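/- **Setting.** Let $m\ge 0$ and let $\theta=(d,\Gamma,A,B)$ denote a parameter with $d\in\mathbb R^2$, $\Gamma\in\mathbb R^{2\times m}$, $A,B\in\mathbb R^{2\times 2}$. Let $\Phi$ be the standard Gaussian distribution function, $\rho$ the spectral radius, $|x|_1=\sum_i|x_i|$, and, for $|r|<1$, let $$c_r(u)=\det(R)^{-1/2}\exp\Big(-\tfrac12\,\Phi^{-1}(u)'(R^{-1}-I)\Phi^{-1}(u)\Big),\quad u\in(0,1)^2,\qquad R=\begin{pmatrix}1&r\\ r&1\end{pmatrix},$$ be the density of the Gaussian copula ($\Phi^{-1}$ applied coordinatewise). For $s\ge 0$ let $F_{2,s}$ be the Poisson($s$) distribution function, and $F_{2,s}^{-1}(u)=\inf\{y\in\mathbb N: F_{2,s}(y)\ge u\}$. Let $(U_t)_{t\in\mathbb Z}$ and $(X_t)_{t\in\mathbb Z}$ be processes in $\mathbb R^2$ and $\mathbb R^m$, and $\mathcal F_t=\sigma(U_s,X_s:s\le t)$. Let $\theta_0=(d_0,\Gamma_0,A_0,B_0)$ and let $((Y_t,\lambda_t))_{t\in\mathbb Z}$, with $Y_t\in\mathbb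 R\times\mathbb N$ and $\lambda_t\in\mathbb R_+^2$, be a stationary, $(\mathcal F_t)$-adapted and integrable solution of the GARCH-INGARCH (GAIN) model with standard Gaussian GARCH noise $$Y_{1,t}=\lambda_{1,t}^{1/2}\,\Phi^{-1}(U_{1,t}),\qquad Y_{2,t}=F_{2,\lambda_{2,t}}^{-1}(U_{2,t}),\qquad \lambda_t=d_0+B_0\lambda_{t-1}+A_0\overline Y_{t-1}+\Gamma_0X_{t-1},\qquad \overline Y_t=(Y_{1,t}^2,Y_{2,t})'.$$ **Assumptions.** 1. $((U_t,X_t))_{t\in\mathbb Z}$ is stationary and ergodic, and for every $t$ the vector $U_t$ is independent of $\mathcal F_{t-1}$ and has density $c_{r_0}$ on $(0,1)^2$. 2. $\Theta\ni\theta_0$ is a compact set of parameters such that all $\theta\in\Theta$ have nonnegative entries, $\min(d_1,d_2)\ge d_-$ for a constant $d_->0$, $\rho(B)<1$, and $\Gamma X_t$ has a.s. nonnegative coordinates for every $t$ (as is the case for nonnegative covariates). The set $K\subset(-1,1)$ is compact and $r_0\in K$. 3. $\rho(A_0+B_0)<1$, and $\mathbb E|X_0|_1^{1+\delta}<\infty$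 for some $\delta>0$. 4. One of the following holds. Either: if $v\in\mathbb R^m$ and $v'X_1$ is a.s. equal to an $\mathcal F_0\vee\sigma(U_1)$-measurable variable, then $v=0$. Or: the processes $(U_t)_t$ and $(X_t)_t$ are independent and, whenever $\sum_{j\ge1}\Phi_jX_{-j}+c=0$ a.s. (the series being a.s. unconditionally convergent) for matrices $\Phi_j\in\mathbb R^{2\times m}$ and $c\in\mathbb R^2$, then $\Phi_j=0$ for all $j\ge 1$ and $c=0$. 5. If $\theta=(d,\Gamma,A,B)\in\Theta$ and $B^jv=B_0^jv$ for all $j\ge1$ and all column vectors $v$ of $A_0$ and of $\Gamma_0$, then $B=B_0$. **Two-step estimator.** For $\theta\in\Theta$, $t\in\mathbb Z$, let $\lambda_t(\theta)=\sum_{j\ge0}B^j(d+A\overline Y_{t-1-j}+\Gamma X_{t-1-j})$, the stationary solution of $\lambda_t(\theta)=d+B\lambda_{t-1}(\theta)+A\overline Y_{t-1}+\Gamma X_{t-1}$. Let $\overline\lambda_t(\theta)$, $t\ge0$, be the solution of the same recursion started at a deterministic $\overline\lambda_0\in\mathbb R_+^2$. First step: for $n\ge1$, $\hat\theta_n$ is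 any minimizer over $\Theta$ of $$\theta\mapsto\frac1n\sum_{t=1}^n\Big(\frac{Y_{1,t}^2}{\ell_{1,t}(\theta)}+\log \ell_{1,t}(\theta)+\ell_{2,t}(\theta)-Y_{2,t}\log \ell_{2,t}(\theta)\Big),$$ where either $\ell_t(\theta)=\overline\lambda_t(\theta)$ for all $t$ or $\ell_t(\theta)=\lambda_t(\theta)$ for all $t$. Second step: $\hat r_n$ is any maximizer over $K$ of $$r\mapsto\frac1n\sum_{t=1}^n\log p_r\big(Y_t\mid\lambda_t(\hat\theta_n)\big),\qquad p_r(y\mid s)=p_{1}(y_1\mid s_1)\int_{F_{2,s_2}(y_2-1)}^{F_{2,s_2}(y_2)}c_r\big(F_{1,s_1}(y_1),u\big)\,du,$$ where $p_1(\cdot\mid s_1)$ and $F_{1,s_1}$ are the density and the distribution function of $\mathcal N(0,s_1)$ and $F_{2,s_2}(-1)=0$. **Conclusion.** The estimator of the copula correlation is strongly consistent: $$\lim_{n\to\infty}\hat r_n=r_0\quad\text{a.s.}$$ -/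

import Mathlib

open MeasureTheory ProbabilityTheory Filter Topology Matrix

noncomputable section

namespace GAIN

/-! ### Stationary and ergodic processes indexed by the integers -/

/-- The left shift on trajectories indexed by `ℤ`. -/
def shift {S : Type*} (x : ℤ → S) : ℤ → S := fun t => x (t + 1)

/-- The law of the whole trajectory of a process, a measure on `ℤ → S`. -/
def processLaw {Ω S : Type*} [MeasurableSpace Ω] [MeasurableSpace S] (P : Measure Ω)
    (Z : ℤ → Ω → S) : Measure (ℤ → S) :=
  P.map (fun ω t => Z t ω)

/-- Strict stationarity: the law of the trajectory is invariant under the shift. -/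
def IsStationary {Ω S : Type*} [MeasurableSpace Ω] [MeasurableSpace S] (P : Measure Ω)
    (Z : ℤ → Ω → S) : Prop :=
  MeasurePreserving shift (processLaw P Z) (processLaw P Z)

/-- Stationarity and ergodicity: the shift preserves the law of the trajectory and
shift-invariant events have probability zero or one. -/
def IsStationaryErgodic {Ω S : Type*} [MeasurableSpace Ω] [MeasurableSpace S] (P : Measure Ω)
    (Z : ℤ → Ω → S) : Prop :=
  Ergodic shift (processLaw P Z)

/-- The sigma-field `ℱ t` generated by `(U s, X s)`, `s ≤ t`. -/
@[reducible] def past {Ω : Type*} {m : ℕ} (U : ℤ → Ω → Fin 2 → ℝ) (X : ℤ → Ω → Fin m → ℝ) (t : ℤ) :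
    MeasurableSpace Ω :=
  ⨆ s : ℤ, ⨆ _ : s ≤ t, MeasurableSpace.comap (fun ω => (U s ω, X s ω)) inferInstance

/-- The noise and covariate process is stationary and ergodic, and the noise at each date is
independent of the past. -/
structure NoiseAssumption {Ω : Type*} [MeasurableSpace Ω] (P : Measure Ω) {m : ℕ}
    (U : ℤ → Ω → Fin 2 → ℝ) (X : ℤ → Ω → Fin m → ℝ) : Prop where
  measurable_noise : ∀ t, Measurable (U t)
  measurable_covariate : ∀ t, Measurable (X t)
  stationary_ergodic : IsStationaryErgodic P (fun t ω => (U t ω, X t ω))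
  indep : ∀ t, Indep (MeasurableSpace.comap (U t) inferInstance) (past U X (t - 1)) P

/-! ### The Gaussian copula -/

/-- The cumulative distribution function of the standard Gaussian distribution. -/
def stdGaussianCDF (x : ℝ) : ℝ := cdf (gaussianReal 0 1) x

/-- The quantile function of the standard Gaussian distribution (meaningful on `(0, 1)`). -/
def stdGaussianQuantile (u : ℝ) : ℝ := sInf {x : ℝ | u ≤ stdGaussianCDF x}

/-- The density, on the open unit cube, of the Gaussian copula with correlation matrix `R`. -/
def gaussianCopulaDensity {ι : Type*} [Fintype ι] [DecidableEq ι] (R : Matrix ι ι ℝ)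
    (u : ι → ℝ) : ℝ :=
  (√R.det)⁻¹ * Real.exp (-(1 / 2) *
    ((fun i => stdGaussianQuantile (u i)) ⬝ᵥ
      ((R⁻¹ - 1) *ᵥ fun i => stdGaussianQuantile (u i))))

/-- The two by two correlation matrix with correlation `r`. -/
def corrMatrix (r : ℝ) : Matrix (Fin 2) (Fin 2) ℝ := !![1, r; r, 1]

/-- The Gaussian copula with correlation matrix `R`, as a measure carried by `(0, 1)ᵏ`. -/
def gaussianCopula {ι : Type*} [Fintype ι] [DecidableEq ι] (R : Matrix ι ι ℝ) :
    Measure (ι → ℝ) :=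
  (volume.restrict (Set.univ.pi fun _ => Set.Ioo 0 1)).withDensity
    (fun u => ENNReal.ofReal (gaussianCopulaDensity R u))

/-! ### Poisson marginals -/

/-- The probability that a Poisson variable with parameter `s` is `< n`.
Thus `poissonLT s (y + 1)` is the distribution function at the integer `y`,
and `poissonLT s y` its left limit at `y`. -/
def poissonLT (s : ℝ) (n : ℕ) : ℝ :=
  ∑ j ∈ Finset.range n, Real.exp (-s) * s ^ j / (j.factorial : ℝ)

/-- The quantile function of the Poisson distribution with parameter `s`
(meaningful for levels `u < 1`). -/
def poissonQuantile (s u : ℝ) : ℕ := sInf {y : ℕ | u ≤ poissonLT s (y + 1)}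

/-! ### The model -/

/-- The parameter `θ = (d, Γ, A, B)`. -/
abbrev Param (m : ℕ) : Type :=
  (Fin 2 → ℝ) × Matrix (Fin 2) (Fin m) ℝ × Matrix (Fin 2) (Fin 2) ℝ × Matrix (Fin 2) (Fin 2) ℝ

/-- The intercept `d`. -/
def Param.d {m : ℕ} (θ : Param m) : Fin 2 → ℝ := θ.1

/-- The covariate coefficients `Γ`. -/
def Param.Γ {m : ℕ} (θ : Param m) : Matrix (Fin 2) (Fin m) ℝ := θ.2.1

/-- The coefficients `A` of the past observations. -/
def Param.A {m : ℕ} (θ : Param m) : Matrix (Fin 2) (Fin 2) ℝ := θ.2.2.1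

/-- The coefficients `B` of the past latent values. -/
def Param.B {m : ℕ} (θ : Param m) : Matrix (Fin 2) (Fin 2) ℝ := θ.2.2.2

/-- The spectral radius of a real square matrix: the largest modulus of its complex
eigenvalues. -/
def specRadius {ι : Type*} [Fintype ι] [DecidableEq ι] (M : Matrix ι ι ℝ) : ENNReal :=
  spectralRadius ℂ (M.map (algebraMap ℝ ℂ))

/-- The vector `(y₁², y₂)` that enters the latent recursion. -/
def obsBar (y : ℝ × ℕ) : Fin 2 → ℝ := ![y.1 ^ 2, (y.2 : ℝ)]

/-- One step of the latent recursion: `d + B s + A ȳ + Γ x`. -/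
def latentStep {m : ℕ} (θ : Param m) (s : Fin 2 → ℝ) (y : ℝ × ℕ) (x : Fin m → ℝ) : Fin 2 → ℝ :=
  θ.d + θ.B *ᵥ s + θ.A *ᵥ obsBar y + θ.Γ *ᵥ x

/-- `((Y t, lam t))` is a stationary, adapted, integrable solution of the GARCH-INGARCH
equations with standard Gaussian GARCH noise and parameter `θ`, driven by the noise `U` and the
covariates `X`. -/
structure IsSolution {Ω : Type*} [MeasurableSpace Ω] (P : Measure Ω) {m : ℕ} (θ : Param m)
    (U : ℤ → Ω → Fin 2 → ℝ) (X : ℤ → Ω → Fin m → ℝ)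
    (Y : ℤ → Ω → ℝ × ℕ) (lam : ℤ → Ω → Fin 2 → ℝ) : Prop where
  adapted_obs : ∀ t, Measurable[past U X t] (Y t)
  adapted_latent : ∀ t, Measurable[past U X t] (lam t)
  stationary : IsStationary P (fun t ω => (Y t ω, lam t ω))
  integrable_garch : ∀ t, Integrable (fun ω => (Y t ω).1) P
  integrable_count : ∀ t, Integrable (fun ω => ((Y t ω).2 : ℝ)) P
  integrable_latent : ∀ t, Integrable (lam t) P
  latent_nonneg : ∀ t, ∀ᵐ ω ∂P, ∀ i, 0 ≤ lam t ω i
  garch_eq : ∀ t, ∀ᵐ ω ∂P, (Y t ω).1 = √(lam t ω 0) * stdGaussianQuantile (U t ω 0)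
  count_eq : ∀ t, ∀ᵐ ω ∂P, (Y t ω).2 = poissonQuantile (lam t ω 1) (U t ω 1)
  latent_eq : ∀ t, ∀ᵐ ω ∂P, lam t ω = latentStep θ (lam (t - 1) ω) (Y (t - 1) ω) (X (t - 1) ω)

/-! ### Latent processes along an observed trajectory -/

/-- The term `Bʲ (d + A ȳ_{t-1-j} + Γ x_{t-1-j})` of the moving average expansion. -/
def latentTerm {m : ℕ} (θ : Param m) (y : ℤ → ℝ × ℕ) (x : ℤ → Fin m → ℝ) (t : ℤ) (j : ℕ) :
    Fin 2 → ℝ :=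
  (θ.B ^ j) *ᵥ (θ.d + θ.A *ᵥ obsBar (y (t - 1 - j)) + θ.Γ *ᵥ x (t - 1 - j))

/-- The latent process `λ_t(θ)` on all of `ℤ`, i.e. the stationary solution of
`λ_t(θ) = d + B λ_{t-1}(θ) + A ȳ_{t-1} + Γ x_{t-1}`. -/
def latent {m : ℕ} (θ : Param m) (y : ℤ → ℝ × ℕ) (x : ℤ → Fin m → ℝ) (t : ℤ) : Fin 2 → ℝ :=
  ∑' j : ℕ, latentTerm θ y x t j

/-- The latent process solves its recursion wherever its expansion converges. -/
theorem latent_eq_latentStep {m : ℕ} (θ : Param m) (y : ℤ → ℝ × ℕ) (x : ℤ → Fin m → ℝ) (t : ℤ)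
    (h : Summable (latentTerm θ y x (t - 1))) :
    latent θ y x t = latentStep θ (latent θ y x (t - 1)) (y (t - 1)) (x (t - 1)) := by
  have hL : Continuous fun v : Fin 2 → ℝ => θ.B *ᵥ v := by fun_prop
  have key : ∀ j : ℕ, latentTerm θ y x t (j + 1) = θ.B *ᵥ latentTerm θ y x (t - 1) j := by
    intro j
    have e : t - 1 - ((j + 1 : ℕ) : ℤ) = t - 1 - 1 - (j : ℤ) := by push_cast; ring
    simp only [latentTerm, e, pow_succ', Matrix.mulVec_mulVec]
  have hs : HasSum (fun j => latentTerm θ y x t (j + 1)) (θ.B *ᵥ latent θ y x (t - 1)) := by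
    simp only [key]
    exact h.hasSum.map (Matrix.mulVecLin θ.B) hL
  have h0 := hs.zero_add.tsum_eq
  rw [latent, h0]
  simp only [latentTerm, latentStep, pow_zero, Matrix.one_mulVec, Nat.cast_zero, sub_zero]
  abel

/-- The computable latent process, started at time `0` from a deterministic value `l₀`. -/
def initLatent {m : ℕ} (l₀ : Fin 2 → ℝ) (θ : Param m) (y : ℤ → ℝ × ℕ) (x : ℤ → Fin m → ℝ) :
    ℕ → Fin 2 → ℝ
  | 0 => l₀
  | t + 1 => latentStep θ (initLatent l₀ θ y x t) (y t) (x t)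

/-! ### First step: pseudo-maximum likelihood for the autoregressive parameter -/

/-- Gaussian quasi-likelihood contrast of the GARCH component. -/
def garchContrast (y s : ℝ) : ℝ := y ^ 2 / s + Real.log s

/-- Poisson likelihood contrast of the count component. -/
def countContrast (y : ℕ) (s : ℝ) : ℝ := s - (y : ℝ) * Real.log s

/-- The criterion `n⁻¹ ∑_{t=1}^n (h₁(y_{1,t}, l_{1,t}) + h₂(y_{2,t}, l_{2,t}))`. -/
def pseudoCriterion (n : ℕ) (y : ℤ → ℝ × ℕ) (l : ℕ → Fin 2 → ℝ) : ℝ :=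
  (n : ℝ)⁻¹ * ∑ t ∈ Finset.Icc 1 n,
    (garchContrast (y t).1 (l t 0) + countContrast (y t).2 (l t 1))

/-- `θ'` minimizes over `Θ` the criterion built on the latent values `l θ t`. -/
def IsPseudoMLE {m : ℕ} (Θ : Set (Param m)) (n : ℕ) (y : ℤ → ℝ × ℕ)
    (l : Param m → ℕ → Fin 2 → ℝ) (θ' : Param m) : Prop :=
  θ' ∈ Θ ∧ IsMinOn (fun θ => pseudoCriterion n y (l θ)) Θ θ'

/-! ### Second step: maximum likelihood for the copula parameter -/

/-- The density `p_r(y | s)`, with respect to the product of the Lebesgue measure and the counting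
measure, of the law with marginals `N(0, s₁)` and Poisson with parameter `s₂` and Gaussian copula
with correlation `r`. -/
def condDensity (r : ℝ) (s : Fin 2 → ℝ) (y : ℝ × ℕ) : ℝ :=
  gaussianPDFReal 0 (s 0).toNNReal y.1 *
    ∫ u in (poissonLT (s 1) y.2)..(poissonLT (s 1) (y.2 + 1)),
      gaussianCopulaDensity (corrMatrix r) ![cdf (gaussianReal 0 (s 0).toNNReal) y.1, u]

/-- The average conditional log-likelihood `n⁻¹ ∑_{t=1}^n log p_r(y_t | λ_t(θ))`. -/
def copulaLogLik {m : ℕ} (n : ℕ) (y : ℤ → ℝ × ℕ) (x : ℤ → Fin m → ℝ) (θ : Param m) (r : ℝ) : ℝ :=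
  (n : ℝ)⁻¹ * ∑ t ∈ Finset.Icc 1 n, Real.log (condDensity r (latent θ y x t) (y t))

/-- `r'` maximizes over `K` the conditional log-likelihood at the autoregressive parameter `θ`. -/
def IsCopulaMLE {m : ℕ} (K : Set ℝ) (n : ℕ) (y : ℤ → ℝ × ℕ) (x : ℤ → Fin m → ℝ)
    (θ : Param m) (r' : ℝ) : Prop :=
  r' ∈ K ∧ IsMaxOn (copulaLogLik n y x θ) K r'

/-! ### Identification assumptions -/

/-- No nontrivial linear combination of the covariates at time `1` is, up to a null set, a
function of the information up to time `0` and of the noise at time `1`. -/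
def CovariateInnovation {Ω : Type*} [MeasurableSpace Ω] (P : Measure Ω) {m : ℕ}
    (U : ℤ → Ω → Fin 2 → ℝ) (X : ℤ → Ω → Fin m → ℝ) : Prop :=
  ∀ v : Fin m → ℝ,
    (∃ g : Ω → ℝ,
      Measurable[past U X 0 ⊔ MeasurableSpace.comap (U 1) inferInstance] g ∧
        (fun ω => v ⬝ᵥ X 1 ω) =ᵐ[P] g) → v = 0

/-- Strict exogeneity, and no nontrivial affine relation `∑_{j ≥ 1} Φ_j X_{-j} + c = 0` holds
almost surely. The matrix `Φ j` of the code multiplies the covariates at time `-(j + 1)`. -/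
def StrictExogeneity {Ω : Type*} [MeasurableSpace Ω] (P : Measure Ω) {m : ℕ}
    (U : ℤ → Ω → Fin 2 → ℝ) (X : ℤ → Ω → Fin m → ℝ) : Prop :=
  IndepFun (fun ω t => U t ω) (fun ω t => X t ω) P ∧
    ∀ (Φ : ℕ → Matrix (Fin 2) (Fin m) ℝ) (c : Fin 2 → ℝ),
      (∀ᵐ ω ∂P, HasSum (fun j : ℕ => Φ j *ᵥ X (-((j : ℤ) + 1)) ω) (-c)) →
        (∀ j, Φ j = 0) ∧ c = 0

/-- The matrix `B₀` is the only `B` in the parameter set with `Bʲ v = B₀ʲ v`, `j ≥ 1`, for all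
column vectors `v` of `A₀` and `Γ₀`. -/
def FeedbackIdentified {m : ℕ} (Θ : Set (Param m)) (θ₀ : Param m) : Prop :=
  ∀ θ ∈ Θ, (∀ j : ℕ, 1 ≤ j → θ.B ^ j * θ₀.A = θ₀.B ^ j * θ₀.A ∧ θ.B ^ j * θ₀.Γ = θ₀.B ^ j * θ₀.Γ) →
    θ.B = θ₀.B

end GAIN

end

open GAIN

/-! The second-step likelihood sees `θ` only through the latent values, so it suffices that every
limit point `θ'` of the first-step estimator reproduces the true latent values almost surely.

The noise and the covariates form an ergodic path, and stability of `A₀ + B₀` makes the observations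
a fixed measurable function of that path (`ModelSetting.ae_lam_eq`). Indeed, run the model from zero
at a remote date with the same noise: given the past, the mean distance between two copies of `(y₁²,
y₂)` equals the distance between their latent values, so `A₀ + B₀` contracts the error. Everything
can then be done on path space, where both criteria are averages along the shift, up to an
asymptotically negligible error when the first-step recursion is started at `l₀`. An ergodic theorem
with values in continuous functions on a compact space (`ae_tendsto_uniform_average`) gives uniform
convergence to continuous limits as soon as there are integrable envelopes.

The envelopes have three sources. Powers of `B` decay geometrically, uniformly over `Θ`. The
logarithmic Poisson terms cost `y log y`, which is paid by a moment of order slightly larger than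
one (`ModelSetting.exists_memLp_obsBar`). The copula term needs a lower bound for the probability of
a count given the Gaussian score (`exists_neg_log_cellProb_le`).

The limits are identified by conditioning on the past. The inequality `log x ≤ x - 1` shows that the
mean contrast is minimal only at the true latent values
(`ModelSetting.ae_pathLatent_eq_of_integral_le`). At these values the log-likelihoods at `r` and
`r₀` differ by the logarithm of a ratio of mean one. If `r` does at least as well as `r₀`, this
ratio is identically one, and the probability of the count zero then forces `r = r₀`
(`ModelSetting.eq_of_integral_condLogDensity_le`). Compactness of `Θ` and `K` concludes
(`ModelSetting.ae_tendsto_rhat`). -/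

open GAIN

set_option linter.unusedSectionVars false

/-! ### Pointwise and uniform ergodic theorems. -/

section Birkhoff

variable {S : Type*} {T : S → S}

/-- The running maximum of `0` and the Birkhoff sums, defined by its recursion. -/
def birkhoffMax (T : S → S) (f : S → ℝ) : ℕ → S → ℝ
  | 0, _ => 0
  | n + 1, x => max 0 (f x + birkhoffMax T f n (T x))

theorem birkhoffMax_nonneg (f : S → ℝ) (n : ℕ) (x : S) : 0 ≤ birkhoffMax T f n x := by
  cases n with
  | zero => exact le_rfl
  | succ n => exact le_max_left _ _

theorem birkhoffMax_le_succ (f : S → ℝ) (n : ℕ) (x : S) :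
    birkhoffMax T f n x ≤ birkhoffMax T f (n + 1) x := by
  induction n generalizing x with
  | zero => exact birkhoffMax_nonneg f 1 x
  | succ n ih => exact max_le_max le_rfl (by gcongr; exact ih (T x))

theorem birkhoffSum_le_birkhoffMax (f : S → ℝ) (n : ℕ) (x : S) :
    birkhoffSum T f n x ≤ birkhoffMax T f n x := by
  induction n generalizing x with
  | zero => simp [birkhoffMax]
  | succ n ih =>
    rw [birkhoffSum_succ']
    exact (add_le_add le_rfl (ih (T x))).trans (le_max_right _ _)

/-- Passing from `T x` to `x` changes the maxima by the finite amount `f x`, so unboundedness is a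
`T`-invariant event, to which ergodicity applies. -/
theorem birkhoffMax_unbounded_iff (f : S → ℝ) (x : S) :
    (∀ C : ℕ, ∃ n, (C : ℝ) < birkhoffMax T f n (T x)) ↔
      ∀ C : ℕ, ∃ n, (C : ℝ) < birkhoffMax T f n x := by
  constructor
  · intro h C
    obtain ⟨D, hD⟩ := exists_nat_gt ((C : ℝ) - f x)
    obtain ⟨n, hn⟩ := h D
    exact ⟨n + 1, lt_of_lt_of_le (by linarith) (le_max_right _ _)⟩
  · intro h C
    obtain ⟨D, hD⟩ := exists_nat_gt ((C : ℝ) + |f x|)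
    obtain ⟨n, hn⟩ := h D
    have h2 := hn.trans_le (birkhoffMax_le_succ f n x)
    refine ⟨n, ?_⟩
    rcases lt_max_iff.1 h2 with h3 | h3
    · have : (0 : ℝ) ≤ D := Nat.cast_nonneg D
      linarith
    · linarith [le_abs_self (f x)]

theorem norm_birkhoffAverage_sub_le {E : Type*} [NormedAddCommGroup E] [NormedSpace ℝ E] (f g : S → E) (n : ℕ) (x : S) :
    ‖birkhoffAverage ℝ T f n x - birkhoffAverage ℝ T g n x‖ ≤
      birkhoffAverage ℝ T (fun y => ‖f y - g y‖) n x := by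
  simp only [birkhoffAverage, birkhoffSum, ← smul_sub, ← Finset.sum_sub_distrib, norm_smul,
    smul_eq_mul]
  rw [Real.norm_of_nonneg (by positivity)]
  gcongr
  exact norm_sum_le _ _

variable [MeasurableSpace S] {μ : Measure S}

theorem integrable_birkhoffMax [IsFiniteMeasure μ] (hT : MeasurePreserving T μ μ) {f : S → ℝ}
    (hf : Integrable f μ) (n : ℕ) : Integrable (birkhoffMax T f n) μ := by
  induction n with
  | zero => exact integrable_zero _ _ _
  | succ n ih =>
    have h := hf.add (hT.integrable_comp_of_integrable ih)
    exact (integrable_zero S ℝ μ).sup h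

theorem measurable_birkhoffMax (hT : Measurable T) {f : S → ℝ}
    (hf : Measurable f) (n : ℕ) : Measurable (birkhoffMax T f n) := by
  induction n with
  | zero => exact measurable_const
  | succ n ih => exact measurable_const.max (hf.add (ih.comp hT))

/-- Birkhoff sums of a function with negative mean are almost surely bounded above. -/
theorem ae_birkhoffSum_bddAbove [IsProbabilityMeasure μ] (hT : Ergodic T μ) {f : S → ℝ}
    (hfm : Measurable f) (hf : Integrable f μ) (hneg : ∫ x, f x ∂μ < 0) :
    ∀ᵐ x ∂μ, ∃ C : ℝ, ∀ n, birkhoffSum T f n x ≤ C := by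
  set A : Set S := {x | ∀ C : ℕ, ∃ n, (C : ℝ) < birkhoffMax T f n x} with hA
  have hAm : MeasurableSet A := by
    have : A = ⋂ C : ℕ, ⋃ n, {x | (C : ℝ) < birkhoffMax T f n x} := by
      ext x; simp [hA]
    rw [this]
    exact MeasurableSet.iInter fun C => MeasurableSet.iUnion fun n =>
      measurableSet_lt measurable_const (measurable_birkhoffMax hT.measurable hfm n)
  have hTA : T ⁻¹' A = A := by
    ext x; exact birkhoffMax_unbounded_iff f x
  rcases hT.ae_mem_or_ae_notMem hAm hTA with h | h
  · exfalso
    -- The difference is the maximum of `f x` and `-birkhoffMax T f n (T x)`. It is dominated by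
    -- `|f|`, and it equals `f x` once the running maximum at `T x` exceeds `-f x`, which happens on
    -- the invariant event.
    have hlim : Tendsto (fun n => ∫ x, (birkhoffMax T f (n + 1) x - birkhoffMax T f n (T x)) ∂μ)
        atTop (𝓝 (∫ x, f x ∂μ)) := by
      refine tendsto_integral_of_dominated_convergence (fun x => |f x|) ?_ hf.abs ?_ ?_
      · intro n
        exact ((measurable_birkhoffMax hT.measurable hfm _).sub
          ((measurable_birkhoffMax hT.measurable hfm _).comp hT.measurable)).aestronglyMeasurable
      · intro n
        filter_upwards with x
        have := birkhoffMax_nonneg (T := T) f n (T x)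
        simp only [birkhoffMax, Real.norm_eq_abs]
        rw [abs_le]
        constructor
        · have := le_max_right 0 (f x + birkhoffMax T f n (T x))
          linarith [neg_abs_le (f x)]
        · rcases max_cases 0 (f x + birkhoffMax T f n (T x)) with h | h <;>
            linarith [le_abs_self (f x), abs_nonneg (f x)]
      · filter_upwards [h] with x hx
        obtain ⟨C, hC⟩ := exists_nat_gt (-f x)
        obtain ⟨N, hN⟩ := (birkhoffMax_unbounded_iff f x).2 hx C
        refine tendsto_const_nhds.congr' ?_
        filter_upwards [eventually_ge_atTop N] with n hn
        have h1 : birkhoffMax T f N (T x) ≤ birkhoffMax T f n (T x) :=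
          monotone_nat_of_le_succ (f := fun k => birkhoffMax T f k (T x))
            (fun k => birkhoffMax_le_succ f k _) hn
        simp only [birkhoffMax]
        rw [max_eq_right (by linarith)]
        ring
    -- Monotonicity in `n` and invariance of `μ` make each integral nonnegative, against the
    -- negative mean in the limit.
    have hge : ∀ n, 0 ≤ ∫ x, (birkhoffMax T f (n + 1) x - birkhoffMax T f n (T x)) ∂μ := by
      intro n
      have hi := integrable_birkhoffMax hT.toMeasurePreserving hf
      rw [integral_sub (g := fun x => birkhoffMax T f n (T x)) (hi _)
        (hT.toMeasurePreserving.integrable_comp_of_integrable (hi n))]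
      have : ∫ x, birkhoffMax T f n (T x) ∂μ = ∫ x, birkhoffMax T f n x ∂μ := by
        have h1 : AEStronglyMeasurable (birkhoffMax T f n) (μ.map T) := by
          rw [hT.toMeasurePreserving.map_eq]; exact (hi n).1
        rw [← integral_map hT.measurable.aemeasurable h1, hT.toMeasurePreserving.map_eq]
      rw [this, sub_nonneg]
      exact integral_mono (hi _) (hi _) (fun x => birkhoffMax_le_succ f n x)
    linarith [ge_of_tendsto' hlim hge]
  · filter_upwards [h] with x hx
    simp only [hA, Set.mem_ofPred_eq, not_forall, not_exists, not_lt] at hx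
    obtain ⟨C, hC⟩ := hx
    exact ⟨C, fun n => (birkhoffSum_le_birkhoffMax f n x).trans (hC n)⟩

/-- Centering at `∫ f + ε / 2` gives a negative mean, hence sums bounded by some `C`; for `n > 2 * C
/ ε` the average of the centered function is below `ε / 2`. -/
theorem ae_eventually_birkhoffAverage_lt [IsProbabilityMeasure μ] (hT : Ergodic T μ) {f : S → ℝ}
    (hfm : Measurable f) (hf : Integrable f μ) {ε : ℝ} (hε : 0 < ε) :
    ∀ᵐ x ∂μ, ∀ᶠ n in atTop, birkhoffAverage ℝ T f n x < ∫ x, f x ∂μ + ε := by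
  set c := ∫ x, f x ∂μ + ε / 2 with hc
  have h := ae_birkhoffSum_bddAbove hT (f := fun x => f x - c) (hfm.sub_const _)
    (hf.sub (integrable_const _)) (by
      rw [integral_sub hf (integrable_const _)]; simp [hc]; linarith)
  filter_upwards [h] with x ⟨C, hC⟩
  obtain ⟨N, hN⟩ := exists_nat_gt (2 * C / ε)
  filter_upwards [eventually_gt_atTop N, eventually_gt_atTop 0] with n hn hn0
  have hn0' : (0 : ℝ) < n := by exact_mod_cast hn0
  have h1 : birkhoffSum T (fun x => f x - c) n x = birkhoffSum T f n x - n * c := by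
    simp [birkhoffSum, Finset.sum_sub_distrib]
  have h2 := hC n
  rw [h1] at h2
  have h3 : 2 * C / ε < n := hN.trans (by exact_mod_cast hn)
  rw [div_lt_iff₀ hε] at h3
  rw [birkhoffAverage, smul_eq_mul, inv_mul_lt_iff₀ hn0']
  nlinarith

/-- The pointwise ergodic theorem for real functions. -/
theorem ae_tendsto_birkhoffAverage_real [IsProbabilityMeasure μ] (hT : Ergodic T μ) {f : S → ℝ}
    (hf : Integrable f μ) :
    ∀ᵐ x ∂μ, Tendsto (fun n => birkhoffAverage ℝ T f n x) atTop (𝓝 (∫ x, f x ∂μ)) := by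
  wlog hfm : Measurable f generalizing f
  · have hm := hf.1.aemeasurable
    have hae : f =ᵐ[μ] hm.mk f := hm.ae_eq_mk
    have h := this (f := hm.mk f) (hf.congr hae) hm.measurable_mk
    have h2 : ∀ᵐ x ∂μ, ∀ n, birkhoffAverage ℝ T f n x = birkhoffAverage ℝ T (hm.mk f) n x :=
      ae_all_iff.2 fun n =>
        hT.quasiErgodic.toQuasiMeasurePreserving.birkhoffAverage_ae_eq_of_ae_eq ℝ hae n
    filter_upwards [h, h2] with x hx hx2
    rw [integral_congr_ae hae]
    simpa only [hx2] using hx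
  have h1 : ∀ᵐ x ∂μ, ∀ k : ℕ, ∀ᶠ n in atTop,
      birkhoffAverage ℝ T f n x < ∫ x, f x ∂μ + 1 / ((k : ℝ) + 1) :=
    ae_all_iff.2 fun k => ae_eventually_birkhoffAverage_lt hT hfm hf Nat.one_div_pos_of_nat
  have h2 : ∀ᵐ x ∂μ, ∀ k : ℕ, ∀ᶠ n in atTop,
      birkhoffAverage ℝ T (-f) n x < ∫ x, (-f) x ∂μ + 1 / ((k : ℝ) + 1) :=
    ae_all_iff.2 fun k => ae_eventually_birkhoffAverage_lt hT hfm.neg hf.neg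
      Nat.one_div_pos_of_nat
  filter_upwards [h1, h2] with x hx1 hx2
  rw [Metric.tendsto_atTop']
  intro ε hε
  obtain ⟨k, hk⟩ := exists_nat_one_div_lt hε
  obtain ⟨N, hN⟩ := eventually_atTop.1 ((hx1 k).and (hx2 k))
  refine ⟨N, fun n hn => ?_⟩
  obtain ⟨ha, hb⟩ := hN n hn.le
  have hneg : birkhoffAverage ℝ T (-f) n x = -birkhoffAverage ℝ T f n x := by
    simp [birkhoffAverage, birkhoffSum]
  rw [hneg] at hb
  simp only [Pi.neg_apply, integral_neg] at hb
  rw [Real.dist_eq, abs_lt]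
  constructor <;> linarith

variable {E : Type*} [NormedAddCommGroup E] [NormedSpace ℝ E] [CompleteSpace E]

/-- The pointwise ergodic theorem for Bochner integrable functions. -/
theorem ae_tendsto_birkhoffAverage [IsProbabilityMeasure μ] (hT : Ergodic T μ) {f : S → E}
    (hf : Integrable f μ) :
    ∀ᵐ x ∂μ, Tendsto (fun n => birkhoffAverage ℝ T f n x) atTop (𝓝 (∫ x, f x ∂μ)) := by
  revert f
  apply Integrable.induction (P := fun f : S → E =>
    ∀ᵐ x ∂μ, Tendsto (fun n => birkhoffAverage ℝ T f n x) atTop (𝓝 (∫ x, f x ∂μ)))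
  · intro c s hs _
    have h := ae_tendsto_birkhoffAverage_real hT
      (f := s.indicator fun _ => (1 : ℝ)) ((integrable_const _).indicator hs)
    filter_upwards [h] with x hx
    have h2 := hx.smul_const c
    have e : ∀ y, s.indicator (fun _ => c) y = (s.indicator (fun _ => (1 : ℝ)) y) • c := by
      intro y
      by_cases hy : y ∈ s <;> simp [hy]
    have e1 : ∫ x, s.indicator (fun _ => c) x ∂μ =
        (∫ x, s.indicator (fun _ => (1 : ℝ)) x ∂μ) • c := by
      simp_rw [e]; rw [integral_smul_const]
    rw [e1]
    refine h2.congr fun n => ?_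
    simp only [birkhoffAverage, birkhoffSum, e, ← Finset.sum_smul, smul_assoc]
  · intro f g _ hfi hgi hf hg
    filter_upwards [hf, hg] with x hx hy
    have := hx.add hy
    rw [integral_add' hfi hgi]
    refine this.congr fun n => ?_
    simp [birkhoffAverage, birkhoffSum, Finset.sum_add_distrib]
  · refine isClosed_of_closure_subset fun f hfcl => ?_
    -- A point of the closure is within `1 / (k + 1)` in mean of a function for which the theorem
    -- holds. The real theorem applied to `‖f - g k‖` controls the averaged error, and three errors
    -- of `ε / 4` remain.
    have hk : ∀ k : ℕ, ∃ g : S →₁[μ] E, (∀ᵐ x ∂μ,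
        Tendsto (fun n => birkhoffAverage ℝ T g n x) atTop (𝓝 (∫ x, g x ∂μ))) ∧
        ∫ x, ‖f x - g x‖ ∂μ < 1 / ((k : ℝ) + 1) := by
      intro k
      obtain ⟨g, hg, hd⟩ := Metric.mem_closure_iff.1 hfcl (1 / ((k : ℝ) + 1))
        Nat.one_div_pos_of_nat
      refine ⟨g, hg, ?_⟩
      rw [dist_eq_norm, L1.norm_eq_integral_norm] at hd
      refine lt_of_eq_of_lt (integral_congr_ae ?_) hd
      filter_upwards [Lp.coeFn_sub f g] with x hx
      rw [hx]; rfl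
    choose g hg hgd using hk
    have hfi : Integrable f μ := L1.integrable_coeFn f
    have hgi : ∀ k, Integrable (g k) μ := fun k => L1.integrable_coeFn _
    have h1 : ∀ᵐ x ∂μ, ∀ k, Tendsto (fun n => birkhoffAverage ℝ T (g k) n x) atTop
      (𝓝 (∫ x, g k x ∂μ)) := ae_all_iff.2 hg
    have h2 : ∀ᵐ x ∂μ, ∀ k, Tendsto
        (fun n => birkhoffAverage ℝ T (fun y => ‖f y - g k y‖) n x) atTop
        (𝓝 (∫ x, ‖f x - g k x‖ ∂μ)) := ae_all_iff.2 fun k =>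
      ae_tendsto_birkhoffAverage_real hT ((hfi.sub (hgi k)).norm)
    show ∀ᵐ x ∂μ, _
    filter_upwards [h1, h2] with x hx1 hx2
    rw [Metric.tendsto_atTop']
    intro ε hε
    obtain ⟨k, hk⟩ := exists_nat_one_div_lt (show 0 < ε / 4 by linarith)
    have e1 := (Metric.tendsto_atTop'.1 (hx1 k)) (ε / 4) (by linarith)
    have e2 := (hx2 k).eventually_lt_const ((hgd k).trans hk)
    obtain ⟨N1, hN1⟩ := e1
    obtain ⟨N2, hN2⟩ := eventually_atTop.1 e2
    refine ⟨max N1 N2, fun n hn => ?_⟩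
    have a1 := hN1 n ((le_max_left _ _).trans_lt hn)
    have a2 := hN2 n ((le_max_right _ _).trans hn.le)
    have a3 := norm_birkhoffAverage_sub_le (T := T) f (g k) n x
    have a4 : ‖∫ x, g k x ∂μ - ∫ x, f x ∂μ‖ ≤ ∫ x, ‖f x - g k x‖ ∂μ := by
      rw [← integral_sub (hgi k) hfi]
      refine (norm_integral_le_integral_norm _).trans_eq ?_
      simp_rw [norm_sub_rev]
    have a5 := (hgd k).trans hk
    rw [← dist_eq_norm] at a3 a4
    have t1 := dist_triangle (birkhoffAverage ℝ T f n x) (birkhoffAverage ℝ T (g k) n x)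
      (∫ x, f x ∂μ)
    have t2 := dist_triangle (birkhoffAverage ℝ T (g k) n x) (∫ x, g k x ∂μ) (∫ x, f x ∂μ)
    linarith
  · intro f g hae _ hf
    have h2 : ∀ᵐ x ∂μ, ∀ n, birkhoffAverage ℝ T f n x = birkhoffAverage ℝ T g n x :=
      ae_all_iff.2 fun n =>
        hT.quasiErgodic.toQuasiMeasurePreserving.birkhoffAverage_ae_eq_of_ae_eq ℝ hae n
    filter_upwards [hf, h2] with x hx hx2
    rw [← integral_congr_ae hae]
    simpa only [hx2] using hx

/-- A map into the continuous functions on a compact metric space is strongly measurable when its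
evaluations are measurable. -/
theorem stronglyMeasurable_continuousMap {K : Type*} [TopologicalSpace K] [CompactSpace K] [T2Space K]
    [SecondCountableTopology K]
    {G : S → C(K, ℝ)} (hG : ∀ k, Measurable fun x => G x k) : StronglyMeasurable G := by
  borelize C(K, ℝ)
  suffices h : Measurable G from h.stronglyMeasurable
  have hball : ∀ (g : C(K, ℝ)) (r : ℝ), MeasurableSet (G ⁻¹' Metric.closedBall g r) := by
    intro g r
    by_cases hr : 0 ≤ r
    -- By continuity a uniform bound need only be tested on a countable dense set, so closed balls
    -- pull back to countable intersections of evaluation events.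
    · obtain ⟨D, hDc, hDd⟩ := TopologicalSpace.exists_countable_dense K
      have : G ⁻¹' Metric.closedBall g r = ⋂ d ∈ D, {x | |G x d - g d| ≤ r} := by
        ext x
        simp only [Set.mem_preimage, Metric.mem_closedBall, Set.mem_iInter, Set.mem_ofPred_eq]
        rw [ContinuousMap.dist_le hr]
        constructor
        · intro h d _; exact h d
        · intro h d
          have hc : IsClosed {k | dist (G x k) (g k) ≤ r} :=
            isClosed_le (by fun_prop) continuous_const
          have := hc.closure_subset_iff.2 (fun k hk => h k hk : D ⊆ _)
          exact this (hDd d)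
      rw [this]
      exact MeasurableSet.biInter hDc fun d _ =>
        measurableSet_le ((hG d).sub_const _).abs measurable_const
    · rw [Metric.closedBall_eq_empty.2 (not_le.1 hr)]; simp
  refine measurable_of_isOpen fun O hO => ?_
  -- By separability of `C(K, ℝ)`, an open set is a countable union of closed balls.
  obtain ⟨D, hDc, hDd⟩ := TopologicalSpace.exists_countable_dense C(K, ℝ)
  have : G ⁻¹' O = ⋃ d ∈ D, ⋃ q : ℚ, ⋃ _ : Metric.closedBall d (q : ℝ) ⊆ O,
      G ⁻¹' Metric.closedBall d (q : ℝ) := by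
    ext x
    simp only [Set.mem_preimage, Set.mem_iUnion, exists_prop]
    constructor
    · intro hx
      obtain ⟨ε, hε, hb⟩ := Metric.isOpen_iff.1 hO _ hx
      obtain ⟨q, hq0, hq⟩ := exists_rat_btwn (show (0 : ℝ) < ε / 2 by linarith)
      obtain ⟨d, hd, hdx⟩ := hDd.exists_dist_lt (G x) hq0
      refine ⟨d, hd, q, fun y hy => hb ?_, hdx.le⟩
      have := dist_triangle y d (G x)
      rw [Metric.mem_closedBall] at hy
      rw [Metric.mem_ball]
      rw [dist_comm] at hdx
      linarith
    · rintro ⟨d, _, q, hs, hx⟩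
      exact hs hx
  rw [this]
  exact MeasurableSet.biUnion hDc fun d _ => MeasurableSet.iUnion fun q =>
    MeasurableSet.iUnion fun _ => hball d q

/-- The uniform ergodic theorem over a compact parameter space. -/
theorem ae_tendsto_uniform_average [IsProbabilityMeasure μ] (hT : Ergodic T μ)
    {K : Type*} [TopologicalSpace K] [CompactSpace K] [T2Space K]
    [SecondCountableTopology K] {g : K → S → ℝ} (hg : ∀ k, Measurable (g k))
    {H : S → ℝ} (hH : Integrable H μ)
    (hgH : ∀ᵐ x ∂μ, (Continuous fun k => g k x) ∧ ∀ k, |g k x| ≤ H x) :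
    (Continuous fun k => ∫ x, g k x ∂μ) ∧ (∀ k, Integrable (g k) μ) ∧ ∀ᵐ x ∂μ, TendstoUniformly
      (fun (n : ℕ) k => (n : ℝ)⁻¹ * ∑ t ∈ Finset.Icc 1 n, g k (T^[t] x))
      (fun k => ∫ x, g k x ∂μ) atTop := by
  -- The event of continuity and domination need not be measurable; `S₀` is a measurable subset of
  -- it of full measure, and `G` vanishes outside.
  let S₀ : Set S := (toMeasurable μ {x | (Continuous fun k => g k x) ∧ ∀ k, |g k x| ≤ H x}ᶜ)ᶜ
  have hS₀m : MeasurableSet S₀ := (measurableSet_toMeasurable _ _).compl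
  have hS₀ : ∀ x ∈ S₀, (Continuous fun k => g k x) ∧ ∀ k, |g k x| ≤ H x := fun x hx => by
    by_contra h
    exact hx (subset_toMeasurable _ _ h)
  have hS₀μ : ∀ᵐ x ∂μ, x ∈ S₀ := by
    have h0 := (measure_toMeasurable _).trans (mem_ae_iff.1 hgH)
    refine mem_ae_iff.2 ?_
    rw [show {x | x ∈ S₀}ᶜ = S₀ᶜ from rfl, compl_compl]
    exact h0
  classical
  let G : S → C(K, ℝ) := fun x => if h : x ∈ S₀ then ⟨fun k => g k x, (hS₀ x h).1⟩ else 0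
  have hGe : ∀ x k, G x k = S₀.indicator (g k) x := by
    intro x k
    by_cases h : x ∈ S₀ <;> simp [G, h]
  have hGm : StronglyMeasurable G := stronglyMeasurable_continuousMap fun k => by
    simpa only [hGe] using (hg k).indicator hS₀m
  have hGi : Integrable G μ := by
    refine Integrable.mono' hH.abs hGm.aestronglyMeasurable ?_
    filter_upwards with x
    rw [ContinuousMap.norm_le _ (abs_nonneg _)]
    intro k
    rw [hGe]
    by_cases h : x ∈ S₀
    · simpa [h] using ((hS₀ x h).2 k).trans (le_abs_self _)
    · simp [h]
  have hae : ∀ k, (fun x => G x k) =ᵐ[μ] g k := by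
    intro k
    filter_upwards [hS₀μ] with x hx
    simp [hGe, hx]
  have hint : ∀ k, (∫ x, G x ∂μ) k = ∫ x, g k x ∂μ := by
    intro k
    rw [ContinuousMap.integral_apply hGi, integral_congr_ae (hae k)]
  have hint' : (fun k => ∫ x, g k x ∂μ) = ⇑(∫ x, G x ∂μ) := by
    ext k; exact (hint k).symm
  refine ⟨?_, ?_, ?_⟩
  · rw [hint']; exact (∫ x, G x ∂μ).continuous
  · intro k
    refine Integrable.congr ?_ (hae k)
    exact (ContinuousMap.evalCLM ℝ k).integrable_comp hGi
  · have hmp := hT.toMeasurePreserving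
    -- The sum runs over `t = 1, …, n`, hence the starting point `T x`.
    have h1 : ∀ᵐ x ∂μ, Tendsto (fun n => birkhoffAverage ℝ T G n (T x)) atTop
        (𝓝 (∫ x, G x ∂μ)) :=
      hmp.quasiMeasurePreserving.ae (ae_tendsto_birkhoffAverage hT hGi)
    have h2 : ∀ᵐ x ∂μ, ∀ t : ℕ, T^[t] x ∈ S₀ := ae_all_iff.2 fun t =>
      (hmp.iterate t).quasiMeasurePreserving.ae hS₀μ
    filter_upwards [h1, h2] with x hx hx2
    rw [hint']
    have h3 := ContinuousMap.tendsto_iff_tendstoUniformly.1 hx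
    intro u hu
    filter_upwards [h3 u hu] with n hn k
    convert hn k using 2
    simp only [birkhoffAverage, birkhoffSum, ContinuousMap.smul_apply,
      ContinuousMap.sum_apply, smul_eq_mul]
    congr 1
    clear hn
    induction n with
    | zero => simp
    | succ n ih =>
      rw [Finset.sum_Icc_succ_top (by omega), Finset.sum_range_succ, ih,
        ← Function.iterate_succ_apply, hGe, Set.indicator_of_mem (hx2 _)]

end Birkhoff

/-! ### Uniform geometric decay of matrix powers. -/

section SpectralRadius

/-- Gelfand's formula: `‖a ^ n‖ ^ (1 / n)` tends to the spectral radius. -/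
theorem exists_norm_pow_lt_one {A : Type*} [NormedRing A] [NormedAlgebra ℂ A] [CompleteSpace A]
    {a : A} (ha : spectralRadius ℂ a < 1) : ∃ n, 1 ≤ n ∧ ‖a ^ n‖ < 1 := by
  have h := (spectrum.pow_nnnorm_pow_one_div_tendsto_nhds_spectralRadius a).eventually_lt_const ha
  obtain ⟨n, hn, hn1⟩ := (h.and (eventually_ge_atTop 1)).exists
  refine ⟨n, hn1, ?_⟩
  have hn0 : (0 : ℝ) < 1 / n := by positivity
  have h1 : ((‖a ^ n‖₊ : ENNReal)) < 1 := by
    by_contra hcon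
    exact absurd hn (not_lt.2 (ENNReal.one_le_rpow (not_lt.1 hcon) hn0))
  exact_mod_cast h1

/-- Powers of the elements of a compact set of elements with spectral radius less than one decay
geometrically, uniformly over the set. -/
theorem exists_norm_pow_le_of_isCompact {A : Type*} [NormedRing A] [NormedAlgebra ℂ A]
    [CompleteSpace A] [NormOneClass A] {S : Set A} (hS : IsCompact S)
    (h : ∀ a ∈ S, spectralRadius ℂ a < 1) :
    ∃ C ρ : ℝ, 0 < C ∧ 0 < ρ ∧ ρ < 1 ∧ ∀ a ∈ S, ∀ k : ℕ, ‖a ^ k‖ ≤ C * ρ ^ k := by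
  -- A single power contracts all of `S`: this holds locally by continuity of `a ↦ a ^ n`, and two
  -- exponents merge into their product because powers of a contraction contract.
  have key : ∃ N : ℕ, 1 ≤ N ∧ ∃ q : ℝ, 0 < q ∧ q < 1 ∧ ∀ a ∈ S, ‖a ^ N‖ ≤ q := by
    refine hS.induction_on (p := fun S' => ∃ N : ℕ, 1 ≤ N ∧ ∃ q : ℝ, 0 < q ∧ q < 1 ∧
      ∀ a ∈ S', ‖a ^ N‖ ≤ q) ⟨1, le_rfl, 1 / 2, by norm_num, by norm_num, by simp⟩ ?_ ?_ ?_
    · rintro s t hst ⟨N, hN, q, hq0, hq, hb⟩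
      exact ⟨N, hN, q, hq0, hq, fun a ha => hb a (hst ha)⟩
    · rintro s t ⟨N, hN, q, hq0, hq, hb⟩ ⟨N', hN', q', hq0', hq', hb'⟩
      refine ⟨N * N', Nat.mul_pos hN hN', max q q', lt_max_of_lt_left hq0, max_lt hq hq', ?_⟩
      have aux : ∀ {a : A} {n m : ℕ} {c : ℝ}, 1 ≤ m → c < 1 → ‖a ^ n‖ ≤ c →
          ‖a ^ (n * m)‖ ≤ c := by
        intro a n m c hm hc hac
        rw [pow_mul]
        have hc0 : 0 ≤ c := (norm_nonneg _).trans hac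
        calc ‖(a ^ n) ^ m‖ ≤ ‖a ^ n‖ ^ m := norm_pow_le _ _
          _ ≤ c ^ m := by gcongr
          _ ≤ c := pow_le_of_le_one hc0 hc.le (by omega)
      rintro a (ha | ha)
      · exact (aux hN' hq (hb a ha)).trans (le_max_left _ _)
      · rw [mul_comm]
        exact (aux hN hq' (hb' a ha)).trans (le_max_right _ _)
    · intro a ha
      obtain ⟨n, hn, hlt⟩ := exists_norm_pow_lt_one (h a ha)
      obtain ⟨q, hq1, hq2⟩ := exists_between hlt
      refine ⟨{b | ‖b ^ n‖ ≤ q}, mem_nhdsWithin_of_mem_nhds ?_, n, hn, q,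
        (norm_nonneg _).trans_lt hq1, hq2, fun b hb => hb⟩
      have hc : ContinuousAt (fun b : A => ‖b ^ n‖) a := by fun_prop
      exact (hc.eventually_lt_const hq1).mono fun b hb => hb.le
  obtain ⟨N, hN, q, hq0, hq1, hb⟩ := key
  obtain ⟨R, hR⟩ := hS.isBounded.exists_norm_le
  set R' := max R 1 with hR'
  set ρ := q ^ (1 / (N : ℝ)) with hρ
  have hNpos : (0 : ℝ) < N := by exact_mod_cast hN
  have hρ0 : 0 < ρ := Real.rpow_pos_of_pos hq0 _
  have hρ1 : ρ < 1 := Real.rpow_lt_one hq0.le hq1 (by positivity)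
  have hρN : ρ ^ N = q := by
    rw [hρ, ← Real.rpow_natCast, ← Real.rpow_mul hq0.le, one_div, inv_mul_cancel₀ hNpos.ne',
      Real.rpow_one]
  have hR1 : 1 ≤ R' := le_max_right _ _
  -- Euclidean division of `k` by `N`: the remainder costs at most `R' ^ N`, and rounding `k` down
  -- to a multiple of `N` costs at most `(ρ ^ N)⁻¹`.
  refine ⟨R' ^ N * (ρ ^ N)⁻¹, ρ, by positivity, hρ0, hρ1, fun a ha k => ?_⟩
  have hak : a ^ k = (a ^ N) ^ (k / N) * a ^ (k % N) := by
    rw [← pow_mul, ← pow_add, Nat.div_add_mod]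
  have hlt : k % N < N := Nat.mod_lt _ hN
  have h1 : ‖a ^ (k % N)‖ ≤ R' ^ N := by
    calc ‖a ^ (k % N)‖ ≤ ‖a‖ ^ (k % N) := norm_pow_le _ _
      _ ≤ R' ^ (k % N) := by
        gcongr
        exact (hR a ha).trans (le_max_left _ _)
      _ ≤ R' ^ N := pow_le_pow_right₀ hR1 hlt.le
  have h2 : ‖(a ^ N) ^ (k / N)‖ ≤ (ρ ^ N)⁻¹ * ρ ^ k := by
    calc ‖(a ^ N) ^ (k / N)‖ ≤ ‖a ^ N‖ ^ (k / N) := norm_pow_le _ _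
      _ ≤ (ρ ^ N) ^ (k / N) := by
        rw [hρN]; gcongr; exact hb a ha
      _ ≤ (ρ ^ N)⁻¹ * ρ ^ k := by
        rw [le_inv_mul_iff₀ (by positivity), ← pow_mul, ← pow_add]
        refine pow_le_pow_of_le_one hρ0.le hρ1.le ?_
        have := Nat.div_add_mod k N
        omega
  calc ‖a ^ k‖ ≤ ‖(a ^ N) ^ (k / N)‖ * ‖a ^ (k % N)‖ := by rw [hak]; exact norm_mul_le _ _
    _ ≤ ((ρ ^ N)⁻¹ * ρ ^ k) * R' ^ N := by gcongr
    _ = _ := by ring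

attribute [local instance] Matrix.linftyOpNormedRing Matrix.linftyOpNormedAlgebra

theorem norm_entry_le_linftyOpNorm {ι : Type*} [Fintype ι] [DecidableEq ι] (M : Matrix ι ι ℂ)
    (i j : ι) : ‖M i j‖ ≤ ‖M‖ := by
  rw [Matrix.linfty_opNorm_def]
  have h1 : ‖M i j‖₊ ≤ ∑ j, ‖M i j‖₊ :=
    Finset.single_le_sum (f := fun j => ‖M i j‖₊) (fun _ _ => zero_le) (Finset.mem_univ j)
  have h2 : ∑ j, ‖M i j‖₊ ≤ Finset.univ.sup fun i => ∑ j, ‖M i j‖₊ :=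
    Finset.le_sup (f := fun i => ∑ j, ‖M i j‖₊) (Finset.mem_univ i)
  exact_mod_cast h1.trans h2

/-- Uniform geometric decay of the powers over a compact set of real matrices whose spectral
radii are less than one. -/
theorem exists_abs_pow_entry_le {ι : Type*} [Fintype ι] [DecidableEq ι] [Nonempty ι]
    {S : Set (Matrix ι ι ℝ)} (hS : IsCompact S) (h : ∀ M ∈ S, specRadius M < 1) :
    ∃ C ρ : ℝ, 0 < C ∧ 0 < ρ ∧ ρ < 1 ∧ ∀ M ∈ S, ∀ (k : ℕ) i j, |(M ^ k) i j| ≤ C * ρ ^ k := by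
  let F : Matrix ι ι ℝ → Matrix ι ι ℂ := fun M => M.map (algebraMap ℝ ℂ)
  have hF : Continuous F := by
    refine continuous_matrix fun i j => ?_
    exact Complex.continuous_ofReal.comp (continuous_apply_apply i j)
  obtain ⟨C, ρ, hC, hρ, hρ1, hb⟩ := exists_norm_pow_le_of_isCompact (hS.image hF) (by
    rintro _ ⟨M, hM, rfl⟩
    exact h M hM)
  refine ⟨C, ρ, hC, hρ, hρ1, fun M hM k i j => ?_⟩
  have h1 := (norm_entry_le_linftyOpNorm (F M ^ k) i j).trans (hb _ ⟨M, hM, rfl⟩ k)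
  have h2 : F M ^ k = F (M ^ k) := (map_pow (algebraMap ℝ ℂ).mapMatrix M k).symm
  rw [h2] at h1
  simpa [F] using h1

end SpectralRadius

/-! ### The Gaussian distribution function, its quantile, and the bivariate Gaussian copula. -/

section Gaussian

theorem stdGaussianCDF_eq (x : ℝ) : stdGaussianCDF x = (gaussianReal 0 1).real (Set.Iic x) :=
  cdf_eq_real _ _

theorem ofReal_stdGaussianCDF (x : ℝ) :
    ENNReal.ofReal (stdGaussianCDF x) = gaussianReal 0 1 (Set.Iic x) :=
  ofReal_cdf _ _

theorem strictMono_stdGaussianCDF : StrictMono stdGaussianCDF := by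
  intro a b hab
  rw [stdGaussianCDF_eq, stdGaussianCDF_eq, ← sub_pos]
  have h1 : Set.Iic b = Set.Iic a ∪ Set.Ioc a b := (Set.Iic_union_Ioc_eq_Iic hab.le).symm
  have h2 : Disjoint (Set.Iic a) (Set.Ioc a b) := by
    rw [Set.disjoint_left]; intro x hx hx2; exact absurd hx (not_le.2 hx2.1)
  rw [h1, measureReal_union h2 measurableSet_Ioc, add_sub_cancel_left]
  rw [measureReal_def, ENNReal.toReal_pos_iff]
  refine ⟨pos_iff_ne_zero.2 fun h0 => ?_, measure_lt_top _ _⟩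
  have h3 := gaussianReal_absolutelyContinuous' 0 (one_ne_zero : (1 : NNReal) ≠ 0) h0
  simp at h3
  linarith

theorem continuous_stdGaussianCDF : Continuous stdGaussianCDF := by
  have : NullSingletonClass (gaussianReal 0 1) := nullSingletonClass_gaussianReal one_ne_zero
  rw [continuous_iff_continuousAt]
  intro x
  have hr : ContinuousWithinAt stdGaussianCDF (Set.Ioi x) x :=
    ((cdf (gaussianReal 0 1)).right_continuous x).mono Set.Ioi_subset_Ici_self
  have hl : ContinuousWithinAt stdGaussianCDF (Set.Iio x) x := by
    rw [(strictMono_stdGaussianCDF.monotone).continuousWithinAt_Iio_iff_leftLim_eq]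
    have h := (cdf (gaussianReal 0 1)).measure_singleton x
    rw [measure_cdf, measure_singleton] at h
    have h2 : stdGaussianCDF x - Function.leftLim stdGaussianCDF x ≤ 0 :=
      ENNReal.ofReal_eq_zero.1 h.symm
    exact le_antisymm (strictMono_stdGaussianCDF.monotone.leftLim_le le_rfl) (by linarith)
  exact continuousAt_iff_continuous_left'_right'.2 ⟨hl, hr⟩

theorem tendsto_stdGaussianCDF_atBot : Tendsto stdGaussianCDF atBot (𝓝 0) := tendsto_cdf_atBot _

theorem tendsto_stdGaussianCDF_atTop : Tendsto stdGaussianCDF atTop (𝓝 1) := tendsto_cdf_atTop _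

theorem stdGaussianCDF_pos (x : ℝ) : 0 < stdGaussianCDF x :=
  lt_of_le_of_lt (cdf_nonneg (gaussianReal 0 1) (x - 1)) (strictMono_stdGaussianCDF (by linarith))

theorem stdGaussianCDF_lt_one (x : ℝ) : stdGaussianCDF x < 1 :=
  lt_of_lt_of_le (strictMono_stdGaussianCDF (show x < x + 1 by linarith))
    (cdf_le_one (gaussianReal 0 1) (x + 1))

theorem stdGaussianCDF_mem (x : ℝ) : stdGaussianCDF x ∈ Set.Ioo (0 : ℝ) 1 :=
  ⟨stdGaussianCDF_pos x, stdGaussianCDF_lt_one x⟩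

@[simp]
theorem stdGaussianQuantile_stdGaussianCDF (x : ℝ) :
    stdGaussianQuantile (stdGaussianCDF x) = x := by
  rw [stdGaussianQuantile]
  simp_rw [strictMono_stdGaussianCDF.le_iff_le]
  exact csInf_Ici

theorem exists_stdGaussianCDF_eq {u : ℝ} (hu : u ∈ Set.Ioo (0 : ℝ) 1) :
    ∃ x, stdGaussianCDF x = u := by
  obtain ⟨a, ha⟩ := (tendsto_stdGaussianCDF_atBot.eventually_lt_const hu.1).exists
  obtain ⟨b, hb⟩ := (tendsto_stdGaussianCDF_atTop.eventually_const_lt hu.2).exists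
  exact mem_range_of_exists_le_of_exists_ge continuous_stdGaussianCDF ⟨a, ha.le⟩ ⟨b, hb.le⟩

theorem stdGaussianCDF_stdGaussianQuantile {u : ℝ} (hu : u ∈ Set.Ioo (0 : ℝ) 1) :
    stdGaussianCDF (stdGaussianQuantile u) = u := by
  obtain ⟨x, rfl⟩ := exists_stdGaussianCDF_eq hu
  simp

theorem stdGaussianCDF_le_iff {u : ℝ} (hu : u ∈ Set.Ioo (0 : ℝ) 1) (x : ℝ) :
    stdGaussianCDF x ≤ u ↔ x ≤ stdGaussianQuantile u := by
  rw [← strictMono_stdGaussianCDF.le_iff_le (b := stdGaussianQuantile u),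
    stdGaussianCDF_stdGaussianQuantile hu]

theorem stdGaussianQuantile_le_iff {u : ℝ} (hu : u ∈ Set.Ioo (0 : ℝ) 1) (x : ℝ) :
    stdGaussianQuantile u ≤ x ↔ u ≤ stdGaussianCDF x := by
  rw [← strictMono_stdGaussianCDF.le_iff_le, stdGaussianCDF_stdGaussianQuantile hu]

/-- The set in the infimum is all of `ℝ` for `u ≤ 0` and empty for `u ≥ 1`, and `sInf` is `0` by
convention in both cases. Measurability on the whole line relies on this value. -/
theorem stdGaussianQuantile_of_notMem {u : ℝ} (hu : u ∉ Set.Ioo (0 : ℝ) 1) :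
    stdGaussianQuantile u = 0 := by
  rw [stdGaussianQuantile]
  by_cases h : u ≤ 0
  · have : {x : ℝ | u ≤ stdGaussianCDF x} = Set.univ :=
      Set.eq_univ_of_forall fun x => h.trans (stdGaussianCDF_pos x).le
    rw [this, Real.sInf_univ]
  · have h1 : 1 ≤ u := by
      by_contra h2; exact hu ⟨not_le.1 h, not_le.1 h2⟩
    have : {x : ℝ | u ≤ stdGaussianCDF x} = ∅ :=
      Set.eq_empty_of_forall_notMem fun x hx =>
        absurd ((h1.trans hx).trans_lt (stdGaussianCDF_lt_one x)) (lt_irrefl _)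
    rw [this, Real.sInf_empty]

theorem measurable_stdGaussianQuantile : Measurable stdGaussianQuantile := by
  refine measurable_of_Iic fun a => ?_
  have : stdGaussianQuantile ⁻¹' Set.Iic a =
      (Set.Ioo 0 1 ∩ Set.Iic (stdGaussianCDF a)) ∪ ((Set.Ioo 0 1)ᶜ ∩ {_u | 0 ≤ a}) := by
    ext u
    by_cases hu : u ∈ Set.Ioo (0 : ℝ) 1
    · simp only [Set.mem_preimage, Set.mem_Iic, stdGaussianQuantile_le_iff hu, Set.mem_union,
        Set.mem_inter_iff, hu, Set.mem_compl_iff, true_and, not_true_eq_false, false_and, or_false]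
    · simp only [Set.mem_preimage, Set.mem_Iic, stdGaussianQuantile_of_notMem hu, Set.mem_union,
        Set.mem_inter_iff, hu, Set.mem_compl_iff, true_and, false_and, not_false_eq_true, false_or,
        Set.mem_ofPred_eq]
  rw [this]
  exact (measurableSet_Ioo.inter measurableSet_Iic).union
    (measurableSet_Ioo.compl.inter (MeasurableSet.const _))

theorem continuousOn_stdGaussianQuantile : ContinuousOn stdGaussianQuantile (Set.Ioo 0 1) := by
  intro u hu
  have hu' := stdGaussianCDF_stdGaussianQuantile hu
  rw [ContinuousWithinAt, tendsto_order]
  refine ⟨fun a ha => ?_, fun b hb => ?_⟩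
  · have h1 : stdGaussianCDF a < u := by
      rw [← hu']; exact strictMono_stdGaussianCDF ha
    filter_upwards [self_mem_nhdsWithin, mem_nhdsWithin_of_mem_nhds (lt_mem_nhds h1)] with v hv hv2
    by_contra h
    exact absurd ((stdGaussianQuantile_le_iff hv a).1 (not_lt.1 h)) (not_le.2 hv2)
  · have h1 : u < stdGaussianCDF b := by
      rw [← hu']; exact strictMono_stdGaussianCDF hb
    filter_upwards [self_mem_nhdsWithin, mem_nhdsWithin_of_mem_nhds (gt_mem_nhds h1)] with v hv hv2
    by_contra h
    exact absurd ((stdGaussianCDF_le_iff hv b).2 (not_lt.1 h)) (not_le.2 hv2)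

/-- The probability integral transform of the standard Gaussian distribution. -/
theorem map_stdGaussianCDF :
    (gaussianReal 0 1).map stdGaussianCDF = volume.restrict (Set.Ioo (0 : ℝ) 1) := by
  have hm := continuous_stdGaussianCDF.measurable
  have : IsProbabilityMeasure ((gaussianReal 0 1).map stdGaussianCDF) :=
    Measure.isProbabilityMeasure_map hm.aemeasurable
  refine Measure.ext_of_Iic _ _ fun a => ?_
  rw [Measure.map_apply hm measurableSet_Iic, Measure.restrict_apply measurableSet_Iic]
  rcases le_or_gt a 0 with h0 | h0
  · have h1 : stdGaussianCDF ⁻¹' Set.Iic a = ∅ := Set.eq_empty_of_forall_notMem fun x hx =>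
      absurd (lt_of_lt_of_le (stdGaussianCDF_pos x) hx) (not_lt.2 h0)
    have h2 : Set.Iic a ∩ Set.Ioo (0 : ℝ) 1 = ∅ := Set.eq_empty_of_forall_notMem fun x hx =>
      absurd (hx.2.1.trans_le hx.1) (not_lt.2 h0)
    rw [h1, h2]; simp
  rcases le_or_gt 1 a with h1 | h1
  · have h1' : stdGaussianCDF ⁻¹' Set.Iic a = Set.univ := Set.eq_univ_of_forall fun x =>
      (stdGaussianCDF_lt_one x).le.trans h1
    have h2 : Set.Iic a ∩ Set.Ioo (0 : ℝ) 1 = Set.Ioo 0 1 :=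
      Set.inter_eq_right.2 fun x hx => hx.2.le.trans h1
    rw [h1', h2]; simp
  · have h2 : stdGaussianCDF ⁻¹' Set.Iic a = Set.Iic (stdGaussianQuantile a) := by
      ext x; exact stdGaussianCDF_le_iff ⟨h0, h1⟩ x
    have h3 : Set.Iic a ∩ Set.Ioo (0 : ℝ) 1 = Set.Ioc 0 a := by
      ext x; simp only [Set.mem_inter_iff, Set.mem_Iic, Set.mem_Ioo, Set.mem_Ioc]
      constructor
      · rintro ⟨h, h', _⟩; exact ⟨h', h⟩
      · rintro ⟨h, h'⟩; exact ⟨h', h, h'.trans_lt h1⟩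
    rw [h2, h3, ← ofReal_stdGaussianCDF, stdGaussianCDF_stdGaussianQuantile ⟨h0, h1⟩]
    simp

theorem lintegral_Ioo_eq_gaussian {f : ℝ → ENNReal} (hf : Measurable f) :
    ∫⁻ u in Set.Ioo (0 : ℝ) 1, f u = ∫⁻ x, f (stdGaussianCDF x) ∂gaussianReal 0 1 := by
  rw [← map_stdGaussianCDF, lintegral_map hf continuous_stdGaussianCDF.measurable]

theorem cdf_gaussianReal {m : ℝ} {v : NNReal} (hv : v ≠ 0) (c : ℝ) :
    cdf (gaussianReal m v) c = stdGaussianCDF ((c - m) / √v) := by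
  have hv0 : 0 < √(v : ℝ) := Real.sqrt_pos.2 (by positivity)
  have h1 : (gaussianReal m v).map (fun x => (x - m) / √v) = gaussianReal 0 1 := by
    rw [show (fun x => (x - m) / √(v : ℝ)) = (fun x => x / √(v : ℝ)) ∘ (fun x => x - m) from rfl,
      ← Measure.map_map (by fun_prop) (by fun_prop), gaussianReal_map_sub_const,
      gaussianReal_map_div_const, sub_self, zero_div]
    congr 1
    ext
    simp [hv]
  rw [cdf_eq_real, stdGaussianCDF_eq, ← h1, measureReal_def, measureReal_def,
    Measure.map_apply (by fun_prop) measurableSet_Iic]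
  congr 2
  ext x
  simp only [Set.mem_Iic, Set.mem_preimage]
  rw [div_le_div_iff_of_pos_right hv0, sub_le_sub_iff_right]

theorem cdf_gaussianReal_zero {s : ℝ} (hs : 0 < s) (y : ℝ) :
    cdf (gaussianReal 0 s.toNNReal) y = stdGaussianCDF (y / √s) := by
  rw [cdf_gaussianReal (by simpa using hs), Real.coe_toNNReal _ hs.le, sub_zero]

theorem integral_sq_stdGaussian : ∫ x, x ^ 2 ∂gaussianReal 0 1 = 1 := by
  have h := variance_fun_id_gaussianReal (μ := 0) (v := 1)
  rw [variance_eq_integral (by fun_prop)] at h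
  simpa [integral_id_gaussianReal] using h

theorem integrable_pow_stdGaussian (n : ℕ) : Integrable (fun x => x ^ n) (gaussianReal 0 1) := by
  have h := (memLp_id_gaussianReal (μ := 0) (v := 1) n).integrable_norm_pow'
  refine h.mono' (by fun_prop) (by filter_upwards with x; simp)


/-! ### The bivariate Gaussian copula in Gaussian coordinates -/

/-- The density of the bivariate Gaussian law with correlation `r` with respect to the standard
one. -/
noncomputable def gaussianRatio (r z x : ℝ) : ℝ :=
  (√(1 - r ^ 2))⁻¹ *
    Real.exp (-(r ^ 2 * z ^ 2 - 2 * r * z * x + r ^ 2 * x ^ 2) / (2 * (1 - r ^ 2)))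

/-- The conditional law of the second coordinate given the first one. -/
noncomputable def condGaussian (r z : ℝ) : Measure ℝ :=
  gaussianReal (r * z) (1 - r ^ 2).toNNReal

instance (r z : ℝ) : IsProbabilityMeasure (condGaussian r z) := by
  unfold condGaussian; infer_instance

theorem one_sub_sq_pos {r : ℝ} (hr : r ∈ Set.Ioo (-1 : ℝ) 1) : 0 < 1 - r ^ 2 := by
  nlinarith [hr.1, hr.2]

/-- In Gaussian scores the copula density is the bivariate Gaussian density divided by the product
of its marginals; subtracting `1` from `R⁻¹` removes the marginal exponents. -/
theorem gaussianCopulaDensity_corrMatrix {r : ℝ} (hr : r ∈ Set.Ioo (-1 : ℝ) 1) (u : Fin 2 → ℝ) :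
    gaussianCopulaDensity (corrMatrix r) u =
      gaussianRatio r (stdGaussianQuantile (u 0)) (stdGaussianQuantile (u 1)) := by
  have h := one_sub_sq_pos hr
  have hdet : (corrMatrix r).det = 1 - r ^ 2 := by
    simp [corrMatrix, Matrix.det_fin_two]; ring
  have hinv : (corrMatrix r)⁻¹ - 1 =
      !![r ^ 2 / (1 - r ^ 2), -r / (1 - r ^ 2); -r / (1 - r ^ 2), r ^ 2 / (1 - r ^ 2)] := by
    rw [Matrix.inv_def, hdet, Ring.inverse_eq_inv']
    ext i j
    fin_cases i <;> fin_cases j <;> simp [corrMatrix, Matrix.adjugate_fin_two] <;>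
      field_simp <;> ring
  rw [gaussianCopulaDensity, hdet, hinv, gaussianRatio]
  congr 2
  simp [dotProduct, Matrix.mulVec, Fin.sum_univ_two]
  field_simp
  ring

theorem gaussianRatio_pos {r : ℝ} (hr : r ∈ Set.Ioo (-1 : ℝ) 1) (z x : ℝ) :
    0 < gaussianRatio r z x :=
  mul_pos (inv_pos.2 (Real.sqrt_pos.2 (one_sub_sq_pos hr))) (Real.exp_pos _)

theorem gaussianRatio_comm (r z x : ℝ) : gaussianRatio r z x = gaussianRatio r x z := by
  rw [gaussianRatio, gaussianRatio]; ring_nf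

theorem measurable_gaussianRatio (r : ℝ) :
    Measurable fun p : ℝ × ℝ => gaussianRatio r p.1 p.2 := by
  unfold gaussianRatio; fun_prop

theorem measurable_gaussianRatio_right (r z : ℝ) : Measurable fun x => gaussianRatio r z x := by
  unfold gaussianRatio; fun_prop

/-- Completing the square in `x` yields the conditional law of the second score given the first. -/
theorem gaussianRatio_mul_gaussianPDFReal {r : ℝ} (hr : r ∈ Set.Ioo (-1 : ℝ) 1) (z x : ℝ) :
    gaussianPDFReal 0 1 x * gaussianRatio r z x =
      gaussianPDFReal (r * z) (1 - r ^ 2).toNNReal x := by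
  have h := one_sub_sq_pos hr
  rw [gaussianPDFReal, gaussianPDFReal, gaussianRatio, Real.coe_toNNReal _ h.le]
  rw [Real.sqrt_mul (by positivity) (1 - r ^ 2), mul_inv]
  have e : ∀ a b c d : ℝ, a * b * (c * d) = a * c * (b * d) := fun a b c d => by ring
  rw [e, ← Real.exp_add]
  simp only [NNReal.coe_one, mul_one]
  congr 2
  field_simp
  ring

theorem withDensity_gaussianRatio {r : ℝ} (hr : r ∈ Set.Ioo (-1 : ℝ) 1) (z : ℝ) :
    (gaussianReal 0 1).withDensity (fun x => ENNReal.ofReal (gaussianRatio r z x)) =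
      condGaussian r z := by
  have h := one_sub_sq_pos hr
  rw [condGaussian, gaussianReal_of_var_ne_zero _ one_ne_zero,
    gaussianReal_of_var_ne_zero _ (by simpa using h), ← withDensity_mul _
      (measurable_gaussianPDF 0 1) (measurable_gaussianRatio_right r z).ennreal_ofReal]
  congr 1
  ext x
  rw [Pi.mul_apply, gaussianPDF, gaussianPDF, ← ENNReal.ofReal_mul (gaussianPDFReal_nonneg _ _ _),
    gaussianRatio_mul_gaussianPDFReal hr]

theorem lintegral_condGaussian {r : ℝ} (hr : r ∈ Set.Ioo (-1 : ℝ) 1) (z : ℝ) {f : ℝ → ENNReal}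
    (hf : Measurable f) : ∫⁻ x, f x ∂condGaussian r z =
      ∫⁻ x, ENNReal.ofReal (gaussianRatio r z x) * f x ∂gaussianReal 0 1 := by
  rw [← withDensity_gaussianRatio hr, lintegral_withDensity_eq_lintegral_mul _
    (measurable_gaussianRatio_right r z).ennreal_ofReal hf]
  rfl

theorem measurable_gaussianCopulaDensity {r : ℝ} (hr : r ∈ Set.Ioo (-1 : ℝ) 1) :
    Measurable (gaussianCopulaDensity (corrMatrix r)) := by
  have e : gaussianCopulaDensity (corrMatrix r) = fun u => gaussianRatio r
      (stdGaussianQuantile (u 0)) (stdGaussianQuantile (u 1)) :=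
    funext fun u => gaussianCopulaDensity_corrMatrix hr u
  have h (i : Fin 2) : Measurable fun u : Fin 2 → ℝ => stdGaussianQuantile (u i) :=
    measurable_stdGaussianQuantile.comp (measurable_pi_apply i)
  have h0 := h 0
  have h1 := h 1
  rw [e]
  unfold gaussianRatio
  fun_prop

/-- The probability integral transform and Tonelli disintegrate the copula: a standard score `z`,
then a second score from `condGaussian r z`. Integrals over the noise are computed in these
coordinates. -/
theorem lintegral_gaussianCopula {r : ℝ} (hr : r ∈ Set.Ioo (-1 : ℝ) 1)
    {f : (Fin 2 → ℝ) → ENNReal} (hf : Measurable f) :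
    ∫⁻ u, f u ∂gaussianCopula (corrMatrix r) =
      ∫⁻ z, ∫⁻ x, f ![stdGaussianCDF z, stdGaussianCDF x] ∂condGaussian r z ∂gaussianReal 0 1 := by
  have hΦ := continuous_stdGaussianCDF.measurable
  have hd := (measurable_gaussianCopulaDensity hr).ennreal_ofReal
  rw [gaussianCopula, lintegral_withDensity_eq_lintegral_mul _ hd hf]
  have h1 : (volume : Measure (Fin 2 → ℝ)).restrict (Set.univ.pi fun _ => Set.Ioo 0 1) =
      Measure.pi fun _ => (gaussianReal 0 1).map stdGaussianCDF := by
    rw [map_stdGaussianCDF, volume_pi, Measure.restrict_pi_pi]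
  have : IsProbabilityMeasure ((gaussianReal 0 1).map stdGaussianCDF) :=
    Measure.isProbabilityMeasure_map hΦ.aemeasurable
  have hmp := (measurePreserving_finTwoArrow ((gaussianReal 0 1).map stdGaussianCDF)).symm
  have hg := hd.mul hf
  rw [h1, ← hmp.lintegral_comp hg, Measure.map_prod_map _ _ hΦ hΦ,
    lintegral_map (f := fun a => ((fun x => ENNReal.ofReal (gaussianCopulaDensity (corrMatrix r) x))
      * f) (MeasurableEquiv.finTwoArrow.symm a)) (hg.comp hmp.measurable) (hΦ.prodMap hΦ)]
  refine (lintegral_prod _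
    ((hg.comp hmp.measurable).comp (hΦ.prodMap hΦ)).aemeasurable).trans ?_
  refine lintegral_congr fun z => ?_
  have hfz : Measurable fun x => f ![stdGaussianCDF z, stdGaussianCDF x] := by
    refine hf.comp (measurable_pi_iff.2 fun i => ?_)
    fin_cases i
    · exact measurable_const
    · exact hΦ
  rw [lintegral_condGaussian hr z hfz]
  refine lintegral_congr fun x => ?_
  change ENNReal.ofReal (gaussianCopulaDensity (corrMatrix r)
    ![stdGaussianCDF z, stdGaussianCDF x]) * f ![stdGaussianCDF z, stdGaussianCDF x] = _
  rw [gaussianCopulaDensity_corrMatrix hr]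
  simp

theorem lintegral_gaussianCopula_fst {r : ℝ} (hr : r ∈ Set.Ioo (-1 : ℝ) 1)
    {f : ℝ → ENNReal} (hf : Measurable f) :
    ∫⁻ u, f (u 0) ∂gaussianCopula (corrMatrix r) = ∫⁻ x, f (stdGaussianCDF x) ∂gaussianReal 0 1 := by
  rw [lintegral_gaussianCopula hr (f := fun u => f (u 0)) (hf.comp (measurable_pi_apply 0))]
  simp

/-- After Tonelli, the symmetry of `gaussianRatio` exchanges the two scores. -/
theorem lintegral_gaussianCopula_snd {r : ℝ} (hr : r ∈ Set.Ioo (-1 : ℝ) 1)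
    {f : ℝ → ENNReal} (hf : Measurable f) :
    ∫⁻ u, f (u 1) ∂gaussianCopula (corrMatrix r) = ∫⁻ x, f (stdGaussianCDF x) ∂gaussianReal 0 1 := by
  have hfΦ := hf.comp continuous_stdGaussianCDF.measurable
  rw [lintegral_gaussianCopula hr (f := fun u => f (u 1)) (hf.comp (measurable_pi_apply 1))]
  simp only [Matrix.cons_val_one, Matrix.cons_val_fin_one]
  have h1 : ∀ z, ∫⁻ x, f (stdGaussianCDF x) ∂condGaussian r z =
      ∫⁻ x, ENNReal.ofReal (gaussianRatio r z x) * f (stdGaussianCDF x) ∂gaussianReal 0 1 :=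
    fun z => lintegral_condGaussian hr z hfΦ
  simp_rw [h1]
  rw [lintegral_lintegral_swap
    (((measurable_gaussianRatio r).ennreal_ofReal).mul (hfΦ.comp measurable_snd)).aemeasurable]
  refine lintegral_congr fun x => ?_
  simp_rw [gaussianRatio_comm r _ x]
  rw [lintegral_mul_const _ (measurable_gaussianRatio_right r x).ennreal_ofReal]
  have h2 := lintegral_condGaussian hr x (f := fun _ => 1) measurable_const
  simp only [lintegral_const, measure_univ, mul_one] at h2
  rw [← h2, one_mul]

theorem isProbabilityMeasure_gaussianCopula {r : ℝ} (hr : r ∈ Set.Ioo (-1 : ℝ) 1) :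
    IsProbabilityMeasure (gaussianCopula (corrMatrix r)) := by
  constructor
  have h := lintegral_gaussianCopula_fst hr (f := fun _ => 1) measurable_const
  simpa using h

end Gaussian

/-! ### Poisson moments, quantiles and their monotone coupling. -/

section Poisson

/-- The mass of the Poisson law with parameter `s` at `n`. -/
noncomputable def poissonMass (s : ℝ) (n : ℕ) : ℝ := Real.exp (-s) * s ^ n / (n.factorial : ℝ)

theorem poissonMass_nonneg {s : ℝ} (hs : 0 ≤ s) (n : ℕ) : 0 ≤ poissonMass s n := by
  unfold poissonMass; positivity

theorem poissonMass_pos {s : ℝ} (hs : 0 < s) (n : ℕ) : 0 < poissonMass s n := by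
  unfold poissonMass; positivity

theorem hasSum_poissonMass (s : ℝ) : HasSum (poissonMass s) 1 := by
  have h := (NormedSpace.expSeries_div_hasSum_exp (𝔸 := ℝ) s).mul_left (Real.exp (-s))
  rw [← Real.exp_eq_exp_ℝ, ← Real.exp_add, neg_add_cancel, Real.exp_zero] at h
  refine h.congr_fun fun n => ?_
  simp [poissonMass, mul_div_assoc]

theorem cast_mul_poissonMass_succ (s : ℝ) (n : ℕ) :
    ((n + 1 : ℕ) : ℝ) * poissonMass s (n + 1) = s * poissonMass s n := by
  rw [poissonMass, poissonMass, Nat.factorial_succ, pow_succ]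
  push_cast
  field_simp

theorem hasSum_cast_mul_poissonMass (s : ℝ) : HasSum (fun n : ℕ => (n : ℝ) * poissonMass s n) s := by
  have h := (hasSum_poissonMass s).mul_left s
  simp_rw [← cast_mul_poissonMass_succ, mul_one] at h
  simpa using (hasSum_nat_add_iff (f := fun n : ℕ => (n : ℝ) * poissonMass s n) 1).1 h

theorem hasSum_sq_mul_poissonMass (s : ℝ) :
    HasSum (fun n : ℕ => (n : ℝ) ^ 2 * poissonMass s n) (s ^ 2 + s) := by
  have h := ((hasSum_cast_mul_poissonMass s).add (hasSum_poissonMass s)).mul_left s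
  have e : ∀ n : ℕ, s * ((n : ℝ) * poissonMass s n + poissonMass s n) =
      ((n + 1 : ℕ) : ℝ) ^ 2 * poissonMass s (n + 1) := by
    intro n
    rw [sq, mul_assoc, cast_mul_poissonMass_succ]
    push_cast; ring
  simp_rw [e] at h
  have h2 := (hasSum_nat_add_iff (f := fun n : ℕ => (n : ℝ) ^ 2 * poissonMass s n) 1).1 h
  have e2 : s * (s + 1) + ∑ i ∈ Finset.range 1, (i : ℝ) ^ 2 * poissonMass s i = s ^ 2 + s := by
    rw [Finset.sum_range_one]; push_cast; ring
  rwa [e2] at h2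

theorem poissonLT_zero (s : ℝ) : poissonLT s 0 = 0 := by simp [poissonLT]

theorem poissonLT_succ (s : ℝ) (n : ℕ) : poissonLT s (n + 1) = poissonLT s n + poissonMass s n := by
  rw [poissonLT, Finset.sum_range_succ]; rfl

theorem monotone_poissonLT {s : ℝ} (hs : 0 ≤ s) : Monotone (poissonLT s) :=
  monotone_nat_of_le_succ fun n => by
    rw [poissonLT_succ]; linarith [poissonMass_nonneg hs n]

theorem strictMono_poissonLT {s : ℝ} (hs : 0 < s) : StrictMono (poissonLT s) :=
  strictMono_nat_of_lt_succ fun n => by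
    rw [poissonLT_succ]; linarith [poissonMass_pos hs n]

theorem poissonLT_nonneg {s : ℝ} (hs : 0 ≤ s) (n : ℕ) : 0 ≤ poissonLT s n := by
  rw [← poissonLT_zero s]; exact monotone_poissonLT hs (Nat.zero_le n)

theorem tendsto_poissonLT (s : ℝ) : Tendsto (poissonLT s) atTop (𝓝 1) :=
  (hasSum_poissonMass s).tendsto_sum_nat

theorem poissonLT_le_one {s : ℝ} (hs : 0 ≤ s) (n : ℕ) : poissonLT s n ≤ 1 :=
  (monotone_poissonLT hs).ge_of_tendsto (tendsto_poissonLT s) n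

theorem poissonLT_lt_one {s : ℝ} (hs : 0 < s) (n : ℕ) : poissonLT s n < 1 :=
  (strictMono_poissonLT hs (Nat.lt_succ_self n)).trans_le (poissonLT_le_one hs.le _)

theorem poissonLT_succ_pos {s : ℝ} (hs : 0 < s) (n : ℕ) : 0 < poissonLT s (n + 1) :=
  (poissonLT_nonneg hs.le n).trans_lt (strictMono_poissonLT hs (Nat.lt_succ_self n))

theorem continuous_poissonLT (n : ℕ) : Continuous fun s => poissonLT s n := by
  unfold poissonLT; fun_prop

/-- The derivatives of the masses telescope; the sign of the result gives stochastic monotonicity in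
the intensity. -/
theorem hasDerivAt_poissonLT (n : ℕ) (s : ℝ) :
    HasDerivAt (fun s => poissonLT s (n + 1)) (-poissonMass s n) s := by
  have hm : ∀ k : ℕ, HasDerivAt (fun s => poissonMass s k)
      (-poissonMass s k + Real.exp (-s) * (k * s ^ (k - 1)) / k.factorial) s := by
    intro k
    have h := (((hasDerivAt_neg s).exp).mul (hasDerivAt_pow k s)).div_const (k.factorial : ℝ)
    refine h.congr_deriv ?_
    rw [poissonMass]; ring
  induction n with
  | zero =>
    have h := hm 0
    simp only [poissonLT_succ, poissonLT_zero, zero_add]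
    simpa using h
  | succ n ih =>
    have h := ih.add (hm (n + 1))
    refine (h.congr_of_eventuallyEq (Eventually.of_forall fun x => ?_)).congr_deriv ?_
    · exact poissonLT_succ x (n + 1)
    · rw [poissonMass, poissonMass, Nat.factorial_succ]
      push_cast
      field_simp
      ring

theorem antitoneOn_poissonLT (n : ℕ) : AntitoneOn (fun s => poissonLT s n) (Set.Ici 0) := by
  cases n with
  | zero => simp_rw [poissonLT_zero]; exact antitoneOn_const
  | succ n =>
    refine antitoneOn_of_deriv_nonpos (convex_Ici 0) (continuous_poissonLT _).continuousOn
      (fun s _ => (hasDerivAt_poissonLT n s).differentiableAt.differentiableWithinAt) ?_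
    intro s hs
    rw [interior_Ici] at hs
    rw [(hasDerivAt_poissonLT n s).deriv, neg_nonpos]
    exact poissonMass_nonneg (le_of_lt hs) n

theorem poissonQuantile_le_iff {s u : ℝ} (hs : 0 ≤ s) (hu : u < 1) (y : ℕ) :
    poissonQuantile s u ≤ y ↔ u ≤ poissonLT s (y + 1) := by
  constructor
  · intro h
    have hne : {y : ℕ | u ≤ poissonLT s (y + 1)}.Nonempty := by
      obtain ⟨n, hn⟩ := ((tendsto_poissonLT s).eventually_const_lt hu).exists
      exact ⟨n, hn.le.trans (monotone_poissonLT hs n.le_succ)⟩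
    have h2 : u ≤ poissonLT s (poissonQuantile s u + 1) := Nat.sInf_mem hne
    exact h2.trans (monotone_poissonLT hs (by omega))
  · exact fun h => Nat.sInf_le h

theorem poissonQuantile_eq_iff {s u : ℝ} (hs : 0 ≤ s) (hu : u ∈ Set.Ioo (0 : ℝ) 1) (y : ℕ) :
    poissonQuantile s u = y ↔ u ∈ Set.Ioc (poissonLT s y) (poissonLT s (y + 1)) := by
  rw [le_antisymm_iff, poissonQuantile_le_iff hs hu.2, Set.mem_Ioc, and_comm]
  refine and_congr_left' ?_
  cases y with
  | zero => simp [poissonLT_zero, hu.1]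
  | succ y =>
    rw [Nat.succ_le_iff, ← not_le, poissonQuantile_le_iff hs hu.2, not_le]

theorem poissonQuantile_mono {s s' u : ℝ} (hs : 0 ≤ s) (h : s ≤ s') (hu : u < 1) :
    poissonQuantile s u ≤ poissonQuantile s' u := by
  rw [poissonQuantile_le_iff hs hu]
  exact ((poissonQuantile_le_iff (hs.trans h) hu _).1 le_rfl).trans
    (antitoneOn_poissonLT _ hs (hs.trans h) h)

/-- The second set of the decomposition collects the levels that are never reached, where the
infimum of the empty set is `0`. -/
theorem measurable_poissonQuantile : Measurable fun p : ℝ × ℝ => poissonQuantile p.1 p.2 := by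
  have hk : ∀ k : ℕ, MeasurableSet {p : ℝ × ℝ | p.2 ≤ poissonLT p.1 (k + 1)} := fun k =>
    measurableSet_le measurable_snd ((continuous_poissonLT _).measurable.comp measurable_fst)
  refine measurable_of_Iic fun y => ?_
  have : (fun p : ℝ × ℝ => poissonQuantile p.1 p.2) ⁻¹' Set.Iic y =
      (⋃ k : ℕ, ⋃ _ : k ≤ y, {p : ℝ × ℝ | p.2 ≤ poissonLT p.1 (k + 1)}) ∪
        ⋂ k : ℕ, {p : ℝ × ℝ | p.2 ≤ poissonLT p.1 (k + 1)}ᶜ := by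
    ext p
    simp only [Set.mem_preimage, Set.mem_Iic, Set.mem_union, Set.mem_iUnion, Set.mem_iInter,
      Set.mem_compl_iff, Set.mem_ofPred_eq, exists_prop]
    constructor
    · intro h
      by_cases hne : {y : ℕ | p.2 ≤ poissonLT p.1 (y + 1)}.Nonempty
      · exact Or.inl ⟨_, h, Nat.sInf_mem hne⟩
      · exact Or.inr fun k hk => hne ⟨k, hk⟩
    · rintro (⟨k, hky, hk⟩ | h)
      · exact (Nat.sInf_le hk).trans hky
      · have : {y : ℕ | p.2 ≤ poissonLT p.1 (y + 1)} = ∅ :=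
          Set.eq_empty_of_forall_notMem h
        rw [poissonQuantile, this, Nat.sInf_empty]
        exact Nat.zero_le _
  rw [this]
  exact (MeasurableSet.iUnion fun k => MeasurableSet.iUnion fun _ => hk k).union
    (MeasurableSet.iInter fun k => (hk k).compl)

theorem measurable_poissonQuantile_right (s : ℝ) : Measurable (poissonQuantile s) :=
  measurable_poissonQuantile.comp measurable_prodMk_left

theorem lintegral_poissonQuantile {s : ℝ} (hs : 0 ≤ s) (f : ℕ → ENNReal) :
    ∫⁻ u in Set.Ioo (0 : ℝ) 1, f (poissonQuantile s u) =
      ∑' n, f n * ENNReal.ofReal (poissonMass s n) := by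
  have hm := measurable_poissonQuantile_right s
  rw [← lintegral_map (f := f) (by fun_prop) hm, lintegral_countable']
  refine tsum_congr fun n => ?_
  congr 1
  rw [Measure.map_apply hm (measurableSet_singleton n),
    Measure.restrict_apply (hm (measurableSet_singleton n))]
  have e : poissonQuantile s ⁻¹' {n} ∩ Set.Ioo (0 : ℝ) 1 =
      Set.Ioc (poissonLT s n) (poissonLT s (n + 1)) ∩ Set.Ioo (0 : ℝ) 1 := by
    ext u
    simp only [Set.mem_inter_iff, Set.mem_preimage, Set.mem_singleton_iff]
    exact and_congr_left fun hu => poissonQuantile_eq_iff hs hu n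
  have hv : poissonLT s (n + 1) - poissonLT s n = poissonMass s n := by
    rw [poissonLT_succ]; ring
  rw [e]
  refine le_antisymm ?_ ?_
  · refine (measure_mono Set.inter_subset_left).trans ?_
    rw [Real.volume_Ioc, hv]
  · rw [← hv, ← Real.volume_Ioo]
    refine measure_mono fun u hu => ⟨Set.Ioo_subset_Ioc_self hu, ?_, ?_⟩
    · exact (poissonLT_nonneg hs n).trans_lt hu.1
    · exact hu.2.trans_le (poissonLT_le_one hs _)

theorem lintegral_poissonQuantile_of_hasSum {s c : ℝ} (hs : 0 ≤ s) {f : ℕ → ℝ}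
    (hf : ∀ n, 0 ≤ f n) (h : HasSum (fun n => f n * poissonMass s n) c) :
    ∫⁻ u in Set.Ioo (0 : ℝ) 1, ENNReal.ofReal (f (poissonQuantile s u)) = ENNReal.ofReal c := by
  rw [lintegral_poissonQuantile hs fun n => ENNReal.ofReal (f n), ← h.tsum_eq,
    ENNReal.ofReal_tsum_of_nonneg (fun n => mul_nonneg (hf n) (poissonMass_nonneg hs n)) h.summable]
  exact tsum_congr fun n => (ENNReal.ofReal_mul (hf n)).symm

theorem lintegral_poissonQuantile_cast {s : ℝ} (hs : 0 ≤ s) :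
    ∫⁻ u in Set.Ioo (0 : ℝ) 1, ENNReal.ofReal (poissonQuantile s u) = ENNReal.ofReal s :=
  lintegral_poissonQuantile_of_hasSum hs (fun n => n.cast_nonneg) (hasSum_cast_mul_poissonMass s)

/-- Two Poisson variables coupled by their quantile functions are at mean distance `|s - s'|`. -/
theorem lintegral_abs_poissonQuantile_sub {s s' : ℝ} (hs : 0 ≤ s) (hs' : 0 ≤ s') :
    ∫⁻ u in Set.Ioo (0 : ℝ) 1,
      ENNReal.ofReal |(poissonQuantile s u : ℝ) - poissonQuantile s' u| =
        ENNReal.ofReal |s - s'| := by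
  wlog h : s ≤ s' generalizing s s'
  · rw [abs_sub_comm s s', ← this hs' hs (le_of_not_ge h)]
    simp_rw [abs_sub_comm]
  have hm : Measurable fun u => ENNReal.ofReal (poissonQuantile s u : ℝ) :=
    (measurable_from_top.comp (measurable_poissonQuantile_right s) :
      Measurable fun u => ((poissonQuantile s u : ℕ) : ℝ)).ennreal_ofReal
  -- Quantiles increase with the intensity, so the difference has a constant sign and integrates to
  -- the difference of the means.
  have h1 : ∫⁻ u in Set.Ioo (0 : ℝ) 1, ENNReal.ofReal (poissonQuantile s' u) =
      (∫⁻ u in Set.Ioo (0 : ℝ) 1, ENNReal.ofReal (poissonQuantile s u)) +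
        ∫⁻ u in Set.Ioo (0 : ℝ) 1,
          ENNReal.ofReal |(poissonQuantile s u : ℝ) - poissonQuantile s' u| := by
    rw [← lintegral_add_left hm]
    refine setLIntegral_congr_fun measurableSet_Ioo fun u hu => ?_
    have hle : (poissonQuantile s u : ℝ) ≤ poissonQuantile s' u :=
      by exact_mod_cast poissonQuantile_mono hs h hu.2
    rw [← ENNReal.ofReal_add (Nat.cast_nonneg _) (abs_nonneg _), abs_sub_comm,
      abs_of_nonneg (sub_nonneg.2 hle), add_sub_cancel]
  rw [lintegral_poissonQuantile_cast hs, lintegral_poissonQuantile_cast hs'] at h1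
  have h2 : ENNReal.ofReal s' = ENNReal.ofReal s + ENNReal.ofReal |s - s'| := by
    rw [← ENNReal.ofReal_add hs (abs_nonneg _), abs_sub_comm, abs_of_nonneg (sub_nonneg.2 h),
      add_sub_cancel]
  rw [h2] at h1
  exact ((ENNReal.add_right_inj ENNReal.ofReal_ne_top).1 h1).symm

/-- Weighted arithmetic-geometric means for `x ^ p = x ^ (2 - p) * (x ^ 2) ^ (p - 1)`. -/
theorem rpow_le_mul_add_mul_sq {x p : ℝ} (hx : 0 ≤ x) (hp1 : 1 ≤ p) (hp2 : p ≤ 2) :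
    x ^ p ≤ (2 - p) * x + (p - 1) * x ^ 2 := by
  have h := Real.geom_mean_le_arith_mean2_weighted (w₁ := 2 - p) (w₂ := p - 1) (p₁ := x)
    (p₂ := x ^ 2) (by linarith) (by linarith) hx (by positivity) (by ring)
  refine le_trans (le_of_eq ?_) h
  rw [← Real.rpow_natCast, ← Real.rpow_mul hx, ← Real.rpow_add_of_nonneg hx (by linarith)
    (by push_cast; linarith)]
  congr 1
  push_cast; ring

/-- After division by `c = s + 1` the count has first and second moments both equal to `s / c ≤ 1`,
so interpolation gives the constant one in front of `c ^ p`. A constant near one keeps the later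
moment recursion contracting. -/
theorem lintegral_poissonQuantile_rpow_le {s p : ℝ} (hs : 0 ≤ s) (hp1 : 1 ≤ p) (hp2 : p ≤ 2) :
    ∫⁻ u in Set.Ioo (0 : ℝ) 1, ENNReal.ofReal ((poissonQuantile s u : ℝ) ^ p) ≤
      ENNReal.ofReal ((s + 1) ^ p) := by
  set c := s + 1 with hc
  have hc0 : 0 < c := by linarith
  have hsum : HasSum (fun n : ℕ => c ^ p * ((2 - p) * ((n : ℝ) / c) + (p - 1) * ((n : ℝ) / c) ^ 2) *
      poissonMass s n) (c ^ p * (s / c)) := by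
    have h := (((hasSum_cast_mul_poissonMass s).mul_left ((2 - p) / c)).add
      ((hasSum_sq_mul_poissonMass s).mul_left ((p - 1) / c ^ 2))).mul_left (c ^ p)
    rw [show s ^ 2 + s = s * c by rw [hc]; ring] at h
    have e : c ^ p * (s / c) = c ^ p * ((2 - p) / c * s + (p - 1) / c ^ 2 * (s * c)) := by
      congr 1; field_simp; ring
    rw [e]
    refine h.congr_fun fun n => ?_
    field_simp
  have hnn : ∀ n : ℕ, 0 ≤ c ^ p * ((2 - p) * ((n : ℝ) / c) + (p - 1) * ((n : ℝ) / c) ^ 2) := by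
    intro n
    have : 0 ≤ 2 - p := by linarith
    have : 0 ≤ p - 1 := by linarith
    positivity
  calc _ ≤ ∫⁻ u in Set.Ioo (0 : ℝ) 1, ENNReal.ofReal (c ^ p *
        ((2 - p) * ((poissonQuantile s u : ℝ) / c) +
          (p - 1) * ((poissonQuantile s u : ℝ) / c) ^ 2)) := by
        refine lintegral_mono fun u => ENNReal.ofReal_le_ofReal ?_
        have h := rpow_le_mul_add_mul_sq (x := (poissonQuantile s u : ℝ) / c) (by positivity) hp1 hp2
        calc (poissonQuantile s u : ℝ) ^ p = c ^ p * ((poissonQuantile s u : ℝ) / c) ^ p := by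
              rw [← Real.mul_rpow hc0.le (by positivity), mul_div_cancel₀ _ hc0.ne']
          _ ≤ _ := by gcongr
    _ = ENNReal.ofReal (c ^ p * (s / c)) := lintegral_poissonQuantile_of_hasSum hs hnn hsum
    _ ≤ ENNReal.ofReal (c ^ p) := by
        refine ENNReal.ofReal_le_ofReal (mul_le_of_le_one_right (by positivity) ?_)
        rw [div_le_one hc0]; linarith

end Poisson

/-! ### Standing assumptions, measurability and independence from the past. -/

section Setting

/-- The standing assumptions on the parameter set, the noise, the covariates and the solution. -/
structure ModelSetting {Ω : Type*} [MeasurableSpace Ω] (P : Measure Ω) {m : ℕ}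
    (U : ℤ → Ω → Fin 2 → ℝ) (X : ℤ → Ω → Fin m → ℝ) (Y : ℤ → Ω → ℝ × ℕ) (lam : ℤ → Ω → Fin 2 → ℝ)
    (Θ : Set (Param m)) (θ₀ : Param m) (r₀ dmin δ : ℝ) : Prop where
  compact : IsCompact Θ
  mem : θ₀ ∈ Θ
  corr_mem : r₀ ∈ Set.Ioo (-1 : ℝ) 1
  dmin_pos : 0 < dmin
  dmin_le : ∀ θ ∈ Θ, ∀ i, dmin ≤ θ.d i
  A_nonneg : ∀ θ ∈ Θ, ∀ i j, 0 ≤ θ.A i j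
  B_nonneg : ∀ θ ∈ Θ, ∀ i j, 0 ≤ θ.B i j
  noise : NoiseAssumption P U X
  law : ∀ t, P.map (U t) = gaussianCopula (corrMatrix r₀)
  cov_nonneg : ∀ θ ∈ Θ, ∀ t, ∀ᵐ ω ∂P, ∀ i, 0 ≤ (θ.Γ *ᵥ X t ω) i
  delta_pos : 0 < δ
  moment : Integrable (fun ω => (∑ i, |X 0 ω i|) ^ (1 + δ)) P
  stab : specRadius (θ₀.A + θ₀.B) < 1
  sol : IsSolution P θ₀ U X Y lam
  specB : ∀ θ ∈ Θ, specRadius θ.B < 1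

/-- The values of a path strictly before time `t`, the most recent one first. -/
def pastOf {V : Type*} (w : ℤ → V) (t : ℤ) : ℕ → V := fun j => w (t - 1 - j)

theorem pastOf_zero {V : Type*} (w : ℤ → V) (t : ℤ) : pastOf w t 0 = w (t - 1) := by
  simp [pastOf]

theorem pastOf_tail {V : Type*} (w : ℤ → V) (t : ℤ) :
    (fun j => pastOf w t (j + 1)) = pastOf w (t - 1) := by
  ext j; simp only [pastOf]; congr 1; push_cast; ring

/-- The observation generated by the latent value `s` and the noise `u`. -/
noncomputable def genObs (s u : Fin 2 → ℝ) : ℝ × ℕ :=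
  (√(s 0) * stdGaussianQuantile (u 0), poissonQuantile (s 1) (u 1))

/-- The latent value obtained after `k` steps of the model started from zero. -/
noncomputable def iterLatent {m : ℕ} (θ : Param m) :
    ℕ → (ℕ → (Fin 2 → ℝ) × (Fin m → ℝ)) → Fin 2 → ℝ
  | 0, _ => 0
  | k + 1, p => latentStep θ (iterLatent θ k fun j => p (j + 1))
      (genObs (iterLatent θ k fun j => p (j + 1)) (p 0).1) (p 0).2

/-- The latent value as a function of the infinite past of noise and covariates. -/
noncomputable def statLatent {m : ℕ} (θ : Param m) (p : ℕ → (Fin 2 → ℝ) × (Fin m → ℝ)) :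
    Fin 2 → ℝ :=
  fun i => limsup (fun k => iterLatent θ k p i) atTop

/-! ### Measurability -/

theorem measurable_obsBar : Measurable obsBar := by
  refine measurable_pi_iff.2 fun i => ?_
  fin_cases i
  · exact measurable_fst.pow_const 2
  · have h : Measurable (Nat.cast : ℕ → ℝ) := measurable_from_top
    exact (h.comp measurable_snd : Measurable fun p : ℝ × ℕ => (p.2 : ℝ))

theorem measurable_genObs :
    Measurable fun p : (Fin 2 → ℝ) × (Fin 2 → ℝ) => genObs p.1 p.2 := by
  have h (i : Fin 2) : Measurable fun p : (Fin 2 → ℝ) × (Fin 2 → ℝ) => p.1 i :=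
    (measurable_pi_apply i).comp measurable_fst
  have h' (i : Fin 2) : Measurable fun p : (Fin 2 → ℝ) × (Fin 2 → ℝ) => p.2 i :=
    (measurable_pi_apply i).comp measurable_snd
  refine Measurable.prodMk ?_ ?_
  · exact (h 0).sqrt.mul (measurable_stdGaussianQuantile.comp (h' 0))
  · exact measurable_poissonQuantile.comp ((h 1).prodMk (h' 1))

theorem measurable_mulVec {ι κ : Type*} [Fintype ι] [Fintype κ] (M : Matrix ι κ ℝ) :
    Measurable fun v : κ → ℝ => M *ᵥ v := by
  refine measurable_pi_iff.2 fun i => ?_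
  simp only [Matrix.mulVec, dotProduct]
  exact Finset.measurable_fun_sum _ fun j _ => (measurable_pi_apply j).const_mul _

theorem measurable_latentStep {m : ℕ} (θ : Param m) :
    Measurable fun p : (Fin 2 → ℝ) × (ℝ × ℕ) × (Fin m → ℝ) => latentStep θ p.1 p.2.1 p.2.2 :=
  ((measurable_const.add ((measurable_mulVec θ.B).comp measurable_fst)).add
    ((measurable_mulVec θ.A).comp (measurable_obsBar.comp (measurable_fst.comp measurable_snd)))).add
    ((measurable_mulVec θ.Γ).comp (measurable_snd.comp measurable_snd))

theorem measurable_iterLatent {m : ℕ} (θ : Param m) (k : ℕ) : Measurable (iterLatent θ k) := by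
  induction k with
  | zero => exact measurable_const
  | succ k ih =>
    have ht : Measurable fun (p : ℕ → (Fin 2 → ℝ) × (Fin m → ℝ)) (j : ℕ) => p (j + 1) :=
      measurable_pi_iff.2 fun j => measurable_pi_apply (j + 1)
    have h0 : Measurable fun p : ℕ → (Fin 2 → ℝ) × (Fin m → ℝ) => p 0 := measurable_pi_apply 0
    have hs := ih.comp ht
    have hy := measurable_genObs.comp (hs.prodMk h0.fst)
    have h1 := (measurable_latentStep θ).comp (hs.prodMk (hy.prodMk h0.snd))
    exact h1

theorem measurable_statLatent {m : ℕ} (θ : Param m) : Measurable (statLatent θ) :=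
  measurable_pi_iff.2 fun i => Measurable.limsup fun k =>
    (measurable_pi_apply i).comp (measurable_iterLatent θ k)

/-! ### Independence of the noise from the past -/

theorem obsBar_genObs_zero {s : Fin 2 → ℝ} (hs : 0 ≤ s 0) (u : Fin 2 → ℝ) :
    obsBar (genObs s u) 0 = s 0 * stdGaussianQuantile (u 0) ^ 2 := by
  simp [obsBar, genObs, mul_pow, Real.sq_sqrt hs]

theorem obsBar_genObs_one (s u : Fin 2 → ℝ) :
    obsBar (genObs s u) 1 = poissonQuantile (s 1) (u 1) := by
  simp [obsBar, genObs]

theorem obsBar_nonneg (y : ℝ × ℕ) (i : Fin 2) : 0 ≤ obsBar y i := by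
  fin_cases i
  · exact sq_nonneg _
  · exact Nat.cast_nonneg _

theorem lintegral_gaussianCopula_quantile {r : ℝ} (hr : r ∈ Set.Ioo (-1 : ℝ) 1) {f : ℝ → ENNReal}
    (hf : Measurable f) : ∫⁻ u, f (stdGaussianQuantile (u 0)) ∂gaussianCopula (corrMatrix r) =
      ∫⁻ x, f x ∂gaussianReal 0 1 := by
  rw [lintegral_gaussianCopula_fst hr (f := fun u => f (stdGaussianQuantile u))
    (hf.comp measurable_stdGaussianQuantile)]
  simp

theorem lintegral_gaussianCopula_poisson {r : ℝ} (hr : r ∈ Set.Ioo (-1 : ℝ) 1) (s : ℝ)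
    (f : ℕ → ENNReal) : ∫⁻ u, f (poissonQuantile s (u 1)) ∂gaussianCopula (corrMatrix r) =
      ∫⁻ u in Set.Ioo (0 : ℝ) 1, f (poissonQuantile s u) := by
  have hf : Measurable fun u => f (poissonQuantile s u) :=
    measurable_from_top.comp (measurable_poissonQuantile_right s)
  rw [lintegral_gaussianCopula_snd hr hf, lintegral_Ioo_eq_gaussian hf]

theorem lintegral_sq_stdGaussian : ∫⁻ x, ENNReal.ofReal (x ^ 2) ∂gaussianReal 0 1 = 1 := by
  rw [← ofReal_integral_eq_lintegral_ofReal (integrable_pow_stdGaussian 2)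
    (by filter_upwards with x using sq_nonneg x), integral_sq_stdGaussian, ENNReal.ofReal_one]

theorem lintegral_obsBar_genObs {r : ℝ} (hr : r ∈ Set.Ioo (-1 : ℝ) 1) {s : Fin 2 → ℝ}
    (hs : ∀ i, 0 ≤ s i) (i : Fin 2) :
    ∫⁻ u, ENNReal.ofReal (obsBar (genObs s u) i) ∂gaussianCopula (corrMatrix r) =
      ENNReal.ofReal (s i) := by
  fin_cases i
  · simp only [Fin.zero_eta, Fin.isValue, obsBar_genObs_zero (hs 0), ENNReal.ofReal_mul (hs 0)]
    rw [lintegral_gaussianCopula_quantile hr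
      (f := fun x => ENNReal.ofReal (s 0) * ENNReal.ofReal (x ^ 2)) (by fun_prop),
      lintegral_const_mul _ (by fun_prop), lintegral_sq_stdGaussian, mul_one]
  · simp only [Fin.mk_one, Fin.isValue, obsBar_genObs_one]
    rw [lintegral_gaussianCopula_poisson hr (s 1) (fun n => ENNReal.ofReal (n : ℝ)),
      lintegral_poissonQuantile_cast (hs 1)]

/-- The squared score has mean one and multiplies `s 0` linearly; the counts are coupled by their
quantiles. Equality, with no constant lost, makes `A + B` the contraction matrix. -/
theorem lintegral_abs_obsBar_genObs_sub {r : ℝ} (hr : r ∈ Set.Ioo (-1 : ℝ) 1) {s s' : Fin 2 → ℝ}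
    (hs : ∀ i, 0 ≤ s i) (hs' : ∀ i, 0 ≤ s' i) (i : Fin 2) :
    ∫⁻ u, ENNReal.ofReal |obsBar (genObs s u) i - obsBar (genObs s' u) i|
      ∂gaussianCopula (corrMatrix r) = ENNReal.ofReal |s i - s' i| := by
  fin_cases i
  · simp only [Fin.zero_eta, Fin.isValue, obsBar_genObs_zero (hs 0), obsBar_genObs_zero (hs' 0),
      ← sub_mul, abs_mul, abs_sq, ENNReal.ofReal_mul (abs_nonneg _)]
    rw [lintegral_gaussianCopula_quantile hr
      (f := fun x => ENNReal.ofReal |s 0 - s' 0| * ENNReal.ofReal (x ^ 2)) (by fun_prop),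
      lintegral_const_mul _ (by fun_prop), lintegral_sq_stdGaussian, mul_one]
  · simp only [Fin.mk_one, Fin.isValue, obsBar_genObs_one]
    have hf : Measurable fun u => ENNReal.ofReal
        |(poissonQuantile (s 1) u : ℝ) - poissonQuantile (s' 1) u| := by
      have h1 : Measurable fun u => (poissonQuantile (s 1) u : ℝ) :=
        measurable_from_top.comp (measurable_poissonQuantile_right _)
      have h2 : Measurable fun u => (poissonQuantile (s' 1) u : ℝ) :=
        measurable_from_top.comp (measurable_poissonQuantile_right _)
      exact (h1.sub h2).abs.ennreal_ofReal
    rw [lintegral_gaussianCopula_snd hr hf, ← lintegral_Ioo_eq_gaussian hf,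
      lintegral_abs_poissonQuantile_sub (hs 1) (hs' 1)]

variable {Ω : Type*} [MeasurableSpace Ω] {P : Measure Ω} [IsProbabilityMeasure P] {m : ℕ}
    {U : ℤ → Ω → Fin 2 → ℝ} {X : ℤ → Ω → Fin m → ℝ} {Y : ℤ → Ω → ℝ × ℕ} {lam : ℤ → Ω → Fin 2 → ℝ}
    {Θ : Set (Param m)} {θ₀ : Param m} {r₀ dmin δ : ℝ}

/-- The joint path of noise and covariates. -/
def drivingPath (U : ℤ → Ω → Fin 2 → ℝ) (X : ℤ → Ω → Fin m → ℝ) (ω : Ω) :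
    ℤ → (Fin 2 → ℝ) × (Fin m → ℝ) := fun t => (U t ω, X t ω)

namespace ModelSetting

theorem past_le (h : ModelSetting P U X Y lam Θ θ₀ r₀ dmin δ) (t : ℤ) :
    past U X t ≤ ‹MeasurableSpace Ω› :=
  iSup_le fun s => iSup_le fun _ => measurable_iff_comap_le.1
    ((h.noise.measurable_noise s).prodMk (h.noise.measurable_covariate s))

theorem measurable_drivingPath (h : ModelSetting P U X Y lam Θ θ₀ r₀ dmin δ) :
    Measurable (drivingPath U X) :=
  measurable_pi_iff.2 fun t =>
    (h.noise.measurable_noise t).prodMk (h.noise.measurable_covariate t)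

theorem measurable_pair_past {s t : ℤ} (hst : s ≤ t) :
    Measurable[past U X t] fun ω => (U s ω, X s ω) :=
  measurable_iff_comap_le.2 (le_iSup₂_of_le s hst le_rfl)

theorem measurable_pastOf (t : ℤ) :
    Measurable[past U X (t - 1)] fun ω => pastOf (drivingPath U X ω) t :=
  @measurable_pi_iff _ _ _ (past U X (t - 1)) _ _ |>.2 fun j =>
    measurable_pair_past (by omega)

/-- The joint law of a functional of the past and of the current noise is a product. -/
theorem map_prod_eq (h : ModelSetting P U X Y lam Θ θ₀ r₀ dmin δ) (t : ℤ) {E : Type*}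
    [MeasurableSpace E] {L : Ω → E} (hL : Measurable[past U X (t - 1)] L) :
    P.map (fun ω => (L ω, U t ω)) = (P.map L).prod (gaussianCopula (corrMatrix r₀)) := by
  rw [← h.law t]
  refine IndepFun.map_prod_eq_prod_map_map (hL.mono (h.past_le _) le_rfl).aemeasurable
    (h.noise.measurable_noise t).aemeasurable ?_
  refine (IndepFun_iff_Indep _ _ _).2 ?_
  exact indep_of_indep_of_le_left (h.noise.indep t).symm (measurable_iff_comap_le.1 hL)

/-- Conditioning on the past in Tonelli form: the current noise is integrated out with the
functional of the past frozen. -/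
theorem lintegral_indep (h : ModelSetting P U X Y lam Θ θ₀ r₀ dmin δ) (t : ℤ) {E : Type*}
    [MeasurableSpace E] {L : Ω → E} (hL : Measurable[past U X (t - 1)] L)
    {f : E → (Fin 2 → ℝ) → ENNReal} (hf : Measurable fun p : E × (Fin 2 → ℝ) => f p.1 p.2) :
    ∫⁻ ω, f (L ω) (U t ω) ∂P = ∫⁻ ω, ∫⁻ u, f (L ω) u ∂gaussianCopula (corrMatrix r₀) ∂P := by
  have := isProbabilityMeasure_gaussianCopula h.corr_mem
  have hLm : Measurable L := hL.mono (h.past_le _) le_rfl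
  rw [← lintegral_map (f := fun p : E × (Fin 2 → ℝ) => f p.1 p.2) hf
    (hLm.prodMk (h.noise.measurable_noise t)), h.map_prod_eq t hL, lintegral_prod _ hf.aemeasurable,
    lintegral_map hf.lintegral_prod_right' hLm]

end ModelSetting

theorem map_eq_map_zero_of_isStationary {S : Type*} [MeasurableSpace S] {Z : ℤ → Ω → S}
    (hZ : ∀ t, Measurable (Z t)) (h : IsStationary P Z) (t : ℤ) : P.map (Z t) = P.map (Z 0) := by
  have hZp : Measurable fun ω t => Z t ω := measurable_pi_iff.2 hZ
  have hshift : Measurable (shift : (ℤ → S) → ℤ → S) :=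
    measurable_pi_iff.2 fun t => measurable_pi_apply (t + 1)
  have hstep : ∀ s : ℤ, P.map (Z (s + 1)) = P.map (Z s) := by
    intro s
    have h1 := congrArg (Measure.map fun x : ℤ → S => x s) h.map_eq
    rw [processLaw, Measure.map_map hshift hZp, Measure.map_map (measurable_pi_apply s)
      (hshift.comp hZp), Measure.map_map (measurable_pi_apply s) hZp] at h1
    exact h1
  induction t with
  | zero => rfl
  | succ n ih => rw [hstep, ih]
  | pred n ih => rw [← ih, ← hstep]; congr 2; ring

end Setting

/-! ### The solution as a measurable function of the past of noise and covariates. -/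

section Solution

theorem latentStep_apply {m : ℕ} (θ : Param m) (s : Fin 2 → ℝ) (y : ℝ × ℕ) (x : Fin m → ℝ)
    (i : Fin 2) : latentStep θ s y x i =
      θ.d i + ∑ j, θ.B i j * s j + ∑ j, θ.A i j * obsBar y j + (θ.Γ *ᵥ x) i := by
  simp only [latentStep, Pi.add_apply, Matrix.mulVec, dotProduct]

theorem abs_latentStep_sub_le {m : ℕ} {θ : Param m} (hA : ∀ i j, 0 ≤ θ.A i j)
    (hB : ∀ i j, 0 ≤ θ.B i j) (s s' : Fin 2 → ℝ) (y y' : ℝ × ℕ) (x : Fin m → ℝ) (i : Fin 2) :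
    |latentStep θ s y x i - latentStep θ s' y' x i| ≤
      ∑ j, (θ.B i j * |s j - s' j| + θ.A i j * |obsBar y j - obsBar y' j|) := by
  have e : latentStep θ s y x i - latentStep θ s' y' x i =
      ∑ j, (θ.B i j * (s j - s' j) + θ.A i j * (obsBar y j - obsBar y' j)) := by
    simp only [latentStep_apply, Fin.sum_univ_two]; ring
  rw [e]
  refine (Finset.abs_sum_le_sum_abs _ _).trans (Finset.sum_le_sum fun j _ => ?_)
  refine (abs_add_le _ _).trans ?_
  rw [abs_mul, abs_mul, abs_of_nonneg (hA i j), abs_of_nonneg (hB i j)]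

theorem latentStep_ge {m : ℕ} {θ : Param m} (hA : ∀ i j, 0 ≤ θ.A i j)
    (hB : ∀ i j, 0 ≤ θ.B i j) {s : Fin 2 → ℝ} (hs : ∀ i, 0 ≤ s i) (y : ℝ × ℕ) {x : Fin m → ℝ}
    {i : Fin 2} (hx : 0 ≤ (θ.Γ *ᵥ x) i) : θ.d i ≤ latentStep θ s y x i := by
  rw [latentStep_apply]
  have h1 : 0 ≤ ∑ j, θ.B i j * s j := Finset.sum_nonneg fun j _ => mul_nonneg (hB i j) (hs j)
  have h2 : 0 ≤ ∑ j, θ.A i j * obsBar y j :=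
    Finset.sum_nonneg fun j _ => mul_nonneg (hA i j) (obsBar_nonneg y j)
  linarith

theorem iterLatent_nonneg {m : ℕ} {θ : Param m} (hd : ∀ i, 0 ≤ θ.d i) (hA : ∀ i j, 0 ≤ θ.A i j)
    (hB : ∀ i j, 0 ≤ θ.B i j) (k : ℕ) {p : ℕ → (Fin 2 → ℝ) × (Fin m → ℝ)}
    (hp : ∀ j i, 0 ≤ (θ.Γ *ᵥ (p j).2) i) (i : Fin 2) : 0 ≤ iterLatent θ k p i := by
  induction k generalizing p i with
  | zero => exact le_rfl
  | succ k ih =>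
    exact (hd i).trans (latentStep_ge hA hB (fun i => ih (fun j => hp (j + 1)) i) _ (hp 0 i))

variable {Ω : Type*} [MeasurableSpace Ω] {P : Measure Ω} [IsProbabilityMeasure P] {m : ℕ}
    {U : ℤ → Ω → Fin 2 → ℝ} {X : ℤ → Ω → Fin m → ℝ} {Y : ℤ → Ω → ℝ × ℕ} {lam : ℤ → Ω → Fin 2 → ℝ}
    {Θ : Set (Param m)} {θ₀ : Param m} {r₀ dmin δ : ℝ}

namespace ModelSetting

theorem d_nonneg (h : ModelSetting P U X Y lam Θ θ₀ r₀ dmin δ) {θ : Param m} (hθ : θ ∈ Θ)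
    (i : Fin 2) : 0 ≤ θ.d i := h.dmin_pos.le.trans (h.dmin_le θ hθ i)

theorem measurable_lam (h : ModelSetting P U X Y lam Θ θ₀ r₀ dmin δ) (t : ℤ) :
    Measurable (lam t) := (h.sol.adapted_latent t).mono (h.past_le t) le_rfl

theorem measurable_Y (h : ModelSetting P U X Y lam Θ θ₀ r₀ dmin δ) (t : ℤ) :
    Measurable (Y t) := (h.sol.adapted_obs t).mono (h.past_le t) le_rfl

theorem ae_Y_eq (h : ModelSetting P U X Y lam Θ θ₀ r₀ dmin δ) :
    ∀ᵐ ω ∂P, ∀ t, Y t ω = genObs (lam t ω) (U t ω) := by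
  refine ae_all_iff.2 fun t => ?_
  filter_upwards [h.sol.garch_eq t, h.sol.count_eq t] with ω h1 h2
  exact Prod.ext h1 h2

theorem ae_pastOf_nonneg (h : ModelSetting P U X Y lam Θ θ₀ r₀ dmin δ) {θ : Param m} (hθ : θ ∈ Θ)
    (t : ℤ) : ∀ᵐ ω ∂P, ∀ j i, 0 ≤ (θ.Γ *ᵥ (pastOf (drivingPath U X ω) t j).2) i :=
  ae_all_iff.2 fun _ => h.cov_nonneg θ hθ _

/-- A version of the latent value at time `t` that depends only on the strict past. -/
theorem exists_predictable (h : ModelSetting P U X Y lam Θ θ₀ r₀ dmin δ) (t : ℤ) :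
    ∃ L : Ω → Fin 2 → ℝ, Measurable[past U X (t - 1)] L ∧ lam t =ᵐ[P] L :=
  ⟨fun ω => latentStep θ₀ (lam (t - 1) ω) (Y (t - 1) ω) (X (t - 1) ω),
    (measurable_latentStep θ₀).comp ((h.sol.adapted_latent _).prodMk
      ((h.sol.adapted_obs _).prodMk (measurable_pair_past le_rfl).snd)), h.sol.latent_eq t⟩

theorem map_lam (h : ModelSetting P U X Y lam Θ θ₀ r₀ dmin δ) (t : ℤ) :
    P.map (lam t) = P.map (lam 0) := by
  have h1 := map_eq_map_zero_of_isStationary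
    (fun t => (h.measurable_Y t).prodMk (h.measurable_lam t)) h.sol.stationary t
  have h2 := congrArg (Measure.map Prod.snd) h1
  rwa [Measure.map_map measurable_snd ((h.measurable_Y t).prodMk (h.measurable_lam t)),
    Measure.map_map measurable_snd ((h.measurable_Y 0).prodMk (h.measurable_lam 0))] at h2

theorem map_X (h : ModelSetting P U X Y lam Θ θ₀ r₀ dmin δ) (t : ℤ) :
    P.map (X t) = P.map (X 0) := by
  have hm := fun t => (h.noise.measurable_noise t).prodMk (h.noise.measurable_covariate t)
  have h1 := map_eq_map_zero_of_isStationary hm h.noise.stationary_ergodic.toMeasurePreserving t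
  have h2 := congrArg (Measure.map Prod.snd) h1
  rwa [Measure.map_map measurable_snd (hm t), Measure.map_map measurable_snd (hm 0)] at h2

theorem lintegral_lam (h : ModelSetting P U X Y lam Θ θ₀ r₀ dmin δ) (t : ℤ)
    {f : (Fin 2 → ℝ) → ENNReal} (hf : Measurable f) :
    ∫⁻ ω, f (lam t ω) ∂P = ∫⁻ ω, f (lam 0 ω) ∂P := by
  rw [← lintegral_map hf (h.measurable_lam t), h.map_lam t, lintegral_map hf (h.measurable_lam 0)]

/-- One step of the model contracts the mean distance between two latent values. -/
theorem lintegral_abs_obsBar_sub (h : ModelSetting P U X Y lam Θ θ₀ r₀ dmin δ) (t : ℤ)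
    {L L' : Ω → Fin 2 → ℝ} (hL : Measurable[past U X (t - 1)] L)
    (hL' : Measurable[past U X (t - 1)] L') (hL0 : ∀ᵐ ω ∂P, ∀ i, 0 ≤ L ω i)
    (hL0' : ∀ᵐ ω ∂P, ∀ i, 0 ≤ L' ω i) (i : Fin 2) :
    ∫⁻ ω, ENNReal.ofReal |obsBar (genObs (L ω) (U t ω)) i - obsBar (genObs (L' ω) (U t ω)) i| ∂P =
      ∫⁻ ω, ENNReal.ofReal |L ω i - L' ω i| ∂P := by
  have hmeas (L : ((Fin 2 → ℝ) × (Fin 2 → ℝ)) × (Fin 2 → ℝ) → Fin 2 → ℝ) (hL : Measurable L) :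
      Measurable fun q : ((Fin 2 → ℝ) × (Fin 2 → ℝ)) × (Fin 2 → ℝ) =>
        obsBar (genObs (L q) q.2) i :=
    (measurable_pi_apply i).comp (measurable_obsBar.comp
      (measurable_genObs.comp (hL.prodMk measurable_snd)))
  rw [h.lintegral_indep t (hL.prodMk hL') (f := fun q u =>
    ENNReal.ofReal |obsBar (genObs q.1 u) i - obsBar (genObs q.2 u) i|)
    ((hmeas _ measurable_fst.fst).sub (hmeas _ measurable_fst.snd)).abs.ennreal_ofReal]
  refine lintegral_congr_ae ?_
  filter_upwards [hL0, hL0'] with ω h1 h2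
  exact lintegral_abs_obsBar_genObs_sub h.corr_mem h1 h2 i

/-- Both latent values are fed the same noise and covariates, so the terms in `d` and `Γ` cancel.
`B` acts on the distance itself, and `A` on the distance of the observations, which has the same
mean. -/
theorem lintegral_abs_iterLatent_succ_sub_le (h : ModelSetting P U X Y lam Θ θ₀ r₀ dmin δ) (k : ℕ)
    (t : ℤ) (i : Fin 2) :
    ∫⁻ ω, ENNReal.ofReal |iterLatent θ₀ (k + 1) (pastOf (drivingPath U X ω) (t + 1)) i -
        lam (t + 1) ω i| ∂P ≤
      ∑ j, ENNReal.ofReal ((θ₀.A + θ₀.B) i j) *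
        ∫⁻ ω, ENNReal.ofReal |iterLatent θ₀ k (pastOf (drivingPath U X ω) t) j - lam t ω j| ∂P := by
  have hA := h.A_nonneg θ₀ h.mem
  have hB := h.B_nonneg θ₀ h.mem
  obtain ⟨L', hL'm, hL'⟩ := h.exists_predictable t
  set L : Ω → Fin 2 → ℝ := fun ω => iterLatent θ₀ k (pastOf (drivingPath U X ω) t) with hLdef
  have hLm : Measurable[past U X (t - 1)] L := (measurable_iterLatent θ₀ k).comp (measurable_pastOf t)
  have hL0 : ∀ᵐ ω ∂P, ∀ i, 0 ≤ L ω i := by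
    filter_upwards [h.ae_pastOf_nonneg h.mem t] with ω hω i
    exact iterLatent_nonneg (h.d_nonneg h.mem) hA hB k hω i
  have hL0' : ∀ᵐ ω ∂P, ∀ i, 0 ≤ L' ω i := by
    filter_upwards [h.sol.latent_nonneg t, hL'] with ω h1 h2 i
    rw [← h2]; exact h1 i
  have hLM : Measurable L := hLm.mono (h.past_le _) le_rfl
  have hLM' : Measurable L' := hL'm.mono (h.past_le _) le_rfl
  have hc (L : Ω → Fin 2 → ℝ) (hL : Measurable L) (j : Fin 2) : Measurable fun ω => L ω j :=
    (measurable_pi_apply j).comp hL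
  have hy (L : Ω → Fin 2 → ℝ) (hL : Measurable L) (j : Fin 2) :
      Measurable fun ω => obsBar (genObs (L ω) (U t ω)) j :=
    hc _ (measurable_obsBar.comp (measurable_genObs.comp
      (hL.prodMk (h.noise.measurable_noise t)))) j
  calc _ ≤ ∫⁻ ω, ∑ j, (ENNReal.ofReal (θ₀.B i j) * ENNReal.ofReal |L ω j - L' ω j| +
        ENNReal.ofReal (θ₀.A i j) * ENNReal.ofReal
          |obsBar (genObs (L ω) (U t ω)) j - obsBar (genObs (L' ω) (U t ω)) j|) ∂P := by
        refine lintegral_mono_ae ?_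
        filter_upwards [hL', h.sol.latent_eq (t + 1), h.ae_Y_eq] with ω h1 h2 h3
        have e : lam (t + 1) ω = latentStep θ₀ (L' ω) (genObs (L' ω) (U t ω)) (X t ω) := by
          rw [h2, add_sub_cancel_right, h3, h1]
        have e2 : iterLatent θ₀ (k + 1) (pastOf (drivingPath U X ω) (t + 1)) =
            latentStep θ₀ (L ω) (genObs (L ω) (U t ω)) (X t ω) := by
          rw [iterLatent, pastOf_tail, pastOf_zero, add_sub_cancel_right]
          rfl
        rw [e, e2]
        refine (ENNReal.ofReal_le_ofReal (abs_latentStep_sub_le hA hB _ _ _ _ _ i)).trans_eq ?_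
        rw [ENNReal.ofReal_sum_of_nonneg fun j _ => add_nonneg (mul_nonneg (hB i j) (abs_nonneg _))
          (mul_nonneg (hA i j) (abs_nonneg _))]
        refine Finset.sum_congr rfl fun j _ => ?_
        rw [ENNReal.ofReal_add (mul_nonneg (hB i j) (abs_nonneg _))
          (mul_nonneg (hA i j) (abs_nonneg _)), ENNReal.ofReal_mul (hB i j),
          ENNReal.ofReal_mul (hA i j)]
    _ = ∑ j, ENNReal.ofReal ((θ₀.A + θ₀.B) i j) *
        ∫⁻ ω, ENNReal.ofReal |L ω j - L' ω j| ∂P := by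
        have m1 (j : Fin 2) : Measurable fun ω => ENNReal.ofReal |L ω j - L' ω j| :=
          ((hc L hLM j).sub (hc L' hLM' j)).abs.ennreal_ofReal
        have m2 (j : Fin 2) : Measurable fun ω => ENNReal.ofReal
            |obsBar (genObs (L ω) (U t ω)) j - obsBar (genObs (L' ω) (U t ω)) j| :=
          ((hy L hLM j).sub (hy L' hLM' j)).abs.ennreal_ofReal
        rw [lintegral_finsetSum (f := fun j ω => ENNReal.ofReal (θ₀.B i j) *
          ENNReal.ofReal |L ω j - L' ω j| + ENNReal.ofReal (θ₀.A i j) * ENNReal.ofReal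
          |obsBar (genObs (L ω) (U t ω)) j - obsBar (genObs (L' ω) (U t ω)) j|) _
          fun j _ => ((m1 j).const_mul _).add ((m2 j).const_mul _)]
        refine Finset.sum_congr rfl fun j _ => ?_
        rw [lintegral_add_left ((m1 j).const_mul _), lintegral_const_mul _ (m1 j),
          lintegral_const_mul _ (m2 j), h.lintegral_abs_obsBar_sub t hLm hL'm hL0 hL0' j,
          Matrix.add_apply, ENNReal.ofReal_add (hA i j) (hB i j), add_mul, add_comm]
    _ = _ := by
        refine Finset.sum_congr rfl fun j _ => ?_
        congr 1
        refine lintegral_congr_ae ?_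
        filter_upwards [hL'] with ω hω
        rw [hω]

theorem integrable_lam (h : ModelSetting P U X Y lam Θ θ₀ r₀ dmin δ) (t : ℤ) (i : Fin 2) :
    Integrable (fun ω => lam t ω i) P :=
  (h.sol.integrable_latent t).eval i

/-- The iteration starts from zero, so the initial error is the latent value itself, whose mean does
not depend on the date. -/
theorem lintegral_abs_iterLatent_sub_le (h : ModelSetting P U X Y lam Θ θ₀ r₀ dmin δ) (k : ℕ)
    (t : ℤ) (i : Fin 2) :
    ∫⁻ ω, ENNReal.ofReal |iterLatent θ₀ k (pastOf (drivingPath U X ω) t) i - lam t ω i| ∂P ≤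
      ENNReal.ofReal ((((θ₀.A + θ₀.B) ^ k) *ᵥ fun j => ∫ ω, |lam 0 ω j| ∂P) i) := by
  induction k generalizing t i with
  | zero =>
    simp only [iterLatent, Pi.zero_apply, zero_sub, abs_neg, pow_zero, Matrix.one_mulVec]
    rw [h.lintegral_lam t (f := fun l => ENNReal.ofReal |l i|) (by fun_prop),
      ofReal_integral_eq_lintegral_ofReal (h.integrable_lam 0 i).abs
        (by filter_upwards with ω using abs_nonneg _)]
  | succ k ih =>
    have hM : ∀ i j, 0 ≤ (θ₀.A + θ₀.B) i j := fun i j =>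
      add_nonneg (h.A_nonneg θ₀ h.mem i j) (h.B_nonneg θ₀ h.mem i j)
    have hpow : ∀ k i j, 0 ≤ ((θ₀.A + θ₀.B) ^ k) i j := by
      intro k
      induction k with
      | zero => intro i j; rw [pow_zero, Matrix.one_apply]; positivity
      | succ k ihk =>
        intro i j
        rw [pow_succ, Matrix.mul_apply]
        exact Finset.sum_nonneg fun l _ => mul_nonneg (ihk i l) (hM l j)
    have h1 := h.lintegral_abs_iterLatent_succ_sub_le k (t - 1) i
    rw [sub_add_cancel] at h1
    refine h1.trans ((Finset.sum_le_sum fun j _ => mul_le_mul_right (ih (t - 1) j) _).trans_eq ?_)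
    rw [pow_succ', ← Matrix.mulVec_mulVec]
    conv_rhs => rw [Matrix.mulVec, dotProduct]
    rw [ENNReal.ofReal_sum_of_nonneg]
    · exact Finset.sum_congr rfl fun j _ => (ENNReal.ofReal_mul (hM i j)).symm
    · intro j _
      refine mul_nonneg (hM i j) ?_
      rw [Matrix.mulVec, dotProduct]
      refine Finset.sum_nonneg fun l _ => mul_nonneg (hpow k j l) ?_
      exact integral_nonneg fun ω => abs_nonneg _

/-- The latent process is almost surely a fixed function of the past of noise and covariates. -/
theorem ae_tendsto_iterLatent (h : ModelSetting P U X Y lam Θ θ₀ r₀ dmin δ) :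
    ∀ᵐ ω ∂P, ∀ t i, Tendsto (fun k => iterLatent θ₀ k (pastOf (drivingPath U X ω) t) i) atTop
      (𝓝 (lam t ω i)) := by
  refine ae_all_iff.2 fun t => ae_all_iff.2 fun i => ?_
  obtain ⟨C, ρ, hC, hρ, hρ1, hb⟩ := exists_abs_pow_entry_le
    (S := {θ₀.A + θ₀.B}) isCompact_singleton (by simpa using h.stab)
  set c : Fin 2 → ℝ := fun j => ∫ ω, |lam 0 ω j| ∂P with hc
  have hc0 : ∀ j, 0 ≤ c j := fun j => integral_nonneg fun ω => abs_nonneg _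
  have hm (k : ℕ) : Measurable fun ω => ENNReal.ofReal
      |iterLatent θ₀ k (pastOf (drivingPath U X ω) t) i - lam t ω i| := by
    have h1 : Measurable fun ω => iterLatent θ₀ k (pastOf (drivingPath U X ω) t) :=
      (measurable_iterLatent θ₀ k).comp ((measurable_pastOf t).mono (h.past_le _) le_rfl)
    exact (((measurable_pi_apply i).comp h1).sub
      ((measurable_pi_apply i).comp (h.measurable_lam t))).abs.ennreal_ofReal
  have hle (k : ℕ) : ∫⁻ ω, ENNReal.ofReal
      |iterLatent θ₀ k (pastOf (drivingPath U X ω) t) i - lam t ω i| ∂P ≤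
        ENNReal.ofReal (C * (∑ j, c j) * ρ ^ k) := by
    refine (h.lintegral_abs_iterLatent_sub_le k t i).trans (ENNReal.ofReal_le_ofReal ?_)
    rw [Matrix.mulVec, dotProduct, mul_right_comm, Finset.mul_sum]
    refine Finset.sum_le_sum fun j _ => mul_le_mul_of_nonneg_right ?_ (hc0 j)
    exact (le_abs_self _).trans (hb _ rfl k i j)
  -- The mean errors are summable in `k`, so the errors vanish almost surely and not only in mean.
  have hfin : ∫⁻ ω, ∑' k, ENNReal.ofReal
      |iterLatent θ₀ k (pastOf (drivingPath U X ω) t) i - lam t ω i| ∂P ≠ ⊤ := by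
    rw [lintegral_tsum fun k => (hm k).aemeasurable]
    refine ne_top_of_le_ne_top ?_ (ENNReal.tsum_le_tsum hle)
    have hs : Summable fun k => C * (∑ j, c j) * ρ ^ k :=
      (summable_geometric_of_lt_one hρ.le hρ1).mul_left _
    have hnn : ∀ k, 0 ≤ C * (∑ j, c j) * ρ ^ k := fun k => by
      have := Finset.sum_nonneg fun j (_ : j ∈ Finset.univ) => hc0 j
      positivity
    rw [← ENNReal.ofReal_tsum_of_nonneg hnn hs]
    exact ENNReal.ofReal_ne_top
  filter_upwards [ae_lt_top (Measurable.tsum hm) hfin] with ω hω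
  have h1 := ENNReal.tendsto_atTop_zero_of_tsum_ne_top hω.ne
  rw [tendsto_iff_dist_tendsto_zero]
  have h2 := (ENNReal.tendsto_toReal ENNReal.zero_ne_top).comp h1
  refine h2.congr fun k => ?_
  rw [Function.comp_apply, ENNReal.toReal_ofReal (abs_nonneg _), Real.dist_eq]

/-- The limsup in `statLatent` is measurable on all pasts and agrees with the limit wherever the
latter exists. -/
theorem ae_lam_eq (h : ModelSetting P U X Y lam Θ θ₀ r₀ dmin δ) :
    ∀ᵐ ω ∂P, ∀ t, lam t ω = statLatent θ₀ (pastOf (drivingPath U X ω) t) := by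
  filter_upwards [h.ae_tendsto_iterLatent] with ω hω t
  ext i
  exact (hω t i).limsup_eq.symm

end ModelSetting

end Solution

/-! ### A moment of order larger than one for latent values and observations. -/

section Moments

/-- A bound on the `p`-th moment of the squared Gaussian noise that tends to one as `p` does. -/
noncomputable def noiseMoment (p : ℝ) : ℝ := 1 + (p - 1) * ∫ x, x ^ 4 ∂gaussianReal 0 1

theorem one_le_noiseMoment {p : ℝ} (hp : 1 ≤ p) : 1 ≤ noiseMoment p := by
  have : 0 ≤ ∫ x, x ^ 4 ∂gaussianReal 0 1 := integral_nonneg fun x => by positivity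
  have : 0 ≤ p - 1 := by linarith
  rw [noiseMoment]
  nlinarith [mul_nonneg this ‹0 ≤ ∫ x, x ^ 4 ∂gaussianReal 0 1›]

theorem lintegral_sq_rpow_stdGaussian_le {p : ℝ} (hp1 : 1 ≤ p) (hp2 : p ≤ 2) :
    ∫⁻ x, ENNReal.ofReal ((x ^ 2) ^ p) ∂gaussianReal 0 1 ≤ ENNReal.ofReal (noiseMoment p) := by
  have hi2 := (integrable_pow_stdGaussian 2).const_mul (2 - p)
  have hi4 := (integrable_pow_stdGaussian 4).const_mul (p - 1)
  have hb : ∀ x : ℝ, (x ^ 2) ^ p ≤ (2 - p) * x ^ 2 + (p - 1) * x ^ 4 := fun x => by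
    have := rpow_le_mul_add_mul_sq (sq_nonneg x) hp1 hp2
    rwa [← pow_mul] at this
  calc _ ≤ ∫⁻ x, ENNReal.ofReal ((2 - p) * x ^ 2 + (p - 1) * x ^ 4) ∂gaussianReal 0 1 :=
        lintegral_mono fun x => ENNReal.ofReal_le_ofReal (hb x)
    _ = ENNReal.ofReal (∫ x, ((2 - p) * x ^ 2 + (p - 1) * x ^ 4) ∂gaussianReal 0 1) := by
        rw [ofReal_integral_eq_lintegral_ofReal
          (f := fun x => (2 - p) * x ^ 2 + (p - 1) * x ^ 4) (hi2.add hi4)]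
        filter_upwards with x
        exact (Real.rpow_nonneg (sq_nonneg x) p).trans (hb x)
    _ ≤ _ := by
        refine ENNReal.ofReal_le_ofReal ?_
        rw [integral_add hi2 hi4, integral_const_mul, integral_const_mul, integral_sq_stdGaussian,
          noiseMoment]
        linarith

theorem eLpNorm_eq_lintegral_ofReal_rpow {Ω : Type*} [MeasurableSpace Ω] {P : Measure Ω} {p : ℝ}
    (hp : 0 < p) {f : Ω → ℝ} (hf : ∀ᵐ ω ∂P, 0 ≤ f ω) :
    eLpNorm f (ENNReal.ofReal p) P = (∫⁻ ω, ENNReal.ofReal (f ω ^ p) ∂P) ^ (1 / p) := by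
  rw [eLpNorm_eq_lintegral_rpow_enorm_toReal (by simpa using hp) ENNReal.ofReal_ne_top,
    ENNReal.toReal_ofReal hp.le]
  congr 1
  refine lintegral_congr_ae ?_
  filter_upwards [hf] with ω hω
  rw [Real.enorm_of_nonneg hω, ENNReal.ofReal_rpow_of_nonneg hω hp.le]

theorem lintegral_obsBar_rpow_le {r : ℝ} (hr : r ∈ Set.Ioo (-1 : ℝ) 1) {p : ℝ} (hp1 : 1 ≤ p)
    (hp2 : p ≤ 2) {s : Fin 2 → ℝ} (hs : ∀ i, 0 ≤ s i) (i : Fin 2) :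
    ∫⁻ u, ENNReal.ofReal (obsBar (genObs s u) i ^ p) ∂gaussianCopula (corrMatrix r) ≤
      ENNReal.ofReal (noiseMoment p) * ENNReal.ofReal ((s i + 1) ^ p) := by
  have hn := one_le_noiseMoment hp1
  fin_cases i
  · simp only [Fin.zero_eta, Fin.isValue, obsBar_genObs_zero (hs 0)]
    simp_rw [Real.mul_rpow (hs 0) (sq_nonneg _), ENNReal.ofReal_mul (Real.rpow_nonneg (hs 0) p)]
    rw [lintegral_gaussianCopula_quantile hr
      (f := fun x => ENNReal.ofReal (s 0 ^ p) * ENNReal.ofReal ((x ^ 2) ^ p)) (by fun_prop),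
      lintegral_const_mul _ (by fun_prop), mul_comm]
    gcongr
    · exact lintegral_sq_rpow_stdGaussian_le hp1 hp2
    · exact hs 0
    · linarith
  · simp only [Fin.mk_one, Fin.isValue, obsBar_genObs_one]
    rw [lintegral_gaussianCopula_poisson hr (s 1) (fun n => ENNReal.ofReal ((n : ℝ) ^ p))]
    refine (lintegral_poissonQuantile_rpow_le (hs 1) hp1 hp2).trans ?_
    refine le_mul_of_one_le_left' ?_
    rw [← ENNReal.ofReal_one]
    exact ENNReal.ofReal_le_ofReal hn

variable {Ω : Type*} [MeasurableSpace Ω] {P : Measure Ω} [IsProbabilityMeasure P] {m : ℕ}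
    {U : ℤ → Ω → Fin 2 → ℝ} {X : ℤ → Ω → Fin m → ℝ} {Y : ℤ → Ω → ℝ × ℕ} {lam : ℤ → Ω → Fin 2 → ℝ}
    {Θ : Set (Param m)} {θ₀ : Param m} {r₀ dmin δ : ℝ}

namespace ModelSetting

theorem measurable_obsBar_genObs (h : ModelSetting P U X Y lam Θ θ₀ r₀ dmin δ) (t : ℤ)
    {L : Ω → Fin 2 → ℝ} (hL : Measurable L) (i : Fin 2) :
    Measurable fun ω => obsBar (genObs (L ω) (U t ω)) i :=
  (measurable_pi_apply i).comp (measurable_obsBar.comp (measurable_genObs.comp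
    (hL.prodMk (h.noise.measurable_noise t))))

/-- The conditional bound is integrated and Minkowski's inequality splits off the `1`. The `p`-th
root of `noiseMoment p` is at most `noiseMoment p`, which is at least one. -/
theorem eLpNorm_obsBar_le (h : ModelSetting P U X Y lam Θ θ₀ r₀ dmin δ) (t : ℤ) {p : ℝ}
    (hp1 : 1 ≤ p) (hp2 : p ≤ 2) {L : Ω → Fin 2 → ℝ} (hL : Measurable[past U X (t - 1)] L)
    (hL0 : ∀ᵐ ω ∂P, ∀ i, 0 ≤ L ω i) (i : Fin 2) :
    eLpNorm (fun ω => obsBar (genObs (L ω) (U t ω)) i) (ENNReal.ofReal p) P ≤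
      ENNReal.ofReal (noiseMoment p) * (eLpNorm (fun ω => L ω i) (ENNReal.ofReal p) P + 1) := by
  have hp0 : 0 < p := by linarith
  have hn := one_le_noiseMoment hp1
  have hLm : Measurable L := hL.mono (h.past_le _) le_rfl
  have hLi : Measurable fun ω => L ω i := (measurable_pi_apply i).comp hLm
  rw [eLpNorm_eq_lintegral_ofReal_rpow hp0 (by filter_upwards with ω using obsBar_nonneg _ i)]
  have hmeas : Measurable fun q : (Fin 2 → ℝ) × (Fin 2 → ℝ) =>
      ENNReal.ofReal (obsBar (genObs q.1 q.2) i ^ p) :=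
    (((measurable_pi_apply i).comp (measurable_obsBar.comp measurable_genObs)).pow_const
      p).ennreal_ofReal
  rw [h.lintegral_indep t hL (f := fun s u => ENNReal.ofReal (obsBar (genObs s u) i ^ p)) hmeas]
  have hle : ∫⁻ ω, ∫⁻ u, ENNReal.ofReal (obsBar (genObs (L ω) u) i ^ p)
      ∂gaussianCopula (corrMatrix r₀) ∂P ≤
      ENNReal.ofReal (noiseMoment p) * ∫⁻ ω, ENNReal.ofReal ((L ω i + 1) ^ p) ∂P := by
    rw [← lintegral_const_mul _ ((hLi.add_const 1).pow_const p).ennreal_ofReal]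
    refine lintegral_mono_ae ?_
    filter_upwards [hL0] with ω hω
    exact lintegral_obsBar_rpow_le h.corr_mem hp1 hp2 hω i
  have hκ : ENNReal.ofReal (noiseMoment p) ^ (1 / p) ≤ ENNReal.ofReal (noiseMoment p) := by
    have h1 : (1 : ENNReal) ≤ ENNReal.ofReal (noiseMoment p) := by
      rw [← ENNReal.ofReal_one]; exact ENNReal.ofReal_le_ofReal hn
    calc _ ≤ ENNReal.ofReal (noiseMoment p) ^ (1 : ℝ) :=
          ENNReal.rpow_le_rpow_of_exponent_le h1 (by rw [div_le_one hp0]; exact hp1)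
      _ = _ := ENNReal.rpow_one _
  calc _ ≤ (ENNReal.ofReal (noiseMoment p) * ∫⁻ ω, ENNReal.ofReal ((L ω i + 1) ^ p) ∂P) ^ (1 / p) :=
        ENNReal.rpow_le_rpow hle (by positivity)
    _ = ENNReal.ofReal (noiseMoment p) ^ (1 / p) *
        eLpNorm (fun ω => L ω i + 1) (ENNReal.ofReal p) P := by
        rw [ENNReal.mul_rpow_of_nonneg _ _ (by positivity), eLpNorm_eq_lintegral_ofReal_rpow hp0]
        filter_upwards [hL0] with ω hω
        linarith [hω i]
    _ ≤ _ := by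
        gcongr
        refine (eLpNorm_add_le hLi.aestronglyMeasurable aestronglyMeasurable_const
          (by simpa using hp1)).trans ?_
        gcongr
        rw [eLpNorm_const _ (by simpa using hp0) (IsProbabilityMeasure.ne_zero P)]
        simp

theorem memLp_X (h : ModelSetting P U X Y lam Θ θ₀ r₀ dmin δ) {p : ℝ} (hp : p ≤ 1 + δ) (t : ℤ) (i : Fin m) :
    MemLp (fun ω => X t ω i) (ENNReal.ofReal p) P := by
  have hmX := h.noise.measurable_covariate
  have h0 : MemLp (fun ω => X 0 ω i) (ENNReal.ofReal p) P := by
    have hδ := h.delta_pos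
    have hsum : MemLp (fun ω => ∑ i, |X 0 ω i|) (ENNReal.ofReal (1 + δ)) P := by
      have hm : Measurable fun ω => ∑ i, |X 0 ω i| :=
        Finset.measurable_fun_sum _ fun j _ => ((measurable_pi_apply j).comp (hmX 0)).abs
      rw [← integrable_norm_rpow_iff hm.aestronglyMeasurable (by simp; linarith)
        ENNReal.ofReal_ne_top, ENNReal.toReal_ofReal (by linarith)]
      refine h.moment.congr ?_
      filter_upwards with ω
      rw [Real.norm_of_nonneg (Finset.sum_nonneg fun j _ => abs_nonneg _)]
    refine (hsum.mono_exponent (ENNReal.ofReal_le_ofReal hp)).mono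
      ((measurable_pi_apply i).comp (hmX 0)).aestronglyMeasurable ?_
    filter_upwards with ω
    rw [Real.norm_of_nonneg (Finset.sum_nonneg fun j _ => abs_nonneg _), Real.norm_eq_abs]
    exact Finset.single_le_sum (f := fun j => |X 0 ω j|) (fun j _ => abs_nonneg _)
      (Finset.mem_univ i)
  have hid : IdentDistrib (X t) (X 0) P P :=
    ⟨(hmX t).aemeasurable, (hmX 0).aemeasurable, h.map_X t⟩
  exact (hid.comp (measurable_pi_apply i)).memLp_iff.2 h0

theorem eLpNorm_X (h : ModelSetting P U X Y lam Θ θ₀ r₀ dmin δ) (p : ENNReal) (θ : Param m) (t : ℤ)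
    (i : Fin 2) :
    eLpNorm (fun ω => (θ.Γ *ᵥ X t ω) i) p P = eLpNorm (fun ω => (θ.Γ *ᵥ X 0 ω) i) p P := by
  have hid : IdentDistrib (X t) (X 0) P P :=
    ⟨(h.noise.measurable_covariate t).aemeasurable, (h.noise.measurable_covariate 0).aemeasurable,
      h.map_X t⟩
  exact (hid.comp ((measurable_pi_apply i).comp (measurable_mulVec θ.Γ))).eLpNorm_eq p

theorem memLp_mulVec_X (h : ModelSetting P U X Y lam Θ θ₀ r₀ dmin δ) {p : ℝ} (hp : p ≤ 1 + δ) (θ : Param m) (t : ℤ) (i : Fin 2) :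
    MemLp (fun ω => (θ.Γ *ᵥ X t ω) i) (ENNReal.ofReal p) P := by
  simp only [Matrix.mulVec, dotProduct]
  exact memLp_finsetSum _ fun j _ => (h.memLp_X hp t j).const_mul _

/-- The recursion satisfied by the moments of order `p` of the iterates. -/
theorem eLpNorm_iterLatent_succ_le (h : ModelSetting P U X Y lam Θ θ₀ r₀ dmin δ) {p : ℝ}
    (hp1 : 1 ≤ p) (hp2 : p ≤ 2) (k : ℕ) (t : ℤ) (i : Fin 2) :
    eLpNorm (fun ω => iterLatent θ₀ (k + 1) (pastOf (drivingPath U X ω) (t + 1)) i)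
        (ENNReal.ofReal p) P ≤
      ENNReal.ofReal (θ₀.d i) + ∑ j, ENNReal.ofReal (noiseMoment p) * ENNReal.ofReal (θ₀.A i j) +
        eLpNorm (fun ω => (θ₀.Γ *ᵥ X 0 ω) i) (ENNReal.ofReal p) P +
        ∑ j, ENNReal.ofReal (noiseMoment p) * ENNReal.ofReal ((θ₀.A + θ₀.B) i j) *
          eLpNorm (fun ω => iterLatent θ₀ k (pastOf (drivingPath U X ω) t) j)
            (ENNReal.ofReal p) P := by
  have hA := h.A_nonneg θ₀ h.mem
  have hB := h.B_nonneg θ₀ h.mem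
  have hn := one_le_noiseMoment hp1
  have hpe : 1 ≤ ENNReal.ofReal p := by simpa using hp1
  set q := ENNReal.ofReal p with hq
  set κ := ENNReal.ofReal (noiseMoment p) with hκ
  have hκ1 : 1 ≤ κ := by
    rw [hκ, ← ENNReal.ofReal_one]; exact ENNReal.ofReal_le_ofReal hn
  set L : Ω → Fin 2 → ℝ := fun ω => iterLatent θ₀ k (pastOf (drivingPath U X ω) t) with hLdef
  have hLm : Measurable[past U X (t - 1)] L :=
    (measurable_iterLatent θ₀ k).comp (measurable_pastOf t)
  have hLM : Measurable L := hLm.mono (h.past_le _) le_rfl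
  have hL0 : ∀ᵐ ω ∂P, ∀ i, 0 ≤ L ω i := by
    filter_upwards [h.ae_pastOf_nonneg h.mem t] with ω hω i
    exact iterLatent_nonneg (h.d_nonneg h.mem) hA hB k hω i
  have hLj (j : Fin 2) : Measurable fun ω => L ω j := (measurable_pi_apply j).comp hLM
  have hyj (j : Fin 2) := h.measurable_obsBar_genObs t hLM j
  have hX : Measurable fun ω => (θ₀.Γ *ᵥ X t ω) i :=
    (measurable_pi_apply i).comp ((measurable_mulVec θ₀.Γ).comp (h.noise.measurable_covariate t))
  have e : (fun ω => iterLatent θ₀ (k + 1) (pastOf (drivingPath U X ω) (t + 1)) i) =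
      (fun _ => θ₀.d i) + (∑ j, θ₀.B i j • fun ω => L ω j) +
        (∑ j, θ₀.A i j • fun ω => obsBar (genObs (L ω) (U t ω)) j) +
        fun ω => (θ₀.Γ *ᵥ X t ω) i := by
    ext ω
    rw [iterLatent, pastOf_tail, pastOf_zero, add_sub_cancel_right, latentStep_apply]
    simp only [Pi.add_apply, Finset.sum_apply, Pi.smul_apply, smul_eq_mul]
    rfl
  have t1 : eLpNorm (fun _ : Ω => θ₀.d i) q P ≤ ENNReal.ofReal (θ₀.d i) := by
    rw [eLpNorm_const _ (by positivity) (IsProbabilityMeasure.ne_zero P)]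
    simp [Real.enorm_of_nonneg (h.d_nonneg h.mem i)]
  have mB : AEStronglyMeasurable (∑ j, θ₀.B i j • fun ω => L ω j) P :=
    Finset.aestronglyMeasurable_sum _ fun j _ => ((hLj j).const_smul _).aestronglyMeasurable
  have mA : AEStronglyMeasurable (∑ j, θ₀.A i j • fun ω => obsBar (genObs (L ω) (U t ω)) j) P :=
    Finset.aestronglyMeasurable_sum _ fun j _ => ((hyj j).const_smul _).aestronglyMeasurable
  have t2 : eLpNorm (∑ j, θ₀.B i j • fun ω => L ω j) q P ≤
      ∑ j, ENNReal.ofReal (θ₀.B i j) * eLpNorm (fun ω => L ω j) q P := by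
    refine (eLpNorm_sum_le (fun j _ => ((hLj j).const_smul _).aestronglyMeasurable) hpe).trans ?_
    refine Finset.sum_le_sum fun j _ => ?_
    rw [eLpNorm_const_smul, Real.enorm_of_nonneg (hB i j)]
  have t3 : eLpNorm (∑ j, θ₀.A i j • fun ω => obsBar (genObs (L ω) (U t ω)) j) q P ≤
      ∑ j, ENNReal.ofReal (θ₀.A i j) * (κ * (eLpNorm (fun ω => L ω j) q P + 1)) := by
    refine (eLpNorm_sum_le (fun j _ => ((hyj j).const_smul _).aestronglyMeasurable) hpe).trans ?_
    refine Finset.sum_le_sum fun j _ => ?_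
    rw [eLpNorm_const_smul, Real.enorm_of_nonneg (hA i j)]
    gcongr
    exact h.eLpNorm_obsBar_le t hp1 hp2 hLm hL0 j
  rw [e]
  refine (eLpNorm_add_le ((aestronglyMeasurable_const.add mB).add mA)
    hX.aestronglyMeasurable hpe).trans ?_
  rw [h.eLpNorm_X q θ₀ t i]
  have mc : AEStronglyMeasurable (fun _ : Ω => θ₀.d i) P := aestronglyMeasurable_const
  have s1 := eLpNorm_add_le (mc.add mB) mA hpe
  have s2 := eLpNorm_add_le mc mB hpe
  have s3 := s1.trans (add_le_add (s2.trans (add_le_add t1 t2)) t3)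
  refine (add_le_add s3 le_rfl).trans ?_
  -- Only the part with `A` carries the factor `κ`; enlarging the part with `B` by it as well leaves
  -- a recursion governed by `κ (A + B)`.
  have key : ∑ j, ENNReal.ofReal (θ₀.B i j) * eLpNorm (fun ω => L ω j) q P +
      ∑ j, ENNReal.ofReal (θ₀.A i j) * (κ * (eLpNorm (fun ω => L ω j) q P + 1)) ≤
      ∑ j, κ * ENNReal.ofReal (θ₀.A i j) +
        ∑ j, κ * ENNReal.ofReal ((θ₀.A + θ₀.B) i j) * eLpNorm (fun ω => L ω j) q P := by
    rw [← Finset.sum_add_distrib, ← Finset.sum_add_distrib]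
    refine Finset.sum_le_sum fun j _ => ?_
    rw [Matrix.add_apply, ENNReal.ofReal_add (hA i j) (hB i j)]
    calc _ ≤ κ * (ENNReal.ofReal (θ₀.B i j) * eLpNorm (fun ω => L ω j) q P) +
          ENNReal.ofReal (θ₀.A i j) * (κ * (eLpNorm (fun ω => L ω j) q P + 1)) := by
          exact add_le_add (le_mul_of_one_le_left' hκ1) le_rfl
      _ = _ := by ring
  calc _ = ENNReal.ofReal (θ₀.d i) + eLpNorm (fun ω => (θ₀.Γ *ᵥ X 0 ω) i) q P +
        (∑ j, ENNReal.ofReal (θ₀.B i j) * eLpNorm (fun ω => L ω j) q P +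
          ∑ j, ENNReal.ofReal (θ₀.A i j) * (κ * (eLpNorm (fun ω => L ω j) q P + 1))) := by ring
    _ ≤ _ := add_le_add le_rfl key
    _ = _ := by ring

/-- The latent process has a finite moment of some order larger than one. -/
theorem exists_memLp_lam (h : ModelSetting P U X Y lam Θ θ₀ r₀ dmin δ) :
    ∃ p : ℝ, 1 < p ∧ p ≤ 2 ∧ ∀ t i, MemLp (fun ω => lam t ω i) (ENNReal.ofReal p) P := by
  obtain ⟨C, ρ, hC, hρ, hρ1, hb⟩ := exists_abs_pow_entry_le
    (S := {θ₀.A + θ₀.B}) isCompact_singleton (by simpa using h.stab)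
  have hA := h.A_nonneg θ₀ h.mem
  have hB := h.B_nonneg θ₀ h.mem
  have hδ := h.delta_pos
  -- `noiseMoment` is continuous with value one at `p = 1`, so a `p` slightly above one preserves
  -- geometric contraction.
  obtain ⟨p, hp1, hp2, hpδ, hκρ⟩ : ∃ p : ℝ, 1 < p ∧ p ≤ 2 ∧ p ≤ 1 + δ ∧ noiseMoment p * ρ < 1 := by
    have hc : ContinuousAt (fun p => noiseMoment p * ρ) 1 := by unfold noiseMoment; fun_prop
    have h1 : noiseMoment 1 * ρ < 1 := by simpa [noiseMoment] using hρ1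
    have h2 : ∀ᶠ p in 𝓝[>] (1 : ℝ), noiseMoment p * ρ < 1 :=
      (hc.eventually_lt_const h1).filter_mono nhdsWithin_le_nhds
    have h3 : ∀ᶠ p in 𝓝[>] (1 : ℝ), p < 2 ∧ p < 1 + δ :=
      (((gt_mem_nhds (by norm_num : (1 : ℝ) < 2)).and
        (gt_mem_nhds (by linarith : (1 : ℝ) < 1 + δ)))).filter_mono nhdsWithin_le_nhds
    obtain ⟨p, ⟨a, b, c⟩, d⟩ := ((h2.and h3).and self_mem_nhdsWithin).exists
    exact ⟨p, d, b.le, c.le, a⟩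
  refine ⟨p, hp1, hp2, ?_⟩
  set κ := noiseMoment p with hκ
  have hκ1 : 1 ≤ κ := one_le_noiseMoment hp1.le
  have hκ0 : 0 ≤ κ := by linarith
  set q := ENNReal.ofReal p with hq
  set M := θ₀.A + θ₀.B with hM
  have hM0 : ∀ i j, 0 ≤ M i j := fun i j => add_nonneg (hA i j) (hB i j)
  set c : Fin 2 → ℝ := fun i => θ₀.d i + ∑ j, κ * θ₀.A i j +
    (eLpNorm (fun ω => (θ₀.Γ *ᵥ X 0 ω) i) q P).toReal with hc
  have hc0 : ∀ i, 0 ≤ c i := fun i => add_nonneg (add_nonneg (h.d_nonneg h.mem i)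
    (Finset.sum_nonneg fun j _ => mul_nonneg hκ0 (hA i j))) ENNReal.toReal_nonneg
  have hce : ∀ i, ENNReal.ofReal (c i) = ENNReal.ofReal (θ₀.d i) +
      ∑ j, ENNReal.ofReal κ * ENNReal.ofReal (θ₀.A i j) +
        eLpNorm (fun ω => (θ₀.Γ *ᵥ X 0 ω) i) q P := by
    intro i
    have hs : 0 ≤ ∑ j, κ * θ₀.A i j := Finset.sum_nonneg fun j _ => mul_nonneg hκ0 (hA i j)
    rw [hc, ENNReal.ofReal_add (add_nonneg (h.d_nonneg h.mem i) hs) ENNReal.toReal_nonneg,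
      ENNReal.ofReal_add (h.d_nonneg h.mem i) hs, ENNReal.ofReal_sum_of_nonneg
        fun j _ => mul_nonneg hκ0 (hA i j), ENNReal.ofReal_toReal
          (h.memLp_mulVec_X hpδ θ₀ 0 i).eLpNorm_ne_top]
    simp only [ENNReal.ofReal_mul hκ0, hq]
  -- The solution, started at zero, of the majorant recursion `b (k + 1) = c + κ M b k`. It stays
  -- below `D` by comparison with a geometric series of ratio `κ * ρ`.
  let b : ℕ → Fin 2 → ℝ := fun k => ∑ l ∈ Finset.range k, (κ ^ l) • ((M ^ l) *ᵥ c)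
  have hb_succ : ∀ k i, b (k + 1) i = c i + ∑ j, κ * M i j * b k j := by
    intro k i
    have e1 : b (k + 1) = c + κ • (M *ᵥ b k) := by
      simp only [b]
      rw [Finset.sum_range_succ', Matrix.mulVec_sum, Finset.smul_sum, add_comm]
      congr 1
      · simp
      · refine Finset.sum_congr rfl fun l _ => ?_
        rw [Matrix.mulVec_smul, Matrix.mulVec_mulVec, smul_smul, pow_succ' κ, pow_succ' M]
    rw [e1]
    simp only [Pi.add_apply, Pi.smul_apply, smul_eq_mul, Matrix.mulVec, dotProduct, Finset.mul_sum,
      mul_assoc]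
  have hb0 : ∀ k i, 0 ≤ b k i := by
    intro k
    induction k with
    | zero => intro i; simp [b]
    | succ k ih =>
      intro i
      rw [hb_succ]
      exact add_nonneg (hc0 i) (Finset.sum_nonneg fun j _ =>
        mul_nonneg (mul_nonneg hκ0 (hM0 i j)) (ih j))
  have hbound : ∀ k t i, eLpNorm (fun ω => iterLatent θ₀ k (pastOf (drivingPath U X ω) t) i) q P ≤
      ENNReal.ofReal (b k i) := by
    intro k
    induction k with
    | zero => intro t i; simp [iterLatent]
    | succ k ih =>
      intro t i
      have h1 := h.eLpNorm_iterLatent_succ_le hp1.le hp2 k (t - 1) i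
      rw [sub_add_cancel, ← hce i] at h1
      refine h1.trans ?_
      rw [hb_succ, ENNReal.ofReal_add (hc0 i) (Finset.sum_nonneg fun j _ =>
        mul_nonneg (mul_nonneg hκ0 (hM0 i j)) (hb0 k j)), ENNReal.ofReal_sum_of_nonneg fun j _ =>
        mul_nonneg (mul_nonneg hκ0 (hM0 i j)) (hb0 k j)]
      gcongr with j
      rw [ENNReal.ofReal_mul (mul_nonneg hκ0 (hM0 i j)), ENNReal.ofReal_mul hκ0]
      gcongr
      exact ih (t - 1) j
  have hκρ0 : 0 ≤ κ * ρ := by positivity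
  set D := C * (∑ j, c j) * (1 - κ * ρ)⁻¹ with hD
  have hbD : ∀ k i, b k i ≤ D := by
    intro k i
    have e1 : b k i = ∑ l ∈ Finset.range k, κ ^ l * ((M ^ l) *ᵥ c) i := by
      simp only [b, Finset.sum_apply, Pi.smul_apply, smul_eq_mul]
    have hcs : 0 ≤ ∑ j, c j := Finset.sum_nonneg fun j _ => hc0 j
    calc b k i ≤ ∑ l ∈ Finset.range k, C * (∑ j, c j) * (κ * ρ) ^ l := by
          rw [e1]
          refine Finset.sum_le_sum fun l _ => ?_
          rw [mul_pow, Matrix.mulVec, dotProduct]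
          calc _ ≤ κ ^ l * ∑ j, C * ρ ^ l * c j := by
                gcongr with j
                · exact hc0 j
                · exact (le_abs_self _).trans (hb _ rfl l i j)
            _ = _ := by rw [← Finset.mul_sum]; ring
      _ ≤ D := by
          rw [← Finset.mul_sum, hD, ← tsum_geometric_of_lt_one hκρ0 hκρ]
          exact mul_le_mul_of_nonneg_left ((summable_geometric_of_lt_one hκρ0 hκρ).sum_le_tsum _
            fun l _ => pow_nonneg hκρ0 l) (mul_nonneg hC.le hcs)
  intro t i
  have hm (k : ℕ) : Measurable fun ω => iterLatent θ₀ k (pastOf (drivingPath U X ω) t) i :=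
    (measurable_pi_apply i).comp ((measurable_iterLatent θ₀ k).comp
      ((measurable_pastOf t).mono (h.past_le _) le_rfl))
  refine ⟨((measurable_pi_apply i).comp (h.measurable_lam t)).aestronglyMeasurable, ?_⟩
  -- Fatou's lemma carries the bound from the iterates to their almost sure limit.
  have hlim := Lp.eLpNorm_lim_le_liminf_eLpNorm (p := q)
    (fun k => (hm k).aestronglyMeasurable (μ := P)) (fun ω => lam t ω i)
    (by filter_upwards [h.ae_tendsto_iterLatent] with ω hω using hω t i)
  refine (hlim.trans ?_).trans_lt (ENNReal.ofReal_lt_top (r := D))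
  exact liminf_le_of_le (by isBoundedDefault) fun a ha => by
    obtain ⟨k, hk⟩ := ha.exists
    exact hk.trans ((hbound k t i).trans (ENNReal.ofReal_le_ofReal (hbD k i)))

/-- The observed pair `(Y₁², Y₂)` has a finite moment of some order larger than one. -/
theorem exists_memLp_obsBar (h : ModelSetting P U X Y lam Θ θ₀ r₀ dmin δ) :
    ∃ p : ℝ, 1 < p ∧ ∀ t i, MemLp (fun ω => obsBar (Y t ω) i) (ENNReal.ofReal p) P := by
  obtain ⟨p, hp1, hp2, hp⟩ := h.exists_memLp_lam
  refine ⟨p, hp1, fun t i => ?_⟩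
  obtain ⟨L, hL, hae⟩ := h.exists_predictable t
  have hL0 : ∀ᵐ ω ∂P, ∀ i, 0 ≤ L ω i := by
    filter_upwards [h.sol.latent_nonneg t, hae] with ω h1 h2 i
    rw [← h2]; exact h1 i
  have hLp : eLpNorm (fun ω => L ω i) (ENNReal.ofReal p) P < ⊤ := by
    rw [eLpNorm_congr_ae (g := fun ω => lam t ω i)]
    · exact (hp t i).2
    · filter_upwards [hae] with ω hω
      rw [hω]
  have h1 := h.eLpNorm_obsBar_le t hp1.le hp2 hL hL0 i
  have h2 : MemLp (fun ω => obsBar (genObs (L ω) (U t ω)) i) (ENNReal.ofReal p) P :=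
    ⟨(h.measurable_obsBar_genObs t (hL.mono (h.past_le _) le_rfl) i).aestronglyMeasurable,
      h1.trans_lt (ENNReal.mul_lt_top ENNReal.ofReal_lt_top
        (ENNReal.add_lt_top.2 ⟨hLp, ENNReal.one_lt_top⟩))⟩
  refine (memLp_congr_ae ?_).2 h2
  filter_upwards [hae, h.ae_Y_eq] with ω h3 h4
  rw [h4, h3]

end ModelSetting

end Moments

/-! ### Latent processes for arbitrary parameters and their transfer to path space. -/

section Latent

instance (m : ℕ) : SecondCountableTopology (Matrix (Fin 2) (Fin m) ℝ) :=
  inferInstanceAs (SecondCountableTopology (Fin 2 → Fin m → ℝ))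

instance (m : ℕ) : SecondCountableTopology (Param m) :=
  inferInstanceAs (SecondCountableTopology ((Fin 2 → ℝ) × Matrix (Fin 2) (Fin m) ℝ ×
    Matrix (Fin 2) (Fin 2) ℝ × Matrix (Fin 2) (Fin 2) ℝ))

theorem continuous_Param_d {m : ℕ} (i : Fin 2) : Continuous fun θ : Param m => θ.d i :=
  (continuous_apply i).comp continuous_fst

theorem continuous_Param_Γ {m : ℕ} : Continuous fun θ : Param m => θ.Γ :=
  continuous_fst.comp continuous_snd

theorem continuous_Param_A {m : ℕ} : Continuous fun θ : Param m => θ.A :=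
  continuous_fst.comp (continuous_snd.comp continuous_snd)

theorem continuous_Param_B {m : ℕ} : Continuous fun θ : Param m => θ.B :=
  continuous_snd.comp (continuous_snd.comp continuous_snd)

/-- The magnitude of an observation and of the covariates. -/
noncomputable def magnitude {m : ℕ} (y : ℝ × ℕ) (x : Fin m → ℝ) : ℝ :=
  1 + ∑ i, obsBar y i + ∑ i, |x i|

theorem one_le_magnitude {m : ℕ} (y : ℝ × ℕ) (x : Fin m → ℝ) : 1 ≤ magnitude y x := by
  have h1 : 0 ≤ ∑ i, obsBar y i := Finset.sum_nonneg fun i _ => obsBar_nonneg y i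
  have h2 : 0 ≤ ∑ i, |x i| := Finset.sum_nonneg fun i _ => abs_nonneg _
  rw [magnitude]; linarith

theorem obsBar_le_magnitude {m : ℕ} (y : ℝ × ℕ) (x : Fin m → ℝ) (i : Fin 2) :
    obsBar y i ≤ magnitude y x := by
  have h1 : obsBar y i ≤ ∑ i, obsBar y i :=
    Finset.single_le_sum (f := obsBar y) (fun i _ => obsBar_nonneg y i) (Finset.mem_univ i)
  have h2 : 0 ≤ ∑ i, |x i| := Finset.sum_nonneg fun i _ => abs_nonneg _
  rw [magnitude]; linarith

theorem measurable_magnitude {α : Type*} [MeasurableSpace α] {m : ℕ} {f : α → ℝ × ℕ}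
    {g : α → Fin m → ℝ} (hf : Measurable f) (hg : Measurable g) :
    Measurable fun a => magnitude (f a) (g a) := by
  unfold magnitude
  have h1 : ∀ i, Measurable fun a => obsBar (f a) i := fun i =>
    (measurable_pi_apply i).comp (measurable_obsBar.comp hf)
  have h2 : ∀ i, Measurable fun a => |g a i| := fun i => ((measurable_pi_apply i).comp hg).abs
  exact (measurable_const.add (Finset.measurable_fun_sum _ fun i _ => h1 i)).add
    (Finset.measurable_fun_sum _ fun i _ => h2 i)

/-- Over a compact parameter set, the terms of the moving average expansion decay geometrically
up to the magnitude of the observations. -/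
theorem exists_abs_latentTerm_le {m : ℕ} {Θ : Set (Param m)} (hΘ : IsCompact Θ)
    (hB : ∀ θ ∈ Θ, specRadius θ.B < 1) :
    ∃ C ρ : ℝ, 0 < C ∧ 0 < ρ ∧ ρ < 1 ∧ (∀ θ ∈ Θ, ∀ k i j, |(θ.B ^ k) i j| ≤ C * ρ ^ k) ∧
      ∀ θ ∈ Θ, ∀ (y : ℤ → ℝ × ℕ) (x : ℤ → Fin m → ℝ) t j i,
        |latentTerm θ y x t j i| ≤ C * (ρ ^ j * magnitude (y (t - 1 - j)) (x (t - 1 - j))) := by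
  obtain ⟨C, ρ, hC, hρ, hρ1, hb⟩ := exists_abs_pow_entry_le (hΘ.image continuous_Param_B) (by
    rintro _ ⟨θ, hθ, rfl⟩
    exact hB θ hθ)
  have hb' : ∀ θ ∈ Θ, ∀ k i j, |(θ.B ^ k) i j| ≤ C * ρ ^ k := fun θ hθ => hb _ ⟨θ, hθ, rfl⟩
  let f : Param m → ℝ := fun θ => ∑ i, |θ.d i| + ∑ i, ∑ j, |θ.A i j| + ∑ i, ∑ j, |θ.Γ i j|
  have hf : Continuous f := by
    refine ((continuous_finsetSum _ fun i _ => (continuous_Param_d i).abs).add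
      (continuous_finsetSum _ fun i _ => continuous_finsetSum _ fun j _ => ?_)).add
      (continuous_finsetSum _ fun i _ => continuous_finsetSum _ fun j _ => ?_)
    · exact (continuous_Param_A.matrix_elem i j).abs
    · exact (continuous_Param_Γ.matrix_elem i j).abs
  obtain ⟨R, hR⟩ := hΘ.exists_bound_of_continuousOn hf.continuousOn
  have hS1 (θ : Param m) : 0 ≤ ∑ i, |θ.d i| := Finset.sum_nonneg fun i _ => abs_nonneg _
  have hS2 (θ : Param m) : 0 ≤ ∑ i, ∑ j, |θ.A i j| :=
    Finset.sum_nonneg fun i _ => Finset.sum_nonneg fun j _ => abs_nonneg _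
  have hS3 (θ : Param m) : 0 ≤ ∑ i, ∑ j, |θ.Γ i j| :=
    Finset.sum_nonneg fun i _ => Finset.sum_nonneg fun j _ => abs_nonneg _
  have hd : ∀ θ ∈ Θ, ∀ i, |θ.d i| ≤ max R 1 := fun θ hθ i => by
    have h1 := (le_abs_self _).trans (hR θ hθ)
    have h2 := Finset.single_le_sum (f := fun i => |θ.d i|) (fun i _ => abs_nonneg _)
      (Finset.mem_univ i)
    have := hS2 θ; have := hS3 θ
    refine le_trans ?_ (le_max_left _ _)
    simp only [f] at h1 h2
    linarith
  have hA : ∀ θ ∈ Θ, ∀ i j, |θ.A i j| ≤ max R 1 := fun θ hθ i j => by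
    have h1 := (le_abs_self _).trans (hR θ hθ)
    have h2 := Finset.single_le_sum (f := fun i => ∑ j, |θ.A i j|)
      (fun i _ => Finset.sum_nonneg fun j _ => abs_nonneg _) (Finset.mem_univ i)
    have h3 := Finset.single_le_sum (f := fun j => |θ.A i j|) (fun i _ => abs_nonneg _)
      (Finset.mem_univ j)
    have := hS1 θ; have := hS3 θ
    refine le_trans ?_ (le_max_left _ _)
    simp only [f] at h1 h2 h3
    linarith
  have hΓ : ∀ θ ∈ Θ, ∀ i j, |θ.Γ i j| ≤ max R 1 := fun θ hθ i j => by
    have h1 := (le_abs_self _).trans (hR θ hθ)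
    have h2 := Finset.single_le_sum (f := fun i => ∑ j, |θ.Γ i j|)
      (fun i _ => Finset.sum_nonneg fun j _ => abs_nonneg _) (Finset.mem_univ i)
    have h3 := Finset.single_le_sum (f := fun j => |θ.Γ i j|) (fun i _ => abs_nonneg _)
      (Finset.mem_univ j)
    have := hS1 θ; have := hS2 θ
    refine le_trans ?_ (le_max_left _ _)
    simp only [f] at h1 h2 h3
    linarith
  set R' := max R 1 with hR'
  have hR1 : 1 ≤ R' := le_max_right _ _
  -- `R'` bounds the entries of `d`, `A` and `Γ` over `Θ`, and `2` counts the coordinates summed in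
  -- the product with `B ^ j`. As `R' ≥ 1`, the same constant serves for `B ^ k` alone.
  refine ⟨2 * C * R', ρ, by positivity, hρ, hρ1, fun θ hθ k i j => ?_, ?_⟩
  · refine (hb' θ hθ k i j).trans ?_
    have : C * 1 ≤ 2 * C * R' := by nlinarith
    have := pow_pos hρ k
    nlinarith
  · intro θ hθ y x t j i
    set y' := y (t - 1 - j)
    set x' := x (t - 1 - j)
    have hin : ∀ k, |(θ.d + θ.A *ᵥ obsBar y' + θ.Γ *ᵥ x') k| ≤ R' * magnitude y' x' := by
      intro k
      have e1 : |(θ.A *ᵥ obsBar y') k| ≤ R' * ∑ l, obsBar y' l := by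
        rw [Matrix.mulVec, dotProduct, Finset.mul_sum]
        refine (Finset.abs_sum_le_sum_abs _ _).trans (Finset.sum_le_sum fun l _ => ?_)
        rw [abs_mul, abs_of_nonneg (obsBar_nonneg y' l)]
        exact mul_le_mul_of_nonneg_right (hA θ hθ k l) (obsBar_nonneg y' l)
      have e2 : |(θ.Γ *ᵥ x') k| ≤ R' * ∑ l, |x' l| := by
        rw [Matrix.mulVec, dotProduct, Finset.mul_sum]
        refine (Finset.abs_sum_le_sum_abs _ _).trans (Finset.sum_le_sum fun l _ => ?_)
        rw [abs_mul]
        exact mul_le_mul_of_nonneg_right (hΓ θ hθ k l) (abs_nonneg _)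
      have e3 := hd θ hθ k
      calc _ ≤ |θ.d k| + |(θ.A *ᵥ obsBar y') k| + |(θ.Γ *ᵥ x') k| := by
            simp only [Pi.add_apply]
            exact abs_add_three _ _ _
        _ ≤ R' + R' * ∑ l, obsBar y' l + R' * ∑ l, |x' l| := by linarith
        _ = _ := by rw [magnitude]; ring
    have hm : 0 ≤ magnitude y' x' := zero_le_one.trans (one_le_magnitude y' x')
    calc |latentTerm θ y x t j i| ≤ ∑ k, |(θ.B ^ j) i k| *
          |(θ.d + θ.A *ᵥ obsBar y' + θ.Γ *ᵥ x') k| := by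
          rw [latentTerm]
          conv_lhs => rw [Matrix.mulVec, dotProduct]
          refine (Finset.abs_sum_le_sum_abs _ _).trans (Finset.sum_le_sum fun k _ => ?_)
          rw [abs_mul]
      _ ≤ ∑ _k : Fin 2, (C * ρ ^ j) * (R' * magnitude y' x') := by
          refine Finset.sum_le_sum fun k _ => ?_
          exact mul_le_mul (hb' θ hθ j i k) (hin k) (abs_nonneg _) (by positivity)
      _ = _ := by simp; ring

/-- The weighted sum of the magnitudes of the past, an envelope for the latent values. -/
noncomputable def envelope {m : ℕ} (ρ : ℝ) (y : ℤ → ℝ × ℕ) (x : ℤ → Fin m → ℝ) (t : ℤ) : ℝ :=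
  ∑' j : ℕ, ρ ^ j * magnitude (y (t - 1 - j)) (x (t - 1 - j))

/-- The expansions of the latent values converge, uniformly over the parameter set. -/
def HasEnvelope {m : ℕ} (ρ : ℝ) (y : ℤ → ℝ × ℕ) (x : ℤ → Fin m → ℝ) (t : ℤ) : Prop :=
  Summable fun j : ℕ => ρ ^ j * magnitude (y (t - 1 - j)) (x (t - 1 - j))

section Deterministic

variable {m : ℕ} {Θ : Set (Param m)} {C ρ : ℝ} {y : ℤ → ℝ × ℕ} {x : ℤ → Fin m → ℝ}

theorem summable_latentTerm {t : ℤ} {θ : Param m}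
    (hb : ∀ j i, |latentTerm θ y x t j i| ≤
      C * (ρ ^ j * magnitude (y (t - 1 - j)) (x (t - 1 - j))))
    (hS : HasEnvelope ρ y x t) : Summable (latentTerm θ y x t) := by
  refine Pi.summable.2 fun i => ?_
  have h1 : ∀ j, ‖latentTerm θ y x t j i‖ ≤
      C * (ρ ^ j * magnitude (y (t - 1 - j)) (x (t - 1 - j))) := fun j => hb j i
  exact Summable.of_norm_bounded (hS.mul_left C) h1

theorem latent_apply {t : ℤ} {θ : Param m} (hs : Summable (latentTerm θ y x t)) (i : Fin 2) :
    latent θ y x t i = ∑' j, latentTerm θ y x t j i :=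
  tsum_apply hs

theorem abs_latent_le {t : ℤ} {θ : Param m}
    (hb : ∀ j i, |latentTerm θ y x t j i| ≤
      C * (ρ ^ j * magnitude (y (t - 1 - j)) (x (t - 1 - j))))
    (hS : HasEnvelope ρ y x t) (i : Fin 2) : |latent θ y x t i| ≤ C * envelope ρ y x t := by
  rw [latent_apply (summable_latentTerm hb hS), envelope, ← tsum_mul_left]
  have h1 : ∀ j, ‖latentTerm θ y x t j i‖ ≤
      C * (ρ ^ j * magnitude (y (t - 1 - j)) (x (t - 1 - j))) := fun j => hb j i
  exact tsum_of_norm_bounded (hS.mul_left C).hasSum h1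

/-- The Weierstrass test: the domination of the series is uniform in `θ`. -/
theorem continuousOn_latent {t : ℤ}
    (hb : ∀ θ ∈ Θ, ∀ j i, |latentTerm θ y x t j i| ≤
      C * (ρ ^ j * magnitude (y (t - 1 - j)) (x (t - 1 - j))))
    (hS : HasEnvelope ρ y x t) (i : Fin 2) : ContinuousOn (fun θ => latent θ y x t i) Θ := by
  have h1 : ContinuousOn (fun θ => ∑' j, latentTerm θ y x t j i) Θ := by
    refine continuousOn_tsum (u := fun j : ℕ => C * (ρ ^ j *
      magnitude (y (t - 1 - j)) (x (t - 1 - j)))) (fun j => Continuous.continuousOn ?_)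
      (hS.mul_left C) fun j θ hθ => hb θ hθ j i
    unfold latentTerm
    have hv : Continuous fun θ : Param m =>
        θ.d + θ.A *ᵥ obsBar (y (t - 1 - j)) + θ.Γ *ᵥ x (t - 1 - j) :=
      (continuous_fst.add (continuous_Param_A.matrix_mulVec continuous_const)).add
        (continuous_Param_Γ.matrix_mulVec continuous_const)
    exact (continuous_apply i).comp ((continuous_Param_B.pow j).matrix_mulVec hv)
  exact h1.congr fun θ hθ => latent_apply (summable_latentTerm (hb θ hθ) hS) i

/-- All terms of the series are nonnegative, and the term `j = 0` is already at least `dmin`. -/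
theorem dmin_le_latent {t : ℤ} {θ : Param m} {dmin : ℝ} (hdmin : 0 ≤ dmin)
    (hd : ∀ i, dmin ≤ θ.d i) (hA : ∀ i j, 0 ≤ θ.A i j) (hB : ∀ i j, 0 ≤ θ.B i j)
    (hx : ∀ s i, 0 ≤ (θ.Γ *ᵥ x s) i) (hs : Summable (latentTerm θ y x t)) (i : Fin 2) :
    dmin ≤ latent θ y x t i := by
  have hin : ∀ s k, dmin ≤ (θ.d + θ.A *ᵥ obsBar (y s) + θ.Γ *ᵥ x s) k := by
    intro s k
    have : 0 ≤ (θ.A *ᵥ obsBar (y s)) k := by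
      rw [Matrix.mulVec, dotProduct]
      exact Finset.sum_nonneg fun l _ => mul_nonneg (hA k l) (obsBar_nonneg _ l)
    simp only [Pi.add_apply]
    linarith [hd k, hx s k]
  have hpow : ∀ k i j, 0 ≤ (θ.B ^ k) i j := by
    intro k
    induction k with
    | zero => intro i j; rw [pow_zero, Matrix.one_apply]; positivity
    | succ k ih =>
      intro i j
      rw [pow_succ, Matrix.mul_apply]
      exact Finset.sum_nonneg fun l _ => mul_nonneg (ih i l) (hB l j)
  have hterm : ∀ j, 0 ≤ latentTerm θ y x t j i := by
    intro j
    rw [latentTerm]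
    conv_rhs => rw [Matrix.mulVec, dotProduct]
    exact Finset.sum_nonneg fun k _ => mul_nonneg (hpow j i k) (hdmin.trans (hin _ k))
  rw [latent_apply hs]
  refine le_trans ?_ ((Pi.summable.1 hs i).le_tsum 0 fun j _ => hterm j)
  rw [latentTerm, pow_zero, Matrix.one_mulVec]
  exact hin _ i

/-- Both processes solve the same affine recursion, so `B` propagates their initial difference; the
initial value is forgotten geometrically fast. -/
theorem latent_sub_initLatent {θ : Param m} (l₀ : Fin 2 → ℝ)
    (hs : ∀ t : ℕ, Summable (latentTerm θ y x t)) (t : ℕ) :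
    latent θ y x t - initLatent l₀ θ y x t = (θ.B ^ t) *ᵥ (latent θ y x 0 - l₀) := by
  induction t with
  | zero => simp [initLatent]
  | succ t ih =>
    have h1 := latent_eq_latentStep θ y x ((t + 1 : ℕ) : ℤ) (by
      rw [show (((t + 1 : ℕ) : ℤ) - 1) = (t : ℤ) by push_cast; ring]; exact hs t)
    rw [show (((t + 1 : ℕ) : ℤ) - 1) = (t : ℤ) by push_cast; ring] at h1
    rw [h1, initLatent, pow_succ', ← Matrix.mulVec_mulVec, ← ih, latentStep, latentStep,
      Matrix.mulVec_sub]
    abel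

/-- The bound starts at time `t + 1` because `l₀` itself may vanish. -/
theorem dmin_le_initLatent {θ : Param m} {dmin : ℝ} {l₀ : Fin 2 → ℝ} (hl₀ : ∀ i, 0 ≤ l₀ i)
    (hdmin : 0 ≤ dmin) (hd : ∀ i, dmin ≤ θ.d i) (hA : ∀ i j, 0 ≤ θ.A i j) (hB : ∀ i j, 0 ≤ θ.B i j)
    (hx : ∀ s i, 0 ≤ (θ.Γ *ᵥ x s) i) (t : ℕ) (i : Fin 2) :
    dmin ≤ initLatent l₀ θ y x (t + 1) i := by
  have hnn : ∀ t i, 0 ≤ initLatent l₀ θ y x t i := by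
    intro t
    induction t with
    | zero => exact hl₀
    | succ t ih => exact fun i => (hdmin.trans (hd i)).trans (latentStep_ge hA hB ih _ (hx t i))
  exact (hd i).trans (latentStep_ge hA hB (hnn t) _ (hx t i))

end Deterministic

/-! ### Observations and latent values as functions of the path -/

/-- The observations generated by a path of noise and covariates. -/
noncomputable def obsPath {m : ℕ} (θ₀ : Param m) (w : ℤ → (Fin 2 → ℝ) × (Fin m → ℝ)) :
    ℤ → ℝ × ℕ := fun t => genObs (statLatent θ₀ (pastOf w t)) (w t).1

/-- The covariates of a path. -/
def covPath {m : ℕ} (w : ℤ → (Fin 2 → ℝ) × (Fin m → ℝ)) : ℤ → Fin m → ℝ := fun t => (w t).2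

/-- The latent value at time zero with parameter `θ` along a path. -/
noncomputable def pathLatent {m : ℕ} (θ₀ θ : Param m) (w : ℤ → (Fin 2 → ℝ) × (Fin m → ℝ)) :
    Fin 2 → ℝ := latent θ (obsPath θ₀ w) (covPath w) 0

theorem shift_iterate {S : Type*} (w : ℤ → S) (n : ℕ) (t : ℤ) : shift^[n] w t = w (t + n) := by
  induction n generalizing t with
  | zero => simp
  | succ n ih =>
    rw [Function.iterate_succ_apply', shift, ih]
    congr 1; push_cast; ring

theorem obsPath_shift {m : ℕ} (θ₀ : Param m) (w : ℤ → (Fin 2 → ℝ) × (Fin m → ℝ)) (n : ℕ) (t : ℤ) :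
    obsPath θ₀ (shift^[n] w) t = obsPath θ₀ w (t + n) := by
  have e : pastOf (shift^[n] w) t = pastOf w (t + n) := by
    funext j
    simp only [pastOf, shift_iterate]
    congr 1; ring
  rw [obsPath, obsPath, e, shift_iterate]

theorem covPath_shift {m : ℕ} (w : ℤ → (Fin 2 → ℝ) × (Fin m → ℝ)) (n : ℕ) (t : ℤ) :
    covPath (shift^[n] w) t = covPath w (t + n) := by
  rw [covPath, covPath, shift_iterate]

/-- Time `n` on a path is time zero on the shifted path; this turns the criteria into averages of a
single functional along the shift. -/
theorem pathLatent_shift {m : ℕ} (θ₀ θ : Param m) (w : ℤ → (Fin 2 → ℝ) × (Fin m → ℝ)) (n : ℕ) :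
    pathLatent θ₀ θ (shift^[n] w) = latent θ (obsPath θ₀ w) (covPath w) n := by
  rw [pathLatent, latent, latent]
  refine tsum_congr fun j => ?_
  rw [latentTerm, latentTerm, obsPath_shift, covPath_shift,
    show (0 : ℤ) - 1 - j + n = n - 1 - j by ring]

theorem measurable_pastOf_path {V : Type*} [MeasurableSpace V] (t : ℤ) :
    Measurable fun w : ℤ → V => pastOf w t :=
  measurable_pi_iff.2 fun _ => measurable_pi_apply _

theorem measurable_obsPath {m : ℕ} (θ₀ : Param m) (t : ℤ) :
    Measurable fun w : ℤ → (Fin 2 → ℝ) × (Fin m → ℝ) => obsPath θ₀ w t :=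
  measurable_genObs.comp (((measurable_statLatent θ₀).comp (measurable_pastOf_path t)).prodMk
    (measurable_pi_apply t).fst)

theorem measurable_covPath {m : ℕ} (t : ℤ) :
    Measurable fun w : ℤ → (Fin 2 → ℝ) × (Fin m → ℝ) => covPath w t :=
  (measurable_pi_apply t).snd

theorem measurable_latentTerm {m : ℕ} (θ : Param m) {α : Type*} [MeasurableSpace α]
    {y : α → ℤ → ℝ × ℕ} {x : α → ℤ → Fin m → ℝ} (t : ℤ) (j : ℕ)
    (hy : Measurable fun a => y a (t - 1 - j)) (hx : Measurable fun a => x a (t - 1 - j)) :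
    Measurable fun a => latentTerm θ (y a) (x a) t j :=
  (measurable_mulVec _).comp ((measurable_const.add
    ((measurable_mulVec _).comp (measurable_obsBar.comp hy))).add ((measurable_mulVec _).comp hx))

theorem measurable_pathLatent {m : ℕ} (θ₀ θ : Param m) : Measurable (pathLatent θ₀ θ) :=
  Measurable.tsum fun j => measurable_latentTerm θ 0 j (measurable_obsPath θ₀ _)
    (measurable_covPath _)

theorem measurable_magnitude_path {m : ℕ} (θ₀ : Param m) (t : ℤ) :
    Measurable fun w : ℤ → (Fin 2 → ℝ) × (Fin m → ℝ) =>
      magnitude (obsPath θ₀ w t) (covPath w t) :=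
  measurable_magnitude (measurable_obsPath θ₀ t) (measurable_covPath t)

theorem measurable_envelope {m : ℕ} (θ₀ : Param m) (ρ : ℝ) (t : ℤ) :
    Measurable fun w => envelope ρ (obsPath θ₀ w) (covPath w) t :=
  Measurable.tsum fun _ => (measurable_magnitude_path θ₀ _).const_mul _

variable {Ω : Type*} [MeasurableSpace Ω] {P : Measure Ω} [IsProbabilityMeasure P] {m : ℕ}
    {U : ℤ → Ω → Fin 2 → ℝ} {X : ℤ → Ω → Fin m → ℝ} {Y : ℤ → Ω → ℝ × ℕ} {lam : ℤ → Ω → Fin 2 → ℝ}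
    {Θ : Set (Param m)} {θ₀ : Param m} {r₀ dmin δ : ℝ}

/-- The law of the path of noise and covariates. -/
noncomputable def pathLaw (P : Measure Ω) (U : ℤ → Ω → Fin 2 → ℝ) (X : ℤ → Ω → Fin m → ℝ) :
    Measure (ℤ → (Fin 2 → ℝ) × (Fin m → ℝ)) := P.map (drivingPath U X)

/-- Paths along which the latent values converge and stay bounded away from zero. -/
def GoodPath (Θ : Set (Param m)) (θ₀ : Param m) (ρ : ℝ) (w : ℤ → (Fin 2 → ℝ) × (Fin m → ℝ)) :
    Prop :=
  HasEnvelope ρ (obsPath θ₀ w) (covPath w) 0 ∧ ∀ θ ∈ Θ, ∀ t i, 0 ≤ (θ.Γ *ᵥ covPath w t) i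

namespace ModelSetting

theorem ergodic_shift (h : ModelSetting P U X Y lam Θ θ₀ r₀ dmin δ) :
    Ergodic shift (pathLaw P U X) := h.noise.stationary_ergodic

theorem isProbabilityMeasure_pathLaw (h : ModelSetting P U X Y lam Θ θ₀ r₀ dmin δ) :
    IsProbabilityMeasure (pathLaw P U X) :=
  Measure.isProbabilityMeasure_map h.measurable_drivingPath.aemeasurable

/-- Almost sure statements can thus be proved on path space, where the shift is ergodic, and pulled
back to `Ω`. -/
theorem ae_obs_eq (h : ModelSetting P U X Y lam Θ θ₀ r₀ dmin δ) :
    ∀ᵐ ω ∂P, (fun t => Y t ω) = obsPath θ₀ (drivingPath U X ω) := by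
  filter_upwards [h.ae_Y_eq, h.ae_lam_eq] with ω h1 h2
  ext1 t
  rw [h1, h2]; rfl

theorem integrable_obsBar (h : ModelSetting P U X Y lam Θ θ₀ r₀ dmin δ) (t : ℤ) (i : Fin 2) :
    Integrable (fun ω => obsBar (Y t ω) i) P := by
  obtain ⟨p, hp, hm⟩ := h.exists_memLp_obsBar
  exact (hm t i).integrable (by simpa using hp.le)

theorem lintegral_obsBar (h : ModelSetting P U X Y lam Θ θ₀ r₀ dmin δ) (t : ℤ) (i : Fin 2) :
    ∫⁻ ω, ENNReal.ofReal (obsBar (Y t ω) i) ∂P = ∫⁻ ω, ENNReal.ofReal (lam 0 ω i) ∂P := by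
  obtain ⟨L, hL, hae⟩ := h.exists_predictable t
  have hmeas : Measurable fun q : (Fin 2 → ℝ) × (Fin 2 → ℝ) =>
      ENNReal.ofReal (obsBar (genObs q.1 q.2) i) :=
    ((measurable_pi_apply i).comp (measurable_obsBar.comp measurable_genObs)).ennreal_ofReal
  calc _ = ∫⁻ ω, ENNReal.ofReal (obsBar (genObs (L ω) (U t ω)) i) ∂P := by
        refine lintegral_congr_ae ?_
        filter_upwards [hae, h.ae_Y_eq] with ω h1 h2
        rw [h2, h1]
    _ = ∫⁻ ω, ENNReal.ofReal (lam t ω i) ∂P := by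
        rw [h.lintegral_indep t hL (f := fun s u => ENNReal.ofReal (obsBar (genObs s u) i)) hmeas]
        refine lintegral_congr_ae ?_
        filter_upwards [hae, h.sol.latent_nonneg t] with ω h1 h2
        rw [h1] at h2
        rw [lintegral_obsBar_genObs h.corr_mem h2, h1]
    _ = _ := h.lintegral_lam t (f := fun l => ENNReal.ofReal (l i))
        (measurable_pi_apply i).ennreal_ofReal

theorem exists_lintegral_magnitude_le (h : ModelSetting P U X Y lam Θ θ₀ r₀ dmin δ) :
    ∃ M : ENNReal, M ≠ ⊤ ∧ ∀ t, ∫⁻ w, ENNReal.ofReal (magnitude (obsPath θ₀ w t) (covPath w t))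
      ∂pathLaw P U X ≤ M := by
  have hX1 (t : ℤ) (i : Fin m) : Integrable (fun ω => X t ω i) P :=
    memLp_one_iff_integrable.1 (by
      simpa using h.memLp_X (p := 1) (by linarith [h.delta_pos]) t i)
  refine ⟨1 + ∑ i, ∫⁻ ω, ENNReal.ofReal (lam 0 ω i) ∂P + ∑ i, ∫⁻ ω, ENNReal.ofReal |X 0 ω i| ∂P,
    ?_, fun t => ?_⟩
  · refine ENNReal.add_ne_top.2 ⟨ENNReal.add_ne_top.2 ⟨ENNReal.one_ne_top, ?_⟩, ?_⟩
    · exact (ENNReal.sum_lt_top.2 fun i _ => (h.integrable_lam 0 i).lintegral_lt_top).ne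
    · exact (ENNReal.sum_lt_top.2 fun i _ => (hX1 0 i).abs.lintegral_lt_top).ne
  · rw [pathLaw, lintegral_map (measurable_magnitude_path θ₀ t).ennreal_ofReal
      h.measurable_drivingPath]
    have hmY (i : Fin 2) : Measurable fun ω => ENNReal.ofReal (obsBar (Y t ω) i) :=
      ((measurable_pi_apply i).comp (measurable_obsBar.comp (h.measurable_Y t))).ennreal_ofReal
    have hmX (s : ℤ) (i : Fin m) : Measurable fun ω => ENNReal.ofReal |X s ω i| :=
      ((measurable_pi_apply i).comp (h.noise.measurable_covariate s)).abs.ennreal_ofReal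
    have hXs (i : Fin m) : ∫⁻ ω, ENNReal.ofReal |X t ω i| ∂P =
        ∫⁻ ω, ENNReal.ofReal |X 0 ω i| ∂P := by
      have hf : Measurable fun x : Fin m → ℝ => ENNReal.ofReal |x i| :=
        (measurable_pi_apply i).abs.ennreal_ofReal
      rw [← lintegral_map hf (h.noise.measurable_covariate t), h.map_X t,
        lintegral_map hf (h.noise.measurable_covariate 0)]
    refine le_of_eq ?_
    calc _ = ∫⁻ ω, (1 + ∑ i, ENNReal.ofReal (obsBar (Y t ω) i) +
          ∑ i, ENNReal.ofReal |X t ω i|) ∂P := by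
          refine lintegral_congr_ae ?_
          filter_upwards [h.ae_obs_eq] with ω hω
          have hs1 : 0 ≤ ∑ i, obsBar (Y t ω) i := Finset.sum_nonneg fun i _ => obsBar_nonneg _ i
          rw [← hω]
          change ENNReal.ofReal (magnitude (Y t ω) (X t ω)) = _
          rw [magnitude, ENNReal.ofReal_add (by linarith)
            (Finset.sum_nonneg fun i _ => abs_nonneg _), ENNReal.ofReal_add zero_le_one hs1,
            ENNReal.ofReal_sum_of_nonneg fun i _ => obsBar_nonneg _ i,
            ENNReal.ofReal_sum_of_nonneg fun i _ => abs_nonneg _, ENNReal.ofReal_one]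
      _ = _ := by
          rw [lintegral_add_right _ (Finset.measurable_fun_sum _ fun i _ => hmX t i),
            lintegral_add_right _ (Finset.measurable_fun_sum _ fun i _ => hmY i),
            lintegral_finsetSum _ fun i _ => hmX t i, lintegral_finsetSum _ fun i _ => hmY i]
          simp only [lintegral_const, measure_univ, mul_one, h.lintegral_obsBar t, hXs]

/-- By Tonelli the weighted series has mean at most `M / (1 - ρ)`. -/
theorem ae_hasEnvelope (h : ModelSetting P U X Y lam Θ θ₀ r₀ dmin δ) {ρ : ℝ} (hρ : 0 < ρ)
    (hρ1 : ρ < 1) :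
    (∀ᵐ w ∂pathLaw P U X, HasEnvelope ρ (obsPath θ₀ w) (covPath w) 0) ∧
      Integrable (fun w => envelope ρ (obsPath θ₀ w) (covPath w) 0) (pathLaw P U X) := by
  obtain ⟨M, hM, hle⟩ := h.exists_lintegral_magnitude_le
  set f : ℕ → (ℤ → (Fin 2 → ℝ) × (Fin m → ℝ)) → ℝ := fun j w =>
    ρ ^ j * magnitude (obsPath θ₀ w (0 - 1 - j)) (covPath w (0 - 1 - j)) with hf
  have hf0 : ∀ j w, 0 ≤ f j w := fun j w =>
    mul_nonneg (by positivity) (zero_le_one.trans (one_le_magnitude _ _))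
  have hfm : ∀ j, Measurable (f j) := fun j => (measurable_magnitude_path θ₀ _).const_mul _
  have hfin : ∫⁻ w, ∑' j, ENNReal.ofReal (f j w) ∂pathLaw P U X ≠ ⊤ := by
    rw [lintegral_tsum fun j => (hfm j).ennreal_ofReal.aemeasurable]
    have h1 : ∀ j, ∫⁻ w, ENNReal.ofReal (f j w) ∂pathLaw P U X ≤ ENNReal.ofReal ρ ^ j * M := by
      intro j
      simp only [f, ENNReal.ofReal_mul (pow_nonneg hρ.le j)]
      rw [lintegral_const_mul _ (measurable_magnitude_path θ₀ _).ennreal_ofReal,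
        ENNReal.ofReal_pow hρ.le]
      gcongr
      exact hle _
    refine ne_top_of_le_ne_top ?_ (ENNReal.tsum_le_tsum h1)
    rw [ENNReal.tsum_mul_right, ENNReal.tsum_geometric]
    refine ENNReal.mul_ne_top (ENNReal.inv_ne_top.2 ?_) hM
    rw [← ENNReal.ofReal_one, ← ENNReal.ofReal_sub _ hρ.le]
    simpa using hρ1
  have hae : ∀ᵐ w ∂pathLaw P U X, Summable fun j => f j w := by
    filter_upwards [ae_lt_top (Measurable.tsum fun j => (hfm j).ennreal_ofReal) hfin] with w hw
    have := ENNReal.summable_toReal hw.ne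
    simpa only [ENNReal.toReal_ofReal (hf0 _ w)] using this
  refine ⟨hae, (measurable_envelope θ₀ ρ 0).aestronglyMeasurable, ?_⟩
  rw [hasFiniteIntegral_iff_norm]
  refine lt_of_le_of_lt (lintegral_mono_ae ?_) (lt_top_iff_ne_top.2 hfin)
  filter_upwards [hae] with w hw
  rw [envelope, Real.norm_of_nonneg (tsum_nonneg fun j => hf0 j w),
    ENNReal.ofReal_tsum_of_nonneg (fun j => hf0 j w) hw]

theorem ae_goodPath (h : ModelSetting P U X Y lam Θ θ₀ r₀ dmin δ) {ρ : ℝ} (hρ : 0 < ρ)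
    (hρ1 : ρ < 1) : ∀ᵐ w ∂pathLaw P U X, GoodPath Θ θ₀ ρ w := by
  -- The exceptional set depends on `θ`; a countable dense set of parameters and continuity in `Γ`
  -- make it common to all of `Θ`.
  obtain ⟨D, hDc, hDd⟩ := TopologicalSpace.exists_countable_dense Θ
  have h1 : ∀ᵐ w ∂pathLaw P U X, ∀ θ ∈ D, ∀ t i, 0 ≤ (θ.1.Γ *ᵥ covPath w t) i := by
    refine (ae_ball_iff hDc).2 fun θ _ => ae_all_iff.2 fun t => ?_
    refine (ae_map_iff h.measurable_drivingPath.aemeasurable ?_).2 (h.cov_nonneg θ.1 θ.2 t)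
    have hm := (measurable_mulVec θ.1.Γ).comp (measurable_covPath (m := m) t)
    have : {w : ℤ → (Fin 2 → ℝ) × (Fin m → ℝ) | ∀ i, 0 ≤ (θ.1.Γ *ᵥ covPath w t) i} =
        ⋂ i, {w | 0 ≤ (θ.1.Γ *ᵥ covPath w t) i} := by
      ext w; simp
    rw [this]
    exact MeasurableSet.iInter fun i => measurableSet_le measurable_const
      ((measurable_pi_apply i).comp hm)
  filter_upwards [(h.ae_hasEnvelope hρ hρ1).1, h1] with w hw1 hw2
  refine ⟨hw1, fun θ hθ t i => ?_⟩
  have hc : Continuous fun θ : Θ => (θ.1.Γ *ᵥ covPath w t) i :=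
    (continuous_apply i).comp ((continuous_Param_Γ.comp
      continuous_subtype_val).matrix_mulVec continuous_const)
  have hcl : IsClosed {θ : Θ | 0 ≤ (θ.1.Γ *ᵥ covPath w t) i} := isClosed_le continuous_const hc
  exact (hcl.closure_subset_iff.2 fun θ hθ => hw2 θ hθ t i) (hDd ⟨θ, hθ⟩)

theorem ae_goodPath_shift (h : ModelSetting P U X Y lam Θ θ₀ r₀ dmin δ) {ρ : ℝ} (hρ : 0 < ρ)
    (hρ1 : ρ < 1) : ∀ᵐ w ∂pathLaw P U X, ∀ n : ℕ, GoodPath Θ θ₀ ρ (shift^[n] w) :=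
  ae_all_iff.2 fun n => (h.ergodic_shift.toMeasurePreserving.iterate n).quasiMeasurePreserving.ae
    (h.ae_goodPath hρ hρ1)

end ModelSetting

end Latent

/-! ### The first-step contrast: bounds and uniform convergence. -/

section FirstStep

/-- The contrast of one observation given the latent values. -/
noncomputable def contrast (y : ℝ × ℕ) (s : Fin 2 → ℝ) : ℝ :=
  garchContrast y.1 (s 0) + countContrast y.2 (s 1)

theorem abs_log_le_of_le {d s : ℝ} (hd : 0 < d) (hs : d ≤ s) : |Real.log s| ≤ |Real.log d| + s := by
  have h1 := Real.log_le_log hd hs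
  have h2 := Real.log_le_self (hd.le.trans hs)
  have h3 := neg_abs_le (Real.log d)
  have h4 := abs_nonneg (Real.log d)
  exact abs_le.2 ⟨by linarith, by linarith⟩

/-- From `log y ≤ y ^ (p - 1) / (p - 1)`. This is where a moment of order larger than one enters. -/
theorem mul_log_le_rpow_div {p y : ℝ} (hp : 1 < p) (hy : 0 ≤ y) :
    y * Real.log y ≤ y ^ p / (p - 1) := by
  rcases hy.eq_or_lt with rfl | hy
  · simp [Real.zero_rpow (by linarith : p ≠ 0)]
  · have h1 := mul_le_mul_of_nonneg_left (Real.log_le_rpow_div hy.le (sub_pos.2 hp)) hy.le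
    have h2 : y * y ^ (p - 1) = y ^ p := by
      rw [mul_comm, ← Real.rpow_add_one hy.ne']; congr 1; ring
    rwa [← mul_div_assoc, h2] at h1

/-- From `log (s / y) ≤ s / y`. It separates the observation from the latent value, so that no
moment of their product is needed. -/
theorem mul_log_le_mul_log_add {y s : ℝ} (hy : 0 ≤ y) (hs : 0 < s) :
    y * Real.log s ≤ y * Real.log y + s := by
  rcases hy.eq_or_lt with rfl | hy
  · simpa using hs.le
  · have h1 := Real.log_le_self (div_pos hs hy).le
    rw [Real.log_div hs.ne' hy.ne'] at h1
    have h2 := mul_le_mul_of_nonneg_left h1 hy.le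
    rw [mul_div_cancel₀ _ hy.ne'] at h2
    linarith

theorem abs_mul_log_le {p d y s : ℝ} (hp : 1 < p) (hd : 0 < d) (hy : 0 ≤ y) (hs : d ≤ s) :
    |y * Real.log s| ≤ y * |Real.log d| + y ^ p / (p - 1) + s := by
  have hs0 := hd.trans_le hs
  have h1 := mul_log_le_mul_log_add hy hs0
  have h2 := mul_log_le_rpow_div hp hy
  have h3 := mul_le_mul_of_nonneg_left (Real.log_le_log hd hs) hy
  have h4 := mul_le_mul_of_nonneg_left (neg_abs_le (Real.log d)) hy
  have h5 := mul_nonneg hy (abs_nonneg (Real.log d))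
  have h6 : 0 ≤ y ^ p / (p - 1) := div_nonneg (Real.rpow_nonneg hy p) (by linarith)
  exact abs_le.2 ⟨by nlinarith, by linarith⟩

theorem contrast_eq (y : ℝ × ℕ) (s : Fin 2 → ℝ) :
    contrast y s = obsBar y 0 / s 0 + Real.log (s 0) + s 1 - obsBar y 1 * Real.log (s 1) := by
  simp only [contrast, garchContrast, countContrast, obsBar]
  simp
  ring

theorem abs_contrast_le {p d E : ℝ} (hp : 1 < p) (hd : 0 < d) {y : ℝ × ℕ} {s : Fin 2 → ℝ}
    (hs : ∀ i, d ≤ s i ∧ s i ≤ E) :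
    |contrast y s| ≤ obsBar y 0 / d + |Real.log d| + 3 * E + obsBar y 1 * |Real.log d| +
      obsBar y 1 ^ p / (p - 1) := by
  rw [contrast_eq]
  have h1 : |obsBar y 0 / s 0| ≤ obsBar y 0 / d := by
    rw [abs_of_nonneg (div_nonneg (obsBar_nonneg y 0) (hd.le.trans (hs 0).1))]
    exact div_le_div_of_nonneg_left (obsBar_nonneg y 0) hd (hs 0).1
  have h2 := abs_log_le_of_le hd (hs 0).1
  have h3 : |s 1| ≤ E := by rw [abs_of_nonneg (hd.le.trans (hs 1).1)]; exact (hs 1).2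
  have h4 := abs_mul_log_le hp hd (obsBar_nonneg y 1) (hs 1).1
  have h5 := abs_sub (obsBar y 0 / s 0 + Real.log (s 0) + s 1) (obsBar y 1 * Real.log (s 1))
  have h6 := abs_add_three (obsBar y 0 / s 0) (Real.log (s 0)) (s 1)
  linarith [(hs 0).2, (hs 1).2]

theorem abs_log_sub_log_le {d a b : ℝ} (hd : 0 < d) (ha : d ≤ a) (hb : d ≤ b) :
    |Real.log a - Real.log b| ≤ |a - b| / d := by
  wlog hab : b ≤ a generalizing a b
  · rw [abs_sub_comm, abs_sub_comm a]
    exact this hb ha (le_of_not_ge hab)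
  have hb0 := hd.trans_le hb
  have ha0 := hd.trans_le ha
  rw [abs_of_nonneg (sub_nonneg.2 (Real.log_le_log hb0 hab)), abs_of_nonneg (sub_nonneg.2 hab),
    ← Real.log_div ha0.ne' hb0.ne']
  refine (Real.log_le_sub_one_of_pos (div_pos ha0 hb0)).trans ?_
  rw [div_sub_one hb0.ne']
  exact div_le_div_of_nonneg_left (sub_nonneg.2 hab) hd hb

/-- On `[d, ∞)` the functions `1 / s` and `log s` are Lipschitz with constants `1 / d ^ 2` and `1 /
d`. -/
theorem abs_contrast_sub_le {m : ℕ} {d : ℝ} (hd : 0 < d) (y : ℝ × ℕ) (x : Fin m → ℝ)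
    {s s' : Fin 2 → ℝ} (hs : ∀ i, d ≤ s i) (hs' : ∀ i, d ≤ s' i) {ε : ℝ}
    (hε : ∀ i, |s i - s' i| ≤ ε) :
    |contrast y s - contrast y s'| ≤ (1 + 2 / d + 1 / d ^ 2) * (ε * magnitude y x) := by
  have hε0 : 0 ≤ ε := (abs_nonneg _).trans (hε 0)
  have h1 : |obsBar y 0 / s 0 - obsBar y 0 / s' 0| ≤ obsBar y 0 * (ε / d ^ 2) := by
    have ha := hd.trans_le (hs 0)
    have hb := hd.trans_le (hs' 0)
    rw [div_eq_mul_inv, div_eq_mul_inv, ← mul_sub, abs_mul, abs_of_nonneg (obsBar_nonneg y 0)]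
    refine mul_le_mul_of_nonneg_left ?_ (obsBar_nonneg y 0)
    rw [inv_sub_inv ha.ne' hb.ne', abs_div, abs_of_pos (mul_pos ha hb), abs_sub_comm]
    refine div_le_div₀ hε0 (hε 0) (by positivity) ?_
    rw [sq]
    exact mul_le_mul (hs 0) (hs' 0) hd.le ha.le
  have h2 : |Real.log (s 0) - Real.log (s' 0)| ≤ ε / d :=
    (abs_log_sub_log_le hd (hs 0) (hs' 0)).trans (div_le_div_of_nonneg_right (hε 0) hd.le)
  have h3 : |obsBar y 1 * Real.log (s 1) - obsBar y 1 * Real.log (s' 1)| ≤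
      obsBar y 1 * (ε / d) := by
    rw [← mul_sub, abs_mul, abs_of_nonneg (obsBar_nonneg y 1)]
    exact mul_le_mul_of_nonneg_left ((abs_log_sub_log_le hd (hs 1) (hs' 1)).trans
      (div_le_div_of_nonneg_right (hε 1) hd.le)) (obsBar_nonneg y 1)
  have h4 : |contrast y s - contrast y s'| ≤
      obsBar y 0 * (ε / d ^ 2) + ε / d + ε + obsBar y 1 * (ε / d) := by
    rw [contrast_eq, contrast_eq]
    have h5 := hε 1
    rw [abs_le] at h1 h2 h3 h5 ⊢
    constructor <;> linarith [h1.1, h1.2, h2.1, h2.2, h3.1, h3.2, h5.1, h5.2]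
  refine h4.trans ?_
  have hm0 := obsBar_le_magnitude y x 0
  have hm1 := obsBar_le_magnitude y x 1
  have hm2 := one_le_magnitude y x
  have e0 := mul_le_mul_of_nonneg_right hm0 (by positivity : 0 ≤ ε / d ^ 2)
  have e1 := mul_le_mul_of_nonneg_right hm1 (by positivity : 0 ≤ ε / d)
  have e2 := mul_le_mul_of_nonneg_right hm2 (by positivity : 0 ≤ ε / d)
  have e3 := mul_le_mul_of_nonneg_right hm2 hε0
  calc _ ≤ magnitude y x * (ε / d ^ 2) + magnitude y x * (ε / d) + magnitude y x * ε +
        magnitude y x * (ε / d) := by linarith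
    _ = _ := by ring

theorem hasEnvelope_shift {m : ℕ} (ρ : ℝ) (θ₀ : Param m) (w : ℤ → (Fin 2 → ℝ) × (Fin m → ℝ))
    (n : ℕ) : HasEnvelope ρ (obsPath θ₀ (shift^[n] w)) (covPath (shift^[n] w)) 0 ↔
      HasEnvelope ρ (obsPath θ₀ w) (covPath w) n := by
  have e : ∀ j : ℕ, (0 : ℤ) - 1 - j + n = n - 1 - j := fun j => by ring
  simp only [HasEnvelope, obsPath_shift, covPath_shift, e]

theorem continuousOn_contrast (y : ℝ × ℕ) :
    ContinuousOn (contrast y) {s | ∀ i, 0 < s i} := by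
  have h : contrast y = fun s =>
      obsBar y 0 / s 0 + Real.log (s 0) + s 1 - obsBar y 1 * Real.log (s 1) :=
    funext (contrast_eq y)
  rw [h]
  have c (i : Fin 2) : ContinuousOn (fun s : Fin 2 → ℝ => s i) {s | ∀ i, 0 < s i} :=
    (continuous_apply i).continuousOn
  exact (((continuousOn_const.div (c 0) fun s hs => (hs 0).ne').add
    ((c 0).log fun s hs => (hs 0).ne')).add (c 1)).sub
    (continuousOn_const.mul ((c 1).log fun s hs => (hs 1).ne'))

theorem measurable_contrast {α : Type*} [MeasurableSpace α] {f : α → ℝ × ℕ}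
    {s : α → Fin 2 → ℝ} (hf : Measurable f) (hs : Measurable s) :
    Measurable fun a => contrast (f a) (s a) := by
  simp only [contrast_eq]
  have h1 : ∀ i, Measurable fun a => obsBar (f a) i := fun i =>
    (measurable_pi_apply i).comp (measurable_obsBar.comp hf)
  have h2 : ∀ i, Measurable fun a => s a i := fun i => (measurable_pi_apply i).comp hs
  exact ((((h1 0).div (h2 0)).add (h2 0).log).add (h2 1)).sub ((h1 1).mul (h2 1).log)

variable {Ω : Type*} [MeasurableSpace Ω] {P : Measure Ω} [IsProbabilityMeasure P] {m : ℕ}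
    {U : ℤ → Ω → Fin 2 → ℝ} {X : ℤ → Ω → Fin m → ℝ} {Y : ℤ → Ω → ℝ × ℕ} {lam : ℤ → Ω → Fin 2 → ℝ}
    {Θ : Set (Param m)} {θ₀ : Param m} {r₀ dmin δ : ℝ}

namespace ModelSetting

/-- The latent values depend continuously on the parameter, are bounded away from zero and have an
integrable envelope. -/
theorem exists_pathLatent_bound (h : ModelSetting P U X Y lam Θ θ₀ r₀ dmin δ) :
    ∃ E : (ℤ → (Fin 2 → ℝ) × (Fin m → ℝ)) → ℝ, Integrable E (pathLaw P U X) ∧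
      ∀ᵐ w ∂pathLaw P U X, (∀ i, Continuous fun θ : Θ => pathLatent θ₀ θ.1 w i) ∧
        ∀ θ ∈ Θ, ∀ i, dmin ≤ pathLatent θ₀ θ w i ∧ pathLatent θ₀ θ w i ≤ E w := by
  obtain ⟨C, ρ, hC, hρ, hρ1, -, hb⟩ := exists_abs_latentTerm_le h.compact h.specB
  refine ⟨_, (h.ae_hasEnvelope hρ hρ1).2.const_mul C, ?_⟩
  filter_upwards [h.ae_goodPath hρ hρ1] with w hw
  have hbw : ∀ θ ∈ Θ, ∀ j i, _ := fun θ hθ => hb θ hθ (obsPath θ₀ w) (covPath w) 0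
  refine ⟨fun i => continuousOn_iff_continuous_domRestrict.1 (continuousOn_latent hbw hw.1 i),
    fun θ hθ i => ⟨?_, (le_abs_self _).trans (abs_latent_le (hbw θ hθ) hw.1 i)⟩⟩
  exact dmin_le_latent h.dmin_pos.le (h.dmin_le θ hθ) (h.A_nonneg θ hθ) (h.B_nonneg θ hθ)
    (hw.2 θ hθ) (summable_latentTerm (hbw θ hθ) hw.1) i

theorem exists_memLp_obsPath (h : ModelSetting P U X Y lam Θ θ₀ r₀ dmin δ) :
    ∃ p : ℝ, 1 < p ∧ ∀ i, Integrable (fun w => obsBar (obsPath θ₀ w 0) i) (pathLaw P U X) ∧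
      Integrable (fun w => obsBar (obsPath θ₀ w 0) i ^ p) (pathLaw P U X) := by
  obtain ⟨p, hp, hm⟩ := h.exists_memLp_obsBar
  have hmeas (i : Fin 2) : Measurable fun w : ℤ → (Fin 2 → ℝ) × (Fin m → ℝ) =>
      obsBar (obsPath θ₀ w 0) i :=
    (measurable_pi_apply i).comp (measurable_obsBar.comp (measurable_obsPath θ₀ 0))
  have hD := h.measurable_drivingPath.aemeasurable (μ := P)
  refine ⟨p, hp, fun i => ⟨?_, ?_⟩⟩
  · refine (integrable_map_measure (hmeas i).aestronglyMeasurable hD).2 ?_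
    refine (h.integrable_obsBar 0 i).congr ?_
    filter_upwards [h.ae_obs_eq] with ω hω
    exact congrArg (fun y : ℤ → ℝ × ℕ => obsBar (y 0) i) hω
  · refine (integrable_map_measure ((hmeas i).pow_const p).aestronglyMeasurable hD).2 ?_
    have h1 := (hm 0 i).integrable_norm_rpow (by simp; linarith) (by simp)
    refine h1.congr ?_
    filter_upwards [h.ae_obs_eq] with ω hω
    rw [Real.norm_of_nonneg (obsBar_nonneg _ _), ENNReal.toReal_ofReal (by linarith)]
    exact congrArg (fun y : ℤ → ℝ × ℕ => obsBar (y 0) i ^ p) hω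

/-- The uniform ergodic theorem for the contrast at time zero. The dominating function is integrable
since it is linear in the latent envelope, the observations and a power of the count with a finite
moment. -/
theorem tendstoUniformly_latent_criterion (h : ModelSetting P U X Y lam Θ θ₀ r₀ dmin δ) :
    (∀ θ : Θ, Integrable (fun w => contrast (obsPath θ₀ w 0) (pathLatent θ₀ θ w))
      (pathLaw P U X)) ∧
    (Continuous fun θ : Θ =>
      ∫ w, contrast (obsPath θ₀ w 0) (pathLatent θ₀ θ w) ∂pathLaw P U X) ∧
    ∀ᵐ w ∂pathLaw P U X, TendstoUniformly
      (fun (n : ℕ) (θ : Θ) => pseudoCriterion n (obsPath θ₀ w)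
        fun t => latent θ (obsPath θ₀ w) (covPath w) t)
      (fun θ => ∫ w, contrast (obsPath θ₀ w 0) (pathLatent θ₀ θ w) ∂pathLaw P U X) atTop := by
  have := h.isProbabilityMeasure_pathLaw
  have : CompactSpace Θ := isCompact_iff_compactSpace.1 h.compact
  obtain ⟨E, hE, hEb⟩ := h.exists_pathLatent_bound
  obtain ⟨p, hp, hY⟩ := h.exists_memLp_obsPath
  have hH : Integrable (fun w => obsBar (obsPath θ₀ w 0) 0 / dmin + |Real.log dmin| + 3 * E w +
      obsBar (obsPath θ₀ w 0) 1 * |Real.log dmin| + obsBar (obsPath θ₀ w 0) 1 ^ p / (p - 1))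
      (pathLaw P U X) :=
    (((((hY 0).1.div_const dmin).add (integrable_const _)).add (hE.const_mul 3)).add
      ((hY 1).1.mul_const _)).add ((hY 1).2.div_const _)
  obtain ⟨h1, h2, h3⟩ := ae_tendsto_uniform_average h.ergodic_shift
    (g := fun (θ : Θ) w => contrast (obsPath θ₀ w 0) (pathLatent θ₀ θ w))
    (fun θ => measurable_contrast (measurable_obsPath θ₀ 0) (measurable_pathLatent θ₀ θ.1)) hH (by
      filter_upwards [hEb] with w hw
      refine ⟨?_, fun θ => abs_contrast_le hp h.dmin_pos (hw.2 θ.1 θ.2)⟩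
      exact (continuousOn_contrast _).comp_continuous (continuous_pi hw.1)
        fun θ i => h.dmin_pos.trans_le (hw.2 θ.1 θ.2 i).1)
  refine ⟨h2, h1, ?_⟩
  filter_upwards [h3] with w hw
  refine (congrArg (fun F => TendstoUniformly F _ atTop) ?_).mp hw
  funext n θ
  simp only [pathLatent_shift, obsPath_shift, zero_add]
  rfl

end ModelSetting

end FirstStep

/-! ### Negligibility of the initial value and identification of the latent values. -/

section FirstStepLimit

variable {Ω : Type*} [MeasurableSpace Ω] {P : Measure Ω} [IsProbabilityMeasure P] {m : ℕ}
    {U : ℤ → Ω → Fin 2 → ℝ} {X : ℤ → Ω → Fin m → ℝ} {Y : ℤ → Ω → ℝ × ℕ} {lam : ℤ → Ω → Fin 2 → ℝ}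
    {Θ : Set (Param m)} {θ₀ : Param m} {r₀ dmin δ : ℝ}

theorem abs_mulVec_le {M : Matrix (Fin 2) (Fin 2) ℝ} {c D : ℝ} (hM : ∀ i j, |M i j| ≤ c)
    (v : Fin 2 → ℝ) (hv : ∀ j, |v j| ≤ D) (i : Fin 2) : |(M *ᵥ v) i| ≤ c * (2 * D) := by
  rw [Matrix.mulVec, dotProduct]
  refine (Finset.abs_sum_le_sum_abs _ _).trans ?_
  calc _ ≤ ∑ _j : Fin 2, c * D := Finset.sum_le_sum fun j _ => by
        rw [abs_mul]
        exact mul_le_mul (hM i j) (hv j) (abs_nonneg _) ((abs_nonneg _).trans (hM i j))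
    _ = _ := by simp; ring

namespace ModelSetting

/-- Weighted sums along the trajectory of nonnegative functionals with bounded mean converge. -/
theorem ae_summable_pow_mul {S : Type*} [MeasurableSpace S] {μ : Measure S} {ρ : ℝ} (hρ : 0 < ρ)
    (hρ1 : ρ < 1) {f : ℕ → S → ℝ} (hf : ∀ j, Measurable (f j)) (hf0 : ∀ j x, 0 ≤ f j x)
    {M : ENNReal} (hM : M ≠ ⊤) (hle : ∀ j, ∫⁻ x, ENNReal.ofReal (f j x) ∂μ ≤ M) :
    ∀ᵐ x ∂μ, Summable fun j => ρ ^ j * f j x := by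
  have hfm : ∀ j, Measurable fun x => ρ ^ j * f j x := fun j => (hf j).const_mul _
  have hfin : ∫⁻ x, ∑' j, ENNReal.ofReal (ρ ^ j * f j x) ∂μ ≠ ⊤ := by
    rw [lintegral_tsum fun j => (hfm j).ennreal_ofReal.aemeasurable]
    have h1 : ∀ j, ∫⁻ x, ENNReal.ofReal (ρ ^ j * f j x) ∂μ ≤ ENNReal.ofReal ρ ^ j * M := by
      intro j
      simp only [ENNReal.ofReal_mul (pow_nonneg hρ.le j)]
      rw [lintegral_const_mul _ (hf j).ennreal_ofReal, ENNReal.ofReal_pow hρ.le]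
      gcongr
      exact hle _
    refine ne_top_of_le_ne_top ?_ (ENNReal.tsum_le_tsum h1)
    rw [ENNReal.tsum_mul_right, ENNReal.tsum_geometric]
    refine ENNReal.mul_ne_top (ENNReal.inv_ne_top.2 ?_) hM
    rw [← ENNReal.ofReal_one, ← ENNReal.ofReal_sub _ hρ.le]
    simpa using hρ1
  filter_upwards [ae_lt_top (Measurable.tsum fun j => (hfm j).ennreal_ofReal) hfin] with x hx
  have := ENNReal.summable_toReal hx.ne
  simpa only [ENNReal.toReal_ofReal (mul_nonneg (pow_nonneg hρ.le _) (hf0 _ x))] using this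

/-- The criteria built on the stationary and on the initialized latent values are asymptotically
equivalent, uniformly over the parameter set. -/
theorem tendstoUniformly_criterion_sub (h : ModelSetting P U X Y lam Θ θ₀ r₀ dmin δ)
    {l₀ : Fin 2 → ℝ} (hl₀ : ∀ i, 0 ≤ l₀ i) :
    ∀ᵐ w ∂pathLaw P U X, TendstoUniformly
      (fun (n : ℕ) (θ : Θ) => pseudoCriterion n (obsPath θ₀ w)
        (initLatent l₀ θ (obsPath θ₀ w) (covPath w)) -
        pseudoCriterion n (obsPath θ₀ w) fun t => latent θ (obsPath θ₀ w) (covPath w) t)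
      (fun _ => 0) atTop := by
  obtain ⟨C, ρ, hC, hρ, hρ1, hBp, hb⟩ := exists_abs_latentTerm_le h.compact h.specB
  obtain ⟨M, hM, hle⟩ := h.exists_lintegral_magnitude_le
  have hsum := ae_summable_pow_mul hρ hρ1
    (f := fun j w => magnitude (obsPath θ₀ w (j : ℤ)) (covPath w j))
    (fun j => measurable_magnitude_path θ₀ _)
    (fun j w => zero_le_one.trans (one_le_magnitude _ _)) hM fun j => hle j
  filter_upwards [h.ae_goodPath_shift hρ hρ1, hsum] with w hw hs
  set y := obsPath θ₀ w with hy
  set x := covPath w with hx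
  have henv : ∀ t : ℕ, HasEnvelope ρ y x t := fun t => (hasEnvelope_shift ρ θ₀ w t).1 (hw t).1
  have hΓ : ∀ θ ∈ Θ, ∀ (t : ℤ) i, 0 ≤ (θ.Γ *ᵥ x t) i := (hw 0).2
  have hsl : ∀ θ ∈ Θ, ∀ t : ℕ, Summable (latentTerm θ y x t) := fun θ hθ t =>
    summable_latentTerm (fun j i => hb θ hθ y x t j i) (henv t)
  set D : ℝ := C * envelope ρ y x 0 + ∑ i, |l₀ i| with hD
  have hD1 : ∀ θ ∈ Θ, ∀ i, |(latent θ y x 0 - l₀) i| ≤ D := fun θ hθ i => by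
    have h1 := abs_latent_le (fun j i => hb θ hθ y x 0 j i) (henv 0) i
    have h2 := Finset.single_le_sum (f := fun i => |l₀ i|) (fun i _ => abs_nonneg _)
      (Finset.mem_univ i)
    have h3 := abs_sub (latent θ y x 0 i) (l₀ i)
    simp only [Pi.sub_apply]
    linarith
  have hdiff : ∀ θ ∈ Θ, ∀ (t : ℕ) i, |initLatent l₀ θ y x t i - latent θ y x t i| ≤
      C * (2 * D) * ρ ^ t := fun θ hθ t i => by
    have h1 := abs_mulVec_le (hBp θ hθ t) _ (hD1 θ hθ) i
    rw [← latent_sub_initLatent l₀ (hsl θ hθ) t, Pi.sub_apply, abs_sub_comm] at h1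
    linarith
  set G : ℝ := (1 + 2 / dmin + 1 / dmin ^ 2) * (C * (2 * D)) with hG
  have hD0 : 0 ≤ D := (abs_nonneg _).trans (hD1 θ₀ h.mem 0)
  have hd0 := h.dmin_pos
  have hG0 : 0 ≤ G := by positivity
  have hterm : ∀ θ ∈ Θ, ∀ t : ℕ, 1 ≤ t →
      |contrast (y t) (initLatent l₀ θ y x t) - contrast (y t) (latent θ y x t)| ≤
        G * (ρ ^ t * magnitude (y t) (x t)) := fun θ hθ t ht => by
    obtain ⟨k, rfl⟩ : ∃ k, t = k + 1 := ⟨t - 1, (Nat.sub_add_cancel ht).symm⟩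
    refine (abs_contrast_sub_le hd0 (y (k + 1 : ℕ)) (x (k + 1 : ℕ)) (fun i => ?_) (fun i => ?_)
      (fun i => hdiff θ hθ (k + 1) i)).trans (le_of_eq ?_)
    · exact dmin_le_initLatent hl₀ hd0.le (h.dmin_le θ hθ) (h.A_nonneg θ hθ) (h.B_nonneg θ hθ)
        (hΓ θ hθ) k i
    · exact dmin_le_latent hd0.le (h.dmin_le θ hθ) (h.A_nonneg θ hθ) (h.B_nonneg θ hθ)
        (hΓ θ hθ) (hsl θ hθ _) i
    · rw [hG]; ring
  have hm0 : ∀ t : ℕ, 0 ≤ ρ ^ t * magnitude (y t) (x t) := fun t =>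
    mul_nonneg (by positivity) (zero_le_one.trans (one_le_magnitude _ _))
  -- The geometric factor makes the discrepancies summable along the path, so the two averages
  -- differ by at most `W / n`.
  set W : ℝ := G * ∑' t : ℕ, ρ ^ t * magnitude (y t) (x t) with hW
  have hbound : ∀ (n : ℕ) (θ : Θ), |pseudoCriterion n y (initLatent l₀ θ y x) -
      pseudoCriterion n y fun t => latent θ y x t| ≤ (n : ℝ)⁻¹ * W := fun n θ => by
    rw [pseudoCriterion, pseudoCriterion, ← mul_sub, abs_mul, abs_of_nonneg (by positivity),
      ← Finset.sum_sub_distrib]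
    refine mul_le_mul_of_nonneg_left ?_ (by positivity)
    refine (Finset.abs_sum_le_sum_abs _ _).trans ?_
    calc _ ≤ ∑ t ∈ Finset.Icc 1 n, G * (ρ ^ t * magnitude (y t) (x t)) :=
          Finset.sum_le_sum fun t ht => hterm θ.1 θ.2 t (Finset.mem_Icc.1 ht).1
      _ ≤ W := by
          rw [← Finset.mul_sum]
          exact mul_le_mul_of_nonneg_left (hs.sum_le_tsum _ fun t _ => hm0 t) hG0
  have hlim : Tendsto (fun n : ℕ => (n : ℝ)⁻¹ * W) atTop (𝓝 0) := by
    simpa using (tendsto_inv_atTop_nhds_zero_nat (𝕜 := ℝ)).mul_const W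
  rw [Metric.tendstoUniformly_iff]
  intro ε hε
  filter_upwards [hlim.eventually (gt_mem_nhds hε)] with n hn θ
  rw [dist_comm, Real.dist_0_eq_abs]
  exact (hbound n θ).trans_lt hn

/-- At the true parameter, the latent values along the path are those of the model. -/
theorem ae_pathLatent_true (h : ModelSetting P U X Y lam Θ θ₀ r₀ dmin δ) :
    ∀ᵐ ω ∂P, pathLatent θ₀ θ₀ (drivingPath U X ω) = lam 0 ω := by
  obtain ⟨C, ρ, hC, hρ, hρ1, hBp, hb⟩ := exists_abs_latentTerm_le h.compact h.specB
  have hgood := ae_of_ae_map h.measurable_drivingPath.aemeasurable (h.ae_goodPath hρ hρ1)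
  have hsum (i : Fin 2) := ae_summable_pow_mul (μ := P) hρ hρ1
    (f := fun j ω => |lam (-(j : ℤ)) ω i|)
    (fun j => ((measurable_pi_apply i).comp (h.measurable_lam _)).abs)
    (fun j ω => abs_nonneg _) (M := ∫⁻ ω, ENNReal.ofReal |lam 0 ω i| ∂P)
    ((h.integrable_lam 0 i).abs.lintegral_lt_top).ne fun j =>
      (h.lintegral_lam (-(j : ℤ)) (f := fun l => ENNReal.ofReal |l i|)
        (measurable_pi_apply i).abs.ennreal_ofReal).le
  filter_upwards [hgood, ae_all_iff.2 hsum, h.ae_obs_eq, ae_all_iff.2 h.sol.latent_eq]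
    with ω hω hs hobs hlam
  rw [pathLatent, ← hobs]
  rw [GoodPath, ← hobs] at hω
  set y : ℤ → ℝ × ℕ := fun t => Y t ω with hy
  set x := covPath (drivingPath U X ω) with hx
  have hsl : Summable (latentTerm θ₀ y x 0) :=
    summable_latentTerm (fun j i => hb θ₀ h.mem y x 0 j i) hω.1
  -- Unrolling the recursion `n` steps back leaves the remainder `B ^ n` applied to the latent value
  -- at `-n`. It vanishes because the latent values weighted by `ρ ^ n` are almost surely summable.
  have hrec : ∀ n : ℕ, lam 0 ω - ∑ j ∈ Finset.range n, latentTerm θ₀ y x 0 j =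
      (θ₀.B ^ n) *ᵥ lam (-(n : ℤ)) ω := by
    intro n
    induction n with
    | zero => simp
    | succ n ih =>
      have e : -((n + 1 : ℕ) : ℤ) = -(n : ℤ) - 1 := by push_cast; ring
      have e' : (0 : ℤ) - 1 - n = -(n : ℤ) - 1 := by ring
      have h1 := hlam (-(n : ℤ))
      rw [Finset.sum_range_succ, ← sub_sub, ih, h1, e, latentTerm, e', pow_succ,
        ← Matrix.mulVec_mulVec, ← Matrix.mulVec_sub]
      congr 1
      simp only [latentStep, hy, hx, covPath, drivingPath]
      abel
  have hlim : Tendsto (fun n : ℕ => (θ₀.B ^ n) *ᵥ lam (-(n : ℤ)) ω) atTop (𝓝 0) := by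
    refine tendsto_pi_nhds.2 fun i => ?_
    have h1 : Tendsto (fun n : ℕ => C * ∑ j, ρ ^ n * |lam (-(n : ℤ)) ω j|) atTop (𝓝 0) := by
      have := (tendsto_finsetSum Finset.univ fun j _ => (hs j).tendsto_atTop_zero).const_mul C
      simpa using this
    refine squeeze_zero_norm (fun n => ?_) h1
    rw [Real.norm_eq_abs]
    conv_lhs => rw [Matrix.mulVec, dotProduct]
    rw [Finset.mul_sum]
    refine (Finset.abs_sum_le_sum_abs _ _).trans (Finset.sum_le_sum fun j _ => ?_)
    rw [abs_mul, ← mul_assoc]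
    exact mul_le_mul_of_nonneg_right (hBp θ₀ h.mem n i j) (abs_nonneg _)
  have h2 : Tendsto (fun n : ℕ => lam 0 ω - ∑ j ∈ Finset.range n, latentTerm θ₀ y x 0 j) atTop
      (𝓝 (lam 0 ω - latent θ₀ y x 0)) := hsl.hasSum.tendsto_sum_nat.const_sub _
  simp only [hrec] at h2
  exact (sub_eq_zero.1 (tendsto_nhds_unique h2 hlim)).symm

theorem measurable_latent (θ : Param m) {α : Type*} [MeasurableSpace α]
    {y : α → ℤ → ℝ × ℕ} {x : α → ℤ → Fin m → ℝ} {t : ℤ}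
    (hy : ∀ j : ℕ, Measurable fun a => y a (t - 1 - j))
    (hx : ∀ j : ℕ, Measurable fun a => x a (t - 1 - j)) :
    Measurable fun a => latent θ (y a) (x a) t :=
  Measurable.tsum fun j => measurable_latentTerm θ t j (hy j) (hx j)

/-- Predictability: only dates up to `-1` enter, so the noise at time zero is independent of this
value. -/
theorem measurable_pathLatent_drivingPath (θ₀ θ : Param m) :
    Measurable[past U X (0 - 1)] fun ω => pathLatent θ₀ θ (drivingPath U X ω) := by
  have hU (s : ℤ) (hs : s ≤ 0 - 1) : Measurable[past U X (0 - 1)] fun ω => (U s ω, X s ω) :=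
    measurable_pair_past hs
  have hp (s : ℤ) (hs : s ≤ 0 - 1) :
      Measurable[past U X (0 - 1)] fun ω => pastOf (drivingPath U X ω) s :=
    @measurable_pi_iff _ _ _ (past U X (0 - 1)) _ _ |>.2 fun j => hU _ (by omega)
  have ho (s : ℤ) (hs : s ≤ 0 - 1) :
      Measurable[past U X (0 - 1)] fun ω => obsPath θ₀ (drivingPath U X ω) s :=
    measurable_genObs.comp (((measurable_statLatent θ₀).comp (hp s hs)).prodMk (hU s hs).fst)
  exact @measurable_latent m θ Ω (past U X (0 - 1)) (fun ω => obsPath θ₀ (drivingPath U X ω))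
    (fun ω => covPath (drivingPath U X ω)) 0 (fun j => ho _ (by omega))
    fun j => (hU _ (by omega)).snd

theorem integral_indep (h : ModelSetting P U X Y lam Θ θ₀ r₀ dmin δ) (t : ℤ) {E : Type*}
    [MeasurableSpace E] {L : Ω → E} (hL : Measurable[past U X (t - 1)] L)
    {f : E → (Fin 2 → ℝ) → ℝ} (hf : Measurable fun p : E × (Fin 2 → ℝ) => f p.1 p.2)
    (hi : Integrable (fun ω => f (L ω) (U t ω)) P) :
    Integrable (fun ω => ∫ u, f (L ω) u ∂gaussianCopula (corrMatrix r₀)) P ∧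
      ∫ ω, f (L ω) (U t ω) ∂P = ∫ ω, ∫ u, f (L ω) u ∂gaussianCopula (corrMatrix r₀) ∂P := by
  have := isProbabilityMeasure_gaussianCopula h.corr_mem
  have hLm : Measurable L := hL.mono (h.past_le _) le_rfl
  have hLU : Measurable fun ω => (L ω, U t ω) := hLm.prodMk (h.noise.measurable_noise t)
  have := Measure.isProbabilityMeasure_map (μ := P) hLm.aemeasurable
  have h1 : Integrable (fun p : E × (Fin 2 → ℝ) => f p.1 p.2)
      ((P.map L).prod (gaussianCopula (corrMatrix r₀))) := by
    rw [← h.map_prod_eq t hL]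
    exact (integrable_map_measure hf.aestronglyMeasurable hLU.aemeasurable).2 hi
  have hsm : StronglyMeasurable fun e => ∫ u, f e u ∂gaussianCopula (corrMatrix r₀) :=
    hf.stronglyMeasurable.integral_prod_right'
  refine ⟨(integrable_map_measure hsm.aestronglyMeasurable hLm.aemeasurable).1
    h1.integral_prod_left, ?_⟩
  rw [← integral_map (φ := L) hLm.aemeasurable hsm.aestronglyMeasurable,
    ← integral_prod _ h1, ← h.map_prod_eq t hL,
    integral_map hLU.aemeasurable hf.aestronglyMeasurable]

end ModelSetting

/-- The conditional mean of the contrast when the latent values are `a`. -/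
noncomputable def meanContrast (a b : Fin 2 → ℝ) : ℝ :=
  a 0 / b 0 + Real.log (b 0) + b 1 - a 1 * Real.log (b 1)

theorem integral_obsBar_genObs {r : ℝ} (hr : r ∈ Set.Ioo (-1 : ℝ) 1) {s : Fin 2 → ℝ}
    (hs : ∀ i, 0 ≤ s i) (i : Fin 2) :
    Integrable (fun u => obsBar (genObs s u) i) (gaussianCopula (corrMatrix r)) ∧
      ∫ u, obsBar (genObs s u) i ∂gaussianCopula (corrMatrix r) = s i := by
  have hm : Measurable fun u => obsBar (genObs s u) i :=
    (measurable_pi_apply i).comp (measurable_obsBar.comp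
      (measurable_genObs.comp (measurable_const.prodMk measurable_id)))
  have h1 := lintegral_obsBar_genObs hr hs i
  refine ⟨⟨hm.aestronglyMeasurable, ?_⟩, ?_⟩
  · rw [hasFiniteIntegral_iff_ofReal (ae_of_all _ fun u => obsBar_nonneg _ i), h1]
    exact ENNReal.ofReal_lt_top
  · rw [integral_eq_lintegral_of_nonneg_ae (ae_of_all _ fun u => obsBar_nonneg _ i)
      hm.aestronglyMeasurable, h1, ENNReal.toReal_ofReal (hs i)]

theorem integral_contrast_genObs {r : ℝ} (hr : r ∈ Set.Ioo (-1 : ℝ) 1) {a : Fin 2 → ℝ}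
    (ha : ∀ i, 0 ≤ a i) (b : Fin 2 → ℝ) :
    ∫ u, contrast (genObs a u) b ∂gaussianCopula (corrMatrix r) = meanContrast a b := by
  have := isProbabilityMeasure_gaussianCopula hr
  have h0 := integral_obsBar_genObs hr ha 0
  have h1 := integral_obsBar_genObs hr ha 1
  simp only [contrast_eq]
  have i1 := h0.1.div_const (b 0)
  have i2 := h1.1.mul_const (Real.log (b 1))
  have i3 : Integrable (fun u => obsBar (genObs a u) 0 / b 0 + Real.log (b 0))
    (gaussianCopula (corrMatrix r)) := i1.add (integrable_const _)
  have i4 : Integrable (fun u => obsBar (genObs a u) 0 / b 0 + Real.log (b 0) + b 1)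
    (gaussianCopula (corrMatrix r)) := i3.add (integrable_const _)
  rw [integral_sub i4 i2, integral_add i3 (integrable_const _), integral_add i1
    (integrable_const _), integral_div, integral_mul_const, h0.2, h1.2, meanContrast]
  simp

/-- The excess is a sum of terms `x - 1 - log x`, with `x = a 0 / b 0` for the Gaussian part and `x
= b 1 / a 1`, weighted by `a 1`, for the Poisson part. Such a term vanishes only at `x = 1`. -/
theorem meanContrast_self_le {a b : Fin 2 → ℝ} (ha : ∀ i, 0 < a i) (hb : ∀ i, 0 < b i) :
    meanContrast a a ≤ meanContrast a b ∧ (meanContrast a a = meanContrast a b → b = a) := by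
  have e : meanContrast a b - meanContrast a a = (a 0 / b 0 - 1 - Real.log (a 0 / b 0)) +
      a 1 * (b 1 / a 1 - 1 - Real.log (b 1 / a 1)) := by
    have := (ha 0).ne'
    have := (ha 1).ne'
    rw [Real.log_div (ha 0).ne' (hb 0).ne', Real.log_div (hb 1).ne' (ha 1).ne', meanContrast,
      meanContrast]
    field_simp
    ring
  have h0 := div_pos (ha 0) (hb 0)
  have h1 := div_pos (hb 1) (ha 1)
  have k0 : 0 ≤ a 0 / b 0 - 1 - Real.log (a 0 / b 0) := by
    linarith [Real.log_le_sub_one_of_pos h0]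
  have k1 : 0 ≤ b 1 / a 1 - 1 - Real.log (b 1 / a 1) := by
    linarith [Real.log_le_sub_one_of_pos h1]
  have k2 := mul_nonneg (ha 1).le k1
  refine ⟨by linarith, fun heq => ?_⟩
  have e0 : a 0 / b 0 = 1 := by
    by_contra hne
    linarith [Real.log_lt_sub_one_of_pos h0 hne]
  have e1 : b 1 / a 1 = 1 := by
    by_contra hne
    have := mul_pos (ha 1) (by linarith [Real.log_lt_sub_one_of_pos h1 hne] :
      0 < b 1 / a 1 - 1 - Real.log (b 1 / a 1))
    linarith
  rw [div_eq_one_iff_eq (hb 0).ne'] at e0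
  rw [div_eq_one_iff_eq (ha 1).ne'] at e1
  ext i
  fin_cases i
  · exact e0.symm
  · exact e1

namespace ModelSetting

theorem ae_obsPath_zero (h : ModelSetting P U X Y lam Θ θ₀ r₀ dmin δ) :
    ∀ᵐ ω ∂P, obsPath θ₀ (drivingPath U X ω) 0 =
      genObs (pathLatent θ₀ θ₀ (drivingPath U X ω)) (U 0 ω) := by
  filter_upwards [h.ae_pathLatent_true, h.ae_obs_eq, h.ae_Y_eq] with ω h1 h2 h3
  rw [h1, ← h3, ← h2]

/-- The true latent values are identified by the mean contrast. -/
theorem ae_pathLatent_eq_of_integral_le (h : ModelSetting P U X Y lam Θ θ₀ r₀ dmin δ) {θ : Param m}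
    (hθ : θ ∈ Θ) (hle : ∫ w, contrast (obsPath θ₀ w 0) (pathLatent θ₀ θ w) ∂pathLaw P U X ≤
      ∫ w, contrast (obsPath θ₀ w 0) (pathLatent θ₀ θ₀ w) ∂pathLaw P U X) :
    pathLatent θ₀ θ =ᵐ[pathLaw P U X] pathLatent θ₀ θ₀ := by
  have hD := h.measurable_drivingPath.aemeasurable (μ := P)
  have hc (θ : Param m) : Measurable fun w => contrast (obsPath θ₀ w 0) (pathLatent θ₀ θ w) :=
    measurable_contrast (measurable_obsPath θ₀ 0) (measurable_pathLatent θ₀ θ)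
  obtain ⟨E, -, hEb⟩ := h.exists_pathLatent_bound
  have hpos : ∀ᵐ ω ∂P, ∀ θ ∈ Θ, ∀ i, 0 < pathLatent θ₀ θ (drivingPath U X ω) i := by
    filter_upwards [ae_of_ae_map hD hEb] with ω hω θ hθ i
    exact h.dmin_pos.trans_le (hω.2 θ hθ i).1
  -- The contrast is affine in `obsBar`, so conditioning on the past replaces the observation by its
  -- conditional mean, the true latent value.
  have key : ∀ θ ∈ Θ, Integrable (fun ω => meanContrast (pathLatent θ₀ θ₀ (drivingPath U X ω))
      (pathLatent θ₀ θ (drivingPath U X ω))) P ∧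
      ∫ w, contrast (obsPath θ₀ w 0) (pathLatent θ₀ θ w) ∂pathLaw P U X =
      ∫ ω, meanContrast (pathLatent θ₀ θ₀ (drivingPath U X ω))
        (pathLatent θ₀ θ (drivingPath U X ω)) ∂P := by
    intro θ hθ
    have hi := h.tendstoUniformly_latent_criterion.1 ⟨θ, hθ⟩
    have hi' := (integrable_map_measure (hc θ).aestronglyMeasurable hD).1 hi
    have hae : (fun ω => contrast (obsPath θ₀ (drivingPath U X ω) 0)
        (pathLatent θ₀ θ (drivingPath U X ω))) =ᵐ[P] fun ω =>
        contrast (genObs (pathLatent θ₀ θ₀ (drivingPath U X ω)) (U 0 ω))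
          (pathLatent θ₀ θ (drivingPath U X ω)) := by
      filter_upwards [h.ae_obsPath_zero] with ω hω
      rw [hω]
    have hL : Measurable[past U X (0 - 1)] fun ω => (pathLatent θ₀ θ₀ (drivingPath U X ω),
        pathLatent θ₀ θ (drivingPath U X ω)) :=
      (measurable_pathLatent_drivingPath θ₀ θ₀).prodMk (measurable_pathLatent_drivingPath θ₀ θ)
    have hf : Measurable fun p : ((Fin 2 → ℝ) × (Fin 2 → ℝ)) × (Fin 2 → ℝ) =>
        contrast (genObs p.1.1 p.2) p.1.2 :=
      measurable_contrast (measurable_genObs.comp (measurable_fst.fst.prodMk measurable_snd))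
        measurable_fst.snd
    obtain ⟨j1, j2⟩ := h.integral_indep 0 hL (f := fun p u => contrast (genObs p.1 u) p.2) hf
      (hi'.congr hae)
    have hinner : (fun ω => ∫ u, contrast (genObs (pathLatent θ₀ θ₀ (drivingPath U X ω)) u)
        (pathLatent θ₀ θ (drivingPath U X ω)) ∂gaussianCopula (corrMatrix r₀)) =ᵐ[P]
        fun ω => meanContrast (pathLatent θ₀ θ₀ (drivingPath U X ω))
          (pathLatent θ₀ θ (drivingPath U X ω)) := by
      filter_upwards [hpos] with ω hω
      exact integral_contrast_genObs h.corr_mem (fun i => (hω θ₀ h.mem i).le) _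
    refine ⟨j1.congr hinner, ?_⟩
    rw [pathLaw, integral_map hD (hc θ).aestronglyMeasurable, integral_congr_ae hae, j2,
      integral_congr_ae hinner]
  obtain ⟨i1, e1⟩ := key θ hθ
  obtain ⟨i2, e2⟩ := key θ₀ h.mem
  rw [e1, e2] at hle
  have hnn : 0 ≤ᵐ[P] fun ω => meanContrast (pathLatent θ₀ θ₀ (drivingPath U X ω))
      (pathLatent θ₀ θ (drivingPath U X ω)) - meanContrast (pathLatent θ₀ θ₀ (drivingPath U X ω))
      (pathLatent θ₀ θ₀ (drivingPath U X ω)) := by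
    filter_upwards [hpos] with ω hω
    exact sub_nonneg.2 (meanContrast_self_le (hω θ₀ h.mem) (hω θ hθ)).1
  have hzero := (integral_eq_zero_iff_of_nonneg_ae hnn (i1.sub i2)).1
    (le_antisymm (by rw [integral_sub i1 i2]; linarith) (integral_nonneg_of_ae hnn))
  refine (ae_map_iff hD (measurableSet_eq_fun (measurable_pathLatent θ₀ θ)
    (measurable_pathLatent θ₀ θ₀))).2 ?_
  filter_upwards [hzero, hpos] with ω h1 h2
  exact (meanContrast_self_le (h2 θ₀ h.mem) (h2 θ hθ)).2 (sub_eq_zero.1 h1).symm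

end ModelSetting

end FirstStepLimit

/-! ### Conditional probabilities of the counts given the Gaussian score. -/

section CellProbabilities

/-- The conditional distribution function, given the first Gaussian score `z`, of the second
coordinate of the copula. -/
noncomputable def copulaCDF (r z c : ℝ) : ℝ :=
  if 0 < c then stdGaussianCDF ((stdGaussianQuantile c - r * z) / √(1 - r ^ 2)) else 0

/-- The conditional probability of the count `n` given the first Gaussian score `z`. -/
noncomputable def cellProb (r z s : ℝ) (n : ℕ) : ℝ :=
  copulaCDF r z (poissonLT s (n + 1)) - copulaCDF r z (poissonLT s n)

/-- The levels `c ≤ 0` need their own branch in `copulaCDF`: the quantile takes the default value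
`0` there, whereas the event is empty. -/
theorem condGaussian_real_cdf_le {r : ℝ} (hr : r ∈ Set.Ioo (-1 : ℝ) 1) (z : ℝ) {c : ℝ}
    (hc : c < 1) : (condGaussian r z).real {x | stdGaussianCDF x ≤ c} = copulaCDF r z c := by
  by_cases h0 : 0 < c
  · have e : {x | stdGaussianCDF x ≤ c} = Set.Iic (stdGaussianQuantile c) := by
      ext x
      exact stdGaussianCDF_le_iff ⟨h0, hc⟩ x
    have h1 := one_sub_sq_pos hr
    rw [e, copulaCDF, if_pos h0, condGaussian, ← cdf_eq_real, cdf_gaussianReal (by simpa using h1),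
      Real.coe_toNNReal _ h1.le]
  · have e : {x | stdGaussianCDF x ≤ c} = ∅ := by
      ext x
      simpa using (not_lt.1 h0).trans_lt (stdGaussianCDF_pos x)
    rw [e, copulaCDF, if_neg h0, measureReal_empty]

theorem setOf_poissonQuantile_eq {s : ℝ} (hs : 0 ≤ s) (n : ℕ) :
    {x | poissonQuantile s (stdGaussianCDF x) = n} =
      {x | stdGaussianCDF x ∈ Set.Ioc (poissonLT s n) (poissonLT s (n + 1))} := by
  ext x
  exact poissonQuantile_eq_iff hs (stdGaussianCDF_mem x) n

theorem cellProb_eq_real {r : ℝ} (hr : r ∈ Set.Ioo (-1 : ℝ) 1) (z : ℝ) {s : ℝ} (hs : 0 < s)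
    (n : ℕ) : cellProb r z s n =
      (condGaussian r z).real {x | poissonQuantile s (stdGaussianCDF x) = n} := by
  have e : {x | stdGaussianCDF x ∈ Set.Ioc (poissonLT s n) (poissonLT s (n + 1))} =
      {x | stdGaussianCDF x ≤ poissonLT s (n + 1)} \ {x | stdGaussianCDF x ≤ poissonLT s n} := by
    ext x
    simp [and_comm]
  have hsub : {x | stdGaussianCDF x ≤ poissonLT s n} ⊆
      {x | stdGaussianCDF x ≤ poissonLT s (n + 1)} := fun x (hx : stdGaussianCDF x ≤ _) =>
    hx.trans (monotone_poissonLT hs.le n.le_succ)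
  rw [setOf_poissonQuantile_eq hs.le, e, measureReal_sdiff hsub
    (measurableSet_le continuous_stdGaussianCDF.measurable measurable_const),
    condGaussian_real_cdf_le hr z (poissonLT_lt_one hs _),
    condGaussian_real_cdf_le hr z (poissonLT_lt_one hs _), cellProb]

/-- Substituting `u = stdGaussianCDF x` turns the copula density into the density of `condGaussian r
z` with respect to the standard Gaussian law. -/
theorem integral_gaussianCopulaDensity {r : ℝ} (hr : r ∈ Set.Ioo (-1 : ℝ) 1) (z : ℝ) {s : ℝ}
    (hs : 0 < s) (n : ℕ) : ∫ u in (poissonLT s n)..(poissonLT s (n + 1)),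
      gaussianCopulaDensity (corrMatrix r) ![stdGaussianCDF z, u] = cellProb r z s n := by
  have hd : Measurable fun u => gaussianCopulaDensity (corrMatrix r) ![stdGaussianCDF z, u] := by
    have e : (fun u => gaussianCopulaDensity (corrMatrix r) ![stdGaussianCDF z, u]) =
        fun u => gaussianRatio r z (stdGaussianQuantile u) :=
      funext fun u => by rw [gaussianCopulaDensity_corrMatrix hr]; simp
    rw [e]
    exact (measurable_gaussianRatio_right r z).comp measurable_stdGaussianQuantile
  have hnn : ∀ u, 0 ≤ gaussianCopulaDensity (corrMatrix r) ![stdGaussianCDF z, u] := fun u => by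
    rw [gaussianCopulaDensity_corrMatrix hr]
    exact (gaussianRatio_pos hr _ _).le
  have hsub : Set.Ioc (poissonLT s n) (poissonLT s (n + 1)) ⊆ Set.Ioo 0 1 := fun u hu =>
    ⟨(poissonLT_nonneg hs.le n).trans_lt hu.1, hu.2.trans_lt (poissonLT_lt_one hs _)⟩
  have hA : MeasurableSet {x | stdGaussianCDF x ∈ Set.Ioc (poissonLT s n) (poissonLT s (n + 1))} :=
    continuous_stdGaussianCDF.measurable measurableSet_Ioc
  rw [intervalIntegral.integral_of_le (monotone_poissonLT hs.le n.le_succ),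
    integral_eq_lintegral_of_nonneg_ae (ae_of_all _ hnn) hd.aestronglyMeasurable,
    cellProb_eq_real hr z hs, setOf_poissonQuantile_eq hs.le, measureReal_def]
  congr 1
  rw [← withDensity_gaussianRatio hr, withDensity_apply _ hA, ← lintegral_indicator hA]
  have e1 : ∫⁻ u in Set.Ioc (poissonLT s n) (poissonLT s (n + 1)),
      ENNReal.ofReal (gaussianCopulaDensity (corrMatrix r) ![stdGaussianCDF z, u]) =
      ∫⁻ u in Set.Ioo (0 : ℝ) 1, (Set.Ioc (poissonLT s n) (poissonLT s (n + 1))).indicator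
        (fun u => ENNReal.ofReal
          (gaussianCopulaDensity (corrMatrix r) ![stdGaussianCDF z, u])) u := by
    rw [lintegral_indicator measurableSet_Ioc, Measure.restrict_restrict measurableSet_Ioc,
      Set.inter_eq_left.2 hsub]
  rw [e1, lintegral_Ioo_eq_gaussian (hd.ennreal_ofReal.indicator measurableSet_Ioc)]
  refine lintegral_congr fun x => ?_
  by_cases hx : stdGaussianCDF x ∈ Set.Ioc (poissonLT s n) (poissonLT s (n + 1))
  · rw [Set.indicator_of_mem hx, Set.indicator_of_mem (by exact hx),
      gaussianCopulaDensity_corrMatrix hr]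
    simp
  · rw [Set.indicator_of_notMem hx, Set.indicator_of_notMem (by exact hx)]

theorem condDensity_eq {r : ℝ} (hr : r ∈ Set.Ioo (-1 : ℝ) 1) {s : Fin 2 → ℝ} (hs : ∀ i, 0 < s i)
    (y : ℝ × ℕ) : condDensity r s y =
      gaussianPDFReal 0 (s 0).toNNReal y.1 * cellProb r (y.1 / √(s 0)) (s 1) y.2 := by
  rw [condDensity, cdf_gaussianReal_zero (hs 0), integral_gaussianCopulaDensity hr _ (hs 1)]

/-! ### Lower bounds for the cell probabilities -/

/-- Markov's inequality for `exp (x ^ 2 / 4)`, which is integrable under the standard Gaussian law.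
-/
theorem exists_gaussian_tail_le : ∃ c : ℝ, 1 ≤ c ∧
    ∀ a : ℝ, (gaussianReal 0 1).real {x | a < x ^ 2} ≤ c * Real.exp (-a / 4) := by
  have hfin : ∫⁻ x, ENNReal.ofReal (Real.exp (x ^ 2 / 4)) ∂gaussianReal 0 1 < ⊤ := by
    rw [gaussianReal_of_var_ne_zero _ one_ne_zero, lintegral_withDensity_eq_lintegral_mul _
      (measurable_gaussianPDF 0 1) (by fun_prop)]
    have hi := ((integrable_exp_neg_mul_sq (b := 1 / 4) (by norm_num)).const_mul
      (√(2 * Real.pi))⁻¹).lintegral_lt_top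
    refine lt_of_le_of_lt (lintegral_mono fun x => ?_) hi
    rw [Pi.mul_apply, gaussianPDF, ← ENNReal.ofReal_mul (gaussianPDFReal_nonneg 0 1 x)]
    refine ENNReal.ofReal_le_ofReal (le_of_eq ?_)
    rw [gaussianPDFReal, mul_assoc, ← Real.exp_add]
    simp only [NNReal.coe_one, mul_one, sub_zero]
    congr 2; ring
  set I := ∫⁻ x, ENNReal.ofReal (Real.exp (x ^ 2 / 4)) ∂gaussianReal 0 1
  refine ⟨max 1 I.toReal, le_max_left _ _, fun a => ?_⟩
  have h1 := mul_meas_ge_le_lintegral (μ := gaussianReal 0 1)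
    (f := fun x : ℝ => ENNReal.ofReal (Real.exp (x ^ 2 / 4))) (by fun_prop)
    (ENNReal.ofReal (Real.exp (a / 4)))
  have h2 : (gaussianReal 0 1) {x | a < x ^ 2} ≤ (gaussianReal 0 1)
      {x | ENNReal.ofReal (Real.exp (a / 4)) ≤ ENNReal.ofReal (Real.exp (x ^ 2 / 4))} := by
    refine measure_mono fun x (hx : a < x ^ 2) => ENNReal.ofReal_le_ofReal ?_
    exact Real.exp_le_exp.2 (by linarith)
  have h3 : Real.exp (a / 4) * (gaussianReal 0 1).real {x | a < x ^ 2} ≤ I.toReal := by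
    have h4 := ENNReal.toReal_mono hfin.ne ((mul_le_mul_right h2 _).trans h1)
    rwa [ENNReal.toReal_mul, ENNReal.toReal_ofReal (Real.exp_pos _).le] at h4
  rw [neg_div, Real.exp_neg, ← div_eq_mul_inv, le_div_iff₀ (Real.exp_pos _), mul_comm]
  exact h3.trans (le_max_right _ _)

/-- The normalizing factor is at least one and the quadratic form in the exponent is at most `2 * (z
^ 2 + x ^ 2)`. A single `κ` will serve for all correlations in a compact set. -/
theorem le_gaussianRatio {r κ : ℝ} (hr : r ∈ Set.Ioo (-1 : ℝ) 1) (hκ : (1 - r ^ 2)⁻¹ ≤ κ)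
    (z x : ℝ) : Real.exp (-(κ * (z ^ 2 + x ^ 2))) ≤ gaussianRatio r z x := by
  have h := one_sub_sq_pos hr
  have h1 : 1 ≤ (√(1 - r ^ 2))⁻¹ :=
    (one_le_inv₀ (Real.sqrt_pos.2 h)).2 (Real.sqrt_le_one.2 (by nlinarith))
  have hr2 : r ^ 2 ≤ 1 := by linarith
  have h2 : r ^ 2 * z ^ 2 - 2 * r * z * x + r ^ 2 * x ^ 2 ≤ 2 * (z ^ 2 + x ^ 2) := by
    nlinarith [sq_nonneg (r * z + x), mul_nonneg (sub_nonneg.2 hr2) (sq_nonneg z),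
      mul_nonneg (sub_nonneg.2 hr2) (sq_nonneg x), sq_nonneg x, sq_nonneg z]
  have h3 : (r ^ 2 * z ^ 2 - 2 * r * z * x + r ^ 2 * x ^ 2) / (2 * (1 - r ^ 2)) ≤
      κ * (z ^ 2 + x ^ 2) := by
    calc _ ≤ 2 * (z ^ 2 + x ^ 2) / (2 * (1 - r ^ 2)) :=
          div_le_div_of_nonneg_right h2 (by linarith)
      _ = (1 - r ^ 2)⁻¹ * (z ^ 2 + x ^ 2) := by field_simp
      _ ≤ _ := mul_le_mul_of_nonneg_right hκ (by positivity)
  calc _ ≤ 1 * Real.exp (-(r ^ 2 * z ^ 2 - 2 * r * z * x + r ^ 2 * x ^ 2) / (2 * (1 - r ^ 2))) := by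
        rw [one_mul, neg_div]
        exact Real.exp_le_exp.2 (neg_le_neg h3)
    _ ≤ _ := mul_le_mul_of_nonneg_right h1 (Real.exp_pos _).le

theorem gaussianReal_real_poissonQuantile {s : ℝ} (hs : 0 ≤ s) (n : ℕ) :
    (gaussianReal 0 1).real {x | poissonQuantile s (stdGaussianCDF x) = n} = poissonMass s n := by
  have hm : MeasurableSet {u | poissonQuantile s u = n} :=
    measurable_poissonQuantile_right s (measurableSet_singleton n)
  have h1 := lintegral_poissonQuantile hs (Set.indicator {n} 1)
  have h0 : Measurable (Set.indicator {n} 1 : ℕ → ENNReal) := measurable_from_top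
  have hi := h0.comp (measurable_poissonQuantile_right s)
  rw [lintegral_Ioo_eq_gaussian (f := fun u => Set.indicator {n} 1 (poissonQuantile s u)) hi,
    tsum_eq_single n (by intro k hk; simp [hk])] at h1
  have h2 : ∫⁻ x, Set.indicator {n} 1 (poissonQuantile s (stdGaussianCDF x)) ∂gaussianReal 0 1 =
      (gaussianReal 0 1) {x | poissonQuantile s (stdGaussianCDF x) = n} := by
    exact lintegral_indicator_one (continuous_stdGaussianCDF.measurable hm)
  rw [measureReal_def, ← h2, h1]
  simp [poissonMass_nonneg hs]

/-- The cell probabilities are bounded below in terms of the marginal ones. -/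
theorem exists_neg_log_cellProb_le : ∃ c : ℝ, 0 ≤ c ∧ ∀ {r κ : ℝ}, r ∈ Set.Ioo (-1 : ℝ) 1 →
    (1 - r ^ 2)⁻¹ ≤ κ → ∀ (z : ℝ) {s : ℝ}, 0 < s → ∀ n : ℕ, 0 < cellProb r z s n ∧
      cellProb r z s n ≤ 1 ∧
      -Real.log (cellProb r z s n) ≤ κ * z ^ 2 + (1 + 4 * κ) * (c - Real.log (poissonMass s n)) := by
  obtain ⟨c₀, hc₀, htail⟩ := exists_gaussian_tail_le
  refine ⟨Real.log (2 * c₀), Real.log_nonneg (by linarith), ?_⟩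
  intro r κ hr hκ z s hs n
  have hp := poissonMass_pos hs n
  set p := poissonMass s n with hpdef
  -- With this `a` the tail bound equals `p / 2`: at least half of the marginal mass of the cell
  -- lies in `x ^ 2 ≤ a`, where the density ratio is at least `exp (-(κ * (z ^ 2 + a)))`.
  set a : ℝ := 4 * Real.log (2 * c₀ / p) with ha
  set A : Set ℝ := {x | poissonQuantile s (stdGaussianCDF x) = n} with hA
  have hAm : MeasurableSet A := continuous_stdGaussianCDF.measurable
    (measurable_poissonQuantile_right s (measurableSet_singleton n))
  have hTm : MeasurableSet {x : ℝ | a < x ^ 2} :=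
    measurableSet_lt measurable_const (by fun_prop)
  have h1 : c₀ * Real.exp (-a / 4) = p / 2 := by
    rw [ha, show -(4 * Real.log (2 * c₀ / p)) / 4 = -Real.log (2 * c₀ / p) by ring, Real.exp_neg,
      Real.exp_log (by positivity)]
    field_simp
  have h2 : p / 2 ≤ (gaussianReal 0 1).real (A \ {x | a < x ^ 2}) := by
    have h3 := le_measureReal_sdiff (μ := gaussianReal 0 1) (s₁ := A) (s₂ := {x : ℝ | a < x ^ 2})
    have h4 := htail a
    rw [gaussianReal_real_poissonQuantile hs.le, ← hpdef] at h3
    linarith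
  have h3 : Real.exp (-(κ * (z ^ 2 + a))) * (gaussianReal 0 1).real (A \ {x | a < x ^ 2}) ≤
      (condGaussian r z).real A := by
    have hκ0 : 0 ≤ κ := (inv_nonneg.2 (one_sub_sq_pos hr).le).trans hκ
    have h4 : ENNReal.ofReal (Real.exp (-(κ * (z ^ 2 + a)))) *
        (gaussianReal 0 1) (A \ {x | a < x ^ 2}) ≤ condGaussian r z (A \ {x | a < x ^ 2}) := by
      rw [← withDensity_gaussianRatio hr, withDensity_apply _ (hAm.diff hTm), ← setLIntegral_const]
      refine setLIntegral_mono_ae (measurable_gaussianRatio_right r z).ennreal_ofReal.aemeasurable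
        (ae_of_all _ fun x hx => ENNReal.ofReal_le_ofReal ?_)
      refine le_trans (Real.exp_le_exp.2 ?_) (le_gaussianRatio hr hκ z x)
      have : x ^ 2 ≤ a := not_lt.1 hx.2
      nlinarith
    have h5 := ENNReal.toReal_mono (measure_ne_top _ _) (h4.trans (measure_mono Set.sdiff_subset))
    rwa [ENNReal.toReal_mul, ENNReal.toReal_ofReal (Real.exp_pos _).le] at h5
  have h6 : Real.exp (-(κ * (z ^ 2 + a))) * (p / 2) ≤ cellProb r z s n := by
    rw [cellProb_eq_real hr z hs]
    exact (mul_le_mul_of_nonneg_left h2 (Real.exp_pos _).le).trans h3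
  have h7 : 0 < Real.exp (-(κ * (z ^ 2 + a))) * (p / 2) := by positivity
  refine ⟨h7.trans_le h6, ?_, ?_⟩
  · rw [cellProb_eq_real hr z hs]
    exact measureReal_le_one
  · have h8 := Real.log_le_log h7 h6
    rw [Real.log_mul (Real.exp_pos _).ne' (by positivity), Real.log_exp,
      Real.log_div hp.ne' two_ne_zero] at h8
    have h9 : a = 4 * (Real.log (2 * c₀) - Real.log p) := by
      rw [ha, Real.log_div (by positivity) hp.ne']
    have h10 : Real.log 2 ≤ Real.log (2 * c₀) := Real.log_le_log (by norm_num) (by linarith)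
    rw [h9] at h8
    linarith

/-- Since `n! ≤ n ^ n`, the factorial costs `n log n`, which the moment of order `p` absorbs. -/
theorem neg_log_poissonMass_le {p d s : ℝ} (hp : 1 < p) (hd : 0 < d) (hs : d ≤ s) (n : ℕ) :
    -Real.log (poissonMass s n) ≤ s + n * |Real.log d| + (n : ℝ) ^ p / (p - 1) := by
  have hs0 := hd.trans_le hs
  have hf : (0 : ℝ) < n.factorial := by exact_mod_cast n.factorial_pos
  have h1 : Real.log n.factorial ≤ n * Real.log n := by
    rw [← Real.log_pow]
    refine Real.log_le_log hf ?_
    exact_mod_cast n.factorial_le_pow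
  have h2 := mul_log_le_rpow_div hp (Nat.cast_nonneg (α := ℝ) n)
  have h3 : -Real.log s ≤ |Real.log d| := by
    have := Real.log_le_log hd hs
    linarith [neg_abs_le (Real.log d)]
  have h4 := mul_le_mul_of_nonneg_left h3 (Nat.cast_nonneg (α := ℝ) n)
  rw [poissonMass, Real.log_div (by positivity) hf.ne', Real.log_mul (Real.exp_pos _).ne'
    (by positivity), Real.log_exp, Real.log_pow]
  linarith

/-! ### Continuity and measurability -/

theorem continuousOn_copulaCDF {α : Type*} [TopologicalSpace α] {S : Set α} {r z c : α → ℝ}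
    (hr : ContinuousOn r S) (hz : ContinuousOn z S) (hc : ContinuousOn c S)
    (hr1 : ∀ a ∈ S, r a ∈ Set.Ioo (-1 : ℝ) 1) (hc1 : ∀ a ∈ S, c a ∈ Set.Ioo (0 : ℝ) 1) :
    ContinuousOn (fun a => copulaCDF (r a) (z a) (c a)) S := by
  have h1 : ContinuousOn (fun a => stdGaussianCDF
      ((stdGaussianQuantile (c a) - r a * z a) / √(1 - r a ^ 2))) S := by
    refine continuous_stdGaussianCDF.comp_continuousOn (ContinuousOn.div ?_ ?_ ?_)
    · exact (continuousOn_stdGaussianQuantile.comp hc hc1).sub (hr.mul hz)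
    · exact (continuousOn_const.sub (hr.pow 2)).sqrt
    · exact fun a ha => (Real.sqrt_pos.2 (one_sub_sq_pos (hr1 a ha))).ne'
  exact h1.congr fun a ha => if_pos (hc1 a ha).1

theorem continuousOn_cellProb {α : Type*} [TopologicalSpace α] {S : Set α} {r z s : α → ℝ}
    (hr : ContinuousOn r S) (hz : ContinuousOn z S) (hs : ContinuousOn s S)
    (hr1 : ∀ a ∈ S, r a ∈ Set.Ioo (-1 : ℝ) 1) (hs1 : ∀ a ∈ S, 0 < s a) (n : ℕ) :
    ContinuousOn (fun a => cellProb (r a) (z a) (s a) n) S := by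
  have h1 : ∀ n : ℕ, ContinuousOn (fun a => copulaCDF (r a) (z a) (poissonLT (s a) (n + 1))) S :=
    fun n => continuousOn_copulaCDF hr hz ((continuous_poissonLT (n + 1)).comp_continuousOn hs) hr1
      fun a ha => ⟨poissonLT_succ_pos (hs1 a ha) n, poissonLT_lt_one (hs1 a ha) _⟩
  refine (h1 n).sub ?_
  -- The cell of the count zero has lower end constantly `0`, which `continuousOn_copulaCDF`
  -- excludes.
  cases n with
  | zero => simpa [poissonLT_zero, copulaCDF] using (continuousOn_const (c := (0 : ℝ)) (s := S))
  | succ n => exact h1 n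

theorem measurable_copulaCDF (r : ℝ) : Measurable fun p : ℝ × ℝ => copulaCDF r p.1 p.2 := by
  have hq : Measurable fun p : ℝ × ℝ => stdGaussianQuantile p.2 :=
    measurable_stdGaussianQuantile.comp measurable_snd
  have hz : Measurable fun p : ℝ × ℝ => r * p.1 := by fun_prop
  have h1 : Measurable fun p : ℝ × ℝ => (stdGaussianQuantile p.2 - r * p.1) / √(1 - r ^ 2) :=
    (hq.sub hz).div_const _
  have h2 := continuous_stdGaussianCDF.measurable.comp h1
  have h3 : MeasurableSet {p : ℝ × ℝ | 0 < p.2} := measurableSet_lt measurable_const measurable_snd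
  simp only [copulaCDF]
  exact Measurable.ite h3 h2 measurable_const

theorem measurable_cellProb (r : ℝ) {α : Type*} [MeasurableSpace α] {z s : α → ℝ} {n : α → ℕ}
    (hz : Measurable z) (hs : Measurable s) (hn : Measurable n) :
    Measurable fun a => cellProb r (z a) (s a) (n a) := by
  have h2 : ∀ k, Measurable fun a => copulaCDF r (z a) (poissonLT (s a) k) := fun k => by
    have h := (measurable_copulaCDF r).comp
      (hz.prodMk ((continuous_poissonLT k).measurable.comp hs))
    exact h
  have h1 : ∀ k, Measurable fun a => cellProb r (z a) (s a) k := fun k =>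
    (h2 (k + 1)).sub (h2 k)
  have h3 : Measurable fun q : α × ℕ => cellProb r (z q.1) (s q.1) q.2 :=
    measurable_from_prod_countable_left h1
  have h4 := h3.comp (measurable_id.prodMk hn)
  exact h4

end CellProbabilities

/-! ### The copula log-likelihood: envelope and identification of the correlation. -/

section SecondStep

/-- The conditional log-likelihood of one observation. -/
noncomputable def condLogDensity (r : ℝ) (s : Fin 2 → ℝ) (y : ℝ × ℕ) : ℝ :=
  -(1 / 2) * Real.log (2 * Real.pi * s 0) - y.1 ^ 2 / (2 * s 0) +
    Real.log (cellProb r (y.1 / √(s 0)) (s 1) y.2)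

theorem log_condDensity {r : ℝ} (hr : r ∈ Set.Ioo (-1 : ℝ) 1) {s : Fin 2 → ℝ} (hs : ∀ i, 0 < s i)
    (y : ℝ × ℕ) : Real.log (condDensity r s y) = condLogDensity r s y := by
  obtain ⟨c, -, hc⟩ := exists_neg_log_cellProb_le
  have hq := (hc hr le_rfl (y.1 / √(s 0)) (hs 1) y.2).1
  have h0 := hs 0
  have hpi := Real.pi_pos
  rw [condDensity_eq hr hs, gaussianPDFReal, condLogDensity, Real.coe_toNNReal _ h0.le,
    Real.log_mul (by positivity) hq.ne', Real.log_mul (by positivity) (Real.exp_pos _).ne',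
    Real.log_exp, Real.log_inv, Real.log_sqrt (by positivity)]
  ring

/-- An envelope for the conditional log-likelihood. -/
noncomputable def logDensityBound (c κ p d E : ℝ) (y : ℝ × ℕ) : ℝ :=
  |Real.log (2 * Real.pi)| + |Real.log d| + E + (1 + κ) * (obsBar y 0 / d) +
    (1 + 4 * κ) * (c + (E + obsBar y 1 * |Real.log d| + obsBar y 1 ^ p / (p - 1)))

/-- Cell probabilities are at most one, so only their lower bound matters. The squared score is `y.1
^ 2 / s 0 ≤ obsBar y 0 / d`, which leaves a bound linear in integrable quantities. -/
theorem exists_abs_condLogDensity_le : ∃ c : ℝ, ∀ {r κ p d E : ℝ}, r ∈ Set.Ioo (-1 : ℝ) 1 →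
    (1 - r ^ 2)⁻¹ ≤ κ → 1 < p → 0 < d → ∀ {s : Fin 2 → ℝ}, (∀ i, d ≤ s i ∧ s i ≤ E) →
      ∀ y, |condLogDensity r s y| ≤ logDensityBound c κ p d E y := by
  obtain ⟨c, hc0, hc⟩ := exists_neg_log_cellProb_le
  refine ⟨c, ?_⟩
  intro r κ p d E hr hκ hp hd s hs y
  have h0 := hd.trans_le (hs 0).1
  have h1 := hd.trans_le (hs 1).1
  have hκ0 : 0 ≤ κ := (inv_nonneg.2 (one_sub_sq_pos hr).le).trans hκ
  obtain ⟨q0, q1, q2⟩ := hc hr hκ (y.1 / √(s 0)) h1 y.2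
  have hy0 : y.1 ^ 2 / s 0 ≤ obsBar y 0 / d :=
    div_le_div_of_nonneg_left (sq_nonneg _) hd (hs 0).1
  have hy0' : 0 ≤ y.1 ^ 2 / s 0 := by positivity
  have hz : (y.1 / √(s 0)) ^ 2 = y.1 ^ 2 / s 0 := by rw [div_pow, Real.sq_sqrt h0.le]
  have hm : -Real.log (poissonMass (s 1) y.2) ≤
      E + obsBar y 1 * |Real.log d| + obsBar y 1 ^ p / (p - 1) := by
    have e : obsBar y 1 = y.2 := rfl
    rw [e]
    linarith [neg_log_poissonMass_le hp hd (hs 1).1 y.2, (hs 1).2]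
  have hl : |Real.log (2 * Real.pi * s 0)| ≤ |Real.log (2 * Real.pi)| + |Real.log d| + E := by
    rw [Real.log_mul (by positivity) h0.ne']
    have := abs_add_le (Real.log (2 * Real.pi)) (Real.log (s 0))
    have := abs_log_le_of_le hd (hs 0).1
    linarith [(hs 0).2]
  have hq : |Real.log (cellProb r (y.1 / √(s 0)) (s 1) y.2)| ≤ κ * (obsBar y 0 / d) +
      (1 + 4 * κ) * (c + (E + obsBar y 1 * |Real.log d| + obsBar y 1 ^ p / (p - 1))) := by
    rw [abs_of_nonpos (Real.log_nonpos q0.le q1)]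
    rw [hz] at q2
    have k1 := mul_le_mul_of_nonneg_left hy0 hκ0
    have k2 := mul_le_mul_of_nonneg_left hm (by linarith : 0 ≤ 1 + 4 * κ)
    linarith
  rw [condLogDensity, logDensityBound]
  have e1 : y.1 ^ 2 / (2 * s 0) = y.1 ^ 2 / s 0 / 2 := by rw [div_div, mul_comm]
  rw [e1]
  have h3 := abs_nonneg (Real.log (2 * Real.pi * s 0))
  rw [abs_le] at hl hq ⊢
  constructor <;> linarith [hl.1, hl.2, hq.1, hq.2]

theorem continuousOn_condLogDensity (y : ℝ × ℕ) :
    ContinuousOn (fun a : (Fin 2 → ℝ) × ℝ => condLogDensity a.2 a.1 y)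
      {a | (∀ i, 0 < a.1 i) ∧ a.2 ∈ Set.Ioo (-1 : ℝ) 1} := by
  set S : Set ((Fin 2 → ℝ) × ℝ) := {a | (∀ i, 0 < a.1 i) ∧ a.2 ∈ Set.Ioo (-1 : ℝ) 1}
  have c (i : Fin 2) : ContinuousOn (fun a : (Fin 2 → ℝ) × ℝ => a.1 i) S :=
    ((continuous_apply i).comp continuous_fst).continuousOn
  obtain ⟨_, -, hc⟩ := exists_neg_log_cellProb_le
  have hq := continuousOn_cellProb (S := S) (r := fun a => a.2) (z := fun a => y.1 / √(a.1 0))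
    (s := fun a => a.1 1) continuous_snd.continuousOn
    (continuousOn_const.div (c 0).sqrt fun a ha => (Real.sqrt_pos.2 (ha.1 0)).ne') (c 1)
    (fun a ha => ha.2) (fun a ha => ha.1 1) y.2
  have hl := hq.log fun a ha => (hc ha.2 le_rfl _ (ha.1 1) y.2).1.ne'
  refine ((continuousOn_const.mul ((continuousOn_const.mul (c 0)).log fun a ha => ?_)).sub
    (continuousOn_const.div (continuousOn_const.mul (c 0)) fun a ha => ?_)).add hl
  · exact (mul_pos (mul_pos two_pos Real.pi_pos) (ha.1 0)).ne'
  · exact (mul_pos two_pos (ha.1 0)).ne'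

theorem measurable_condLogDensity (r : ℝ) {α : Type*} [MeasurableSpace α] {s : α → Fin 2 → ℝ}
    {y : α → ℝ × ℕ} (hs : Measurable s) (hy : Measurable y) :
    Measurable fun a => condLogDensity r (s a) (y a) := by
  have h (i : Fin 2) : Measurable fun a => s a i := (measurable_pi_apply i).comp hs
  have hz : Measurable fun a => (y a).1 / √(s a 0) := hy.fst.div (h 0).sqrt
  have hq := (measurable_cellProb r hz (h 1) hy.snd).log
  have h1 : Measurable fun a => -(1 / 2) * Real.log (2 * Real.pi * s a 0) :=
    ((h 0).const_mul _).log.const_mul _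
  have h2 : Measurable fun a => (y a).1 ^ 2 / (2 * s a 0) :=
    (hy.fst.pow_const 2).div ((h 0).const_mul _)
  exact (h1.sub h2).add hq

/-! ### Identification of the copula parameter -/

theorem lintegral_poissonQuantile_condGaussian {r : ℝ} (hr : r ∈ Set.Ioo (-1 : ℝ) 1) (z : ℝ)
    {s : ℝ} (hs : 0 < s) (f : ℕ → ENNReal) :
    ∫⁻ x, f (poissonQuantile s (stdGaussianCDF x)) ∂condGaussian r z =
      ∑' n, f n * ENNReal.ofReal (cellProb r z s n) := by
  have hm : Measurable fun x => poissonQuantile s (stdGaussianCDF x) :=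
    (measurable_poissonQuantile_right s).comp continuous_stdGaussianCDF.measurable
  rw [← lintegral_map (f := f) measurable_from_top hm, lintegral_countable']
  refine tsum_congr fun n => ?_
  rw [Measure.map_apply hm (measurableSet_singleton n), cellProb_eq_real hr z hs, measureReal_def,
    ENNReal.ofReal_toReal (measure_ne_top _ _)]
  rfl

theorem tsum_cellProb {r : ℝ} (hr : r ∈ Set.Ioo (-1 : ℝ) 1) (z : ℝ) {s : ℝ} (hs : 0 < s) :
    ∑' n, ENNReal.ofReal (cellProb r z s n) = 1 := by
  have h := lintegral_poissonQuantile_condGaussian hr z hs fun _ => 1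
  simpa using h.symm

theorem cellProb_zero (r z : ℝ) {s : ℝ} (hs : 0 < s) : cellProb r z s 0 =
    stdGaussianCDF ((stdGaussianQuantile (poissonLT s 1) - r * z) / √(1 - r ^ 2)) := by
  rw [cellProb, poissonLT_zero, copulaCDF, copulaCDF, if_neg (lt_irrefl _), sub_zero,
    if_pos (poissonLT_succ_pos hs 0)]

/-- The count zero suffices: its conditional probability is `stdGaussianCDF` of an affine function
of `z` with slope `-r / √(1 - r ^ 2)`, and this slope determines `r`. -/
theorem eq_of_ae_cellProb_zero_eq {r r' : ℝ} (hr : r ∈ Set.Ioo (-1 : ℝ) 1)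
    (hr' : r' ∈ Set.Ioo (-1 : ℝ) 1) {s : ℝ} (hs : 0 < s)
    (h : ∀ᵐ z ∂gaussianReal 0 1, cellProb r z s 0 = cellProb r' z s 0) : r = r' := by
  set α := stdGaussianQuantile (poissonLT s 1)
  have ha := Real.sqrt_pos.2 (one_sub_sq_pos hr)
  have ha' := Real.sqrt_pos.2 (one_sub_sq_pos hr')
  have h1 : (fun z => (α - r * z) / √(1 - r ^ 2)) =ᵐ[volume]
      fun z => (α - r' * z) / √(1 - r' ^ 2) := by
    refine (gaussianReal_absolutelyContinuous' 0 one_ne_zero).ae_le ?_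
    filter_upwards [h] with z hz
    rw [cellProb_zero r z hs, cellProb_zero r' z hs] at hz
    exact strictMono_stdGaussianCDF.injective hz
  have h2 := (Continuous.ae_eq_iff_eq volume (by fun_prop) (by fun_prop)).1 h1
  have e0 := congrFun h2 0
  have e1 := congrFun h2 1
  simp only [mul_zero, sub_zero, mul_one, sub_div] at e0 e1
  have e2 : r / √(1 - r ^ 2) = r' / √(1 - r' ^ 2) := by linarith
  rw [div_eq_div_iff ha.ne' ha'.ne'] at e2
  have e3 : r ^ 2 = r' ^ 2 := by
    have := congrArg (· ^ 2) e2
    simp only [mul_pow, Real.sq_sqrt (one_sub_sq_pos hr).le,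
      Real.sq_sqrt (one_sub_sq_pos hr').le] at this
    linarith
  rw [e3] at e2
  exact mul_right_cancel₀ ha'.ne' e2

/-- The likelihood ratio of the second component given the first one. -/
noncomputable def cellRatio (r r' : ℝ) (s u : Fin 2 → ℝ) : ℝ :=
  cellProb r (stdGaussianQuantile (u 0)) (s 1) (poissonQuantile (s 1) (u 1)) /
    cellProb r' (stdGaussianQuantile (u 0)) (s 1) (poissonQuantile (s 1) (u 1))

theorem measurable_cellRatio (r r' : ℝ) :
    Measurable fun p : (Fin 2 → ℝ) × (Fin 2 → ℝ) => cellRatio r r' p.1 p.2 := by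
  have hz : Measurable fun p : (Fin 2 → ℝ) × (Fin 2 → ℝ) => stdGaussianQuantile (p.2 0) :=
    measurable_stdGaussianQuantile.comp ((measurable_pi_apply 0).comp measurable_snd)
  have hs : Measurable fun p : (Fin 2 → ℝ) × (Fin 2 → ℝ) => p.1 1 :=
    (measurable_pi_apply 1).comp measurable_fst
  have hu : Measurable fun p : (Fin 2 → ℝ) × (Fin 2 → ℝ) => p.2 1 :=
    (measurable_pi_apply 1).comp measurable_snd
  have hn := measurable_poissonQuantile.comp (hs.prodMk hu)
  have h1 := measurable_cellProb r hz hs hn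
  have h2 := measurable_cellProb r' hz hs hn
  exact h1.div h2

theorem cellProb_pos {r : ℝ} (hr : r ∈ Set.Ioo (-1 : ℝ) 1) (z : ℝ) {s : ℝ} (hs : 0 < s) (n : ℕ) :
    0 < cellProb r z s n := by
  obtain ⟨_, -, hc⟩ := exists_neg_log_cellProb_le
  exact (hc hr le_rfl z hs n).1

/-- Given the score, the ratio depends on the second noise coordinate only through the count, so the
inner integral is a sum over counts. -/
theorem lintegral_comp_cellRatio {r r' : ℝ} (hr' : r' ∈ Set.Ioo (-1 : ℝ) 1) {s : Fin 2 → ℝ}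
    (hs : 0 < s 1) {f : ℝ → ENNReal} (hf : Measurable f) :
    ∫⁻ u, f (cellRatio r r' s u) ∂gaussianCopula (corrMatrix r') =
      ∫⁻ z, ∑' n, f (cellProb r z (s 1) n / cellProb r' z (s 1) n) *
        ENNReal.ofReal (cellProb r' z (s 1) n) ∂gaussianReal 0 1 := by
  have h1 := (measurable_cellRatio r r').comp (measurable_prodMk_left (x := s))
  rw [lintegral_gaussianCopula hr' (f := fun u => f (cellRatio r r' s u)) (hf.comp h1)]
  refine lintegral_congr fun z => ?_
  rw [← lintegral_poissonQuantile_condGaussian hr' z hs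
    fun n => f (cellProb r z (s 1) n / cellProb r' z (s 1) n)]
  refine lintegral_congr fun x => ?_
  simp [cellRatio]

/-- The denominators cancel against the weights of the true law and leave the total mass of the
conditional law with correlation `r`. -/
theorem lintegral_cellRatio {r r' : ℝ} (hr : r ∈ Set.Ioo (-1 : ℝ) 1)
    (hr' : r' ∈ Set.Ioo (-1 : ℝ) 1) {s : Fin 2 → ℝ} (hs : 0 < s 1) :
    ∫⁻ u, ENNReal.ofReal (cellRatio r r' s u) ∂gaussianCopula (corrMatrix r') = 1 := by
  rw [lintegral_comp_cellRatio hr' hs ENNReal.measurable_ofReal]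
  have h : ∀ z n, ENNReal.ofReal (cellProb r z (s 1) n / cellProb r' z (s 1) n) *
      ENNReal.ofReal (cellProb r' z (s 1) n) = ENNReal.ofReal (cellProb r z (s 1) n) := by
    intro z n
    have h' := cellProb_pos hr' z hs n
    rw [← ENNReal.ofReal_mul (div_nonneg (cellProb_pos hr z hs n).le h'.le),
      div_mul_cancel₀ _ h'.ne']
  simp only [h, tsum_cellProb hr _ hs]
  simp

theorem eq_of_ae_cellRatio_eq_one {r r' : ℝ} (hr : r ∈ Set.Ioo (-1 : ℝ) 1)
    (hr' : r' ∈ Set.Ioo (-1 : ℝ) 1) {s : Fin 2 → ℝ} (hs : 0 < s 1)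
    (h : ∫⁻ u, ENNReal.ofReal |cellRatio r r' s u - 1| ∂gaussianCopula (corrMatrix r') = 0) :
    r = r' := by
  have hf : Measurable fun x : ℝ => ENNReal.ofReal |x - 1| := by fun_prop
  rw [lintegral_comp_cellRatio hr' hs (f := fun x => ENNReal.ofReal |x - 1|) hf] at h
  refine eq_of_ae_cellProb_zero_eq hr hr' hs ?_
  have hz : Measurable fun z : ℝ => z := measurable_id
  have hm : ∀ n, Measurable fun z => ENNReal.ofReal
      |cellProb r z (s 1) n / cellProb r' z (s 1) n - 1| *
        ENNReal.ofReal (cellProb r' z (s 1) n) := by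
    intro n
    have h1 := measurable_cellProb r hz (measurable_const (a := s 1)) (measurable_const (a := n))
    have h2 := measurable_cellProb r' hz (measurable_const (a := s 1)) (measurable_const (a := n))
    exact (((h1.div h2).sub_const 1).abs.ennreal_ofReal).mul h2.ennreal_ofReal
  filter_upwards [(lintegral_eq_zero_iff (Measurable.tsum hm)).1 h] with z hz
  have h0 := ENNReal.tsum_eq_zero.1 hz 0
  have hpos := cellProb_pos hr' z hs 0
  rcases mul_eq_zero.1 h0 with h0 | h0
  · have h1 := abs_nonpos_iff.1 (ENNReal.ofReal_eq_zero.1 h0)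
    rw [sub_eq_zero, div_eq_one_iff_eq hpos.ne'] at h1
    exact h1
  · exact absurd (ENNReal.ofReal_eq_zero.1 h0) hpos.not_ge

end SecondStep

/-! ### Uniform convergence of the second-step likelihood and consistency. -/

section SecondStepLimit

variable {Ω : Type*} [MeasurableSpace Ω] {P : Measure Ω} [IsProbabilityMeasure P] {m : ℕ}
    {U : ℤ → Ω → Fin 2 → ℝ} {X : ℤ → Ω → Fin m → ℝ} {Y : ℤ → Ω → ℝ × ℕ} {lam : ℤ → Ω → Fin 2 → ℝ}
    {Θ : Set (Param m)} {θ₀ : Param m} {r₀ dmin δ : ℝ} {K : Set ℝ}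

namespace ModelSetting

/-- Uniformity is joint in `(θ, r)`, which allows a random first-step estimator to be plugged in. -/
theorem tendstoUniformly_copulaLogLik (h : ModelSetting P U X Y lam Θ θ₀ r₀ dmin δ)
    (hK : IsCompact K) (hK1 : K ⊆ Set.Ioo (-1) 1) :
    (∀ p : Θ × K, Integrable (fun w => condLogDensity p.2 (pathLatent θ₀ p.1 w) (obsPath θ₀ w 0))
      (pathLaw P U X)) ∧
    (Continuous fun p : Θ × K =>
      ∫ w, condLogDensity p.2 (pathLatent θ₀ p.1 w) (obsPath θ₀ w 0) ∂pathLaw P U X) ∧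
    ∀ᵐ w ∂pathLaw P U X, TendstoUniformly
      (fun (n : ℕ) (p : Θ × K) => copulaLogLik n (obsPath θ₀ w) (covPath w) p.1 p.2)
      (fun p => ∫ w, condLogDensity p.2 (pathLatent θ₀ p.1 w) (obsPath θ₀ w 0) ∂pathLaw P U X)
      atTop := by
  have := h.isProbabilityMeasure_pathLaw
  have : CompactSpace Θ := isCompact_iff_compactSpace.1 h.compact
  have : CompactSpace K := isCompact_iff_compactSpace.1 hK
  obtain ⟨E, hE, hEb⟩ := h.exists_pathLatent_bound
  obtain ⟨p, hp, hY⟩ := h.exists_memLp_obsPath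
  obtain ⟨c, hc⟩ := exists_abs_condLogDensity_le
  have hcont : ContinuousOn (fun r : ℝ => (1 - r ^ 2)⁻¹) K :=
    ContinuousOn.inv₀ (by fun_prop) fun r hr => (one_sub_sq_pos (hK1 hr)).ne'
  obtain ⟨κ, hκ⟩ := hK.exists_bound_of_continuousOn hcont
  have hκ' : ∀ r ∈ K, (1 - r ^ 2)⁻¹ ≤ κ := fun r hr => (le_abs_self _).trans (hκ r hr)
  have hH : Integrable (fun w => logDensityBound c κ p dmin (E w) (obsPath θ₀ w 0))
      (pathLaw P U X) := by
    unfold logDensityBound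
    exact (((integrable_const _).add hE).add (((hY 0).1.div_const dmin).const_mul _)).add
      (((integrable_const c).add ((hE.add ((hY 1).1.mul_const _)).add
        ((hY 1).2.div_const _))).const_mul _)
  obtain ⟨h1, h2, h3⟩ := ae_tendsto_uniform_average h.ergodic_shift
    (g := fun (p : Θ × K) w => condLogDensity p.2 (pathLatent θ₀ p.1 w) (obsPath θ₀ w 0))
    (fun p => measurable_condLogDensity p.2.1 (measurable_pathLatent θ₀ p.1.1)
      (measurable_obsPath θ₀ 0)) hH (by
      filter_upwards [hEb] with w hw
      refine ⟨?_, fun q => hc (hK1 q.2.2) (hκ' _ q.2.2) hp h.dmin_pos (hw.2 q.1.1 q.1.2) _⟩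
      have hcn : Continuous fun q : Θ × K => (pathLatent θ₀ q.1.1 w, q.2.1) :=
        ((continuous_pi hw.1).comp continuous_fst).prodMk
          (continuous_subtype_val.comp continuous_snd)
      exact (continuousOn_condLogDensity (obsPath θ₀ w 0)).comp_continuous hcn
        fun q => ⟨fun i => h.dmin_pos.trans_le (hw.2 q.1.1 q.1.2 i).1, hK1 q.2.2⟩)
  refine ⟨h2, h1, ?_⟩
  have hEb' : ∀ᵐ w ∂pathLaw P U X, ∀ n : ℕ, ∀ θ ∈ Θ, ∀ i, 0 < pathLatent θ₀ θ (shift^[n] w) i := by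
    refine ae_all_iff.2 fun n => ?_
    have h4 := (h.ergodic_shift.toMeasurePreserving.iterate n).quasiMeasurePreserving.ae hEb
    filter_upwards [h4] with w hw θ hθ i
    exact h.dmin_pos.trans_le (hw.2 θ hθ i).1
  filter_upwards [h3, hEb'] with w hw hpos
  refine (congrArg (fun F => TendstoUniformly F _ atTop) ?_).mp hw
  funext n q
  rw [copulaLogLik]
  congr 1
  refine Finset.sum_congr rfl fun t _ => ?_
  rw [← log_condDensity (hK1 q.2.2) (hpos t q.1.1 q.1.2), pathLatent_shift, obsPath_shift, zero_add]

/-- The copula parameter is identified by the mean conditional log-likelihood. -/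
theorem eq_of_integral_condLogDensity_le (h : ModelSetting P U X Y lam Θ θ₀ r₀ dmin δ)
    (hK : IsCompact K) (hK1 : K ⊆ Set.Ioo (-1) 1) (hr₀ : r₀ ∈ K) {r : ℝ} (hr : r ∈ K)
    (hle : ∫ w, condLogDensity r₀ (pathLatent θ₀ θ₀ w) (obsPath θ₀ w 0) ∂pathLaw P U X ≤
      ∫ w, condLogDensity r (pathLatent θ₀ θ₀ w) (obsPath θ₀ w 0) ∂pathLaw P U X) : r = r₀ := by
  have hD := h.measurable_drivingPath.aemeasurable (μ := P)
  have hint := (h.tendstoUniformly_copulaLogLik hK hK1).1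
  obtain ⟨E, -, hEb⟩ := h.exists_pathLatent_bound
  set s : Ω → Fin 2 → ℝ := fun ω => pathLatent θ₀ θ₀ (drivingPath U X ω) with hsdef
  have hs : Measurable[past U X (0 - 1)] s := measurable_pathLatent_drivingPath θ₀ θ₀
  have hpos : ∀ᵐ ω ∂P, ∀ i, 0 < s ω i := by
    filter_upwards [ae_of_ae_map hD hEb] with ω hω i
    exact h.dmin_pos.trans_le (hω.2 θ₀ h.mem i).1
  -- The likelihood ratio at the true latent values; the Gaussian marginal density does not depend
  -- on the correlation and cancels.
  set R : Ω → ℝ := fun ω => cellRatio r r₀ (s ω) (U 0 ω) with hR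
  have hRm : Measurable R := by
    have h1 := (measurable_cellRatio r r₀).comp
      ((hs.mono (h.past_le _) le_rfl).prodMk (h.noise.measurable_noise 0))
    exact h1
  have hRpos : ∀ᵐ ω ∂P, 0 < R ω := by
    filter_upwards [hpos] with ω hω
    exact div_pos (cellProb_pos (hK1 hr) _ (hω 1) _) (cellProb_pos (hK1 hr₀) _ (hω 1) _)
  have hmeas (r : ℝ) : Measurable fun w : ℤ → (Fin 2 → ℝ) × (Fin m → ℝ) =>
      condLogDensity r (pathLatent θ₀ θ₀ w) (obsPath θ₀ w 0) :=
    measurable_condLogDensity r (measurable_pathLatent θ₀ θ₀) (measurable_obsPath θ₀ 0)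
  have hint' (r : ℝ) (hr : r ∈ K) := (integrable_map_measure (hmeas r).aestronglyMeasurable hD).1
    (hint (⟨θ₀, h.mem⟩, ⟨r, hr⟩))
  have hlog : (fun ω => Real.log (R ω)) =ᵐ[P] fun ω =>
      condLogDensity r (s ω) (obsPath θ₀ (drivingPath U X ω) 0) -
        condLogDensity r₀ (s ω) (obsPath θ₀ (drivingPath U X ω) 0) := by
    filter_upwards [hpos, h.ae_obsPath_zero] with ω h1 h2
    rw [h2]
    have e : (genObs (s ω) (U 0 ω)).1 / √(s ω 0) = stdGaussianQuantile (U 0 ω 0) :=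
      mul_div_cancel_left₀ _ (Real.sqrt_pos.2 (h1 0)).ne'
    rw [condLogDensity, condLogDensity, e, hR]
    simp only [cellRatio]
    rw [Real.log_div (cellProb_pos (hK1 hr) _ (h1 1) _).ne'
      (cellProb_pos (hK1 hr₀) _ (h1 1) _).ne']
    simp only [genObs]
    ring
  have hlogi : Integrable (fun ω => Real.log (R ω)) P :=
    ((hint' r hr).sub (hint' r₀ hr₀)).congr hlog.symm
  have hlog0 : 0 ≤ ∫ ω, Real.log (R ω) ∂P := by
    rw [integral_congr_ae hlog]
    have h1 := integral_sub (hint' r hr) (hint' r₀ hr₀)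
    rw [pathLaw, integral_map hD (hmeas r).aestronglyMeasurable,
      integral_map hD (hmeas r₀).aestronglyMeasurable] at hle
    exact (sub_nonneg.2 hle).trans h1.ge
  have hR1 : ∫⁻ ω, ENNReal.ofReal (R ω) ∂P = 1 := by
    rw [h.lintegral_indep 0 hs (f := fun s u => ENNReal.ofReal (cellRatio r r₀ s u))
      (measurable_cellRatio r r₀).ennreal_ofReal]
    rw [lintegral_congr_ae (g := fun _ => 1), lintegral_const, measure_univ, one_mul]
    filter_upwards [hpos] with ω hω
    exact lintegral_cellRatio (hK1 hr) (hK1 hr₀) (hω 1)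
  have hRi : Integrable R P := by
    refine ⟨hRm.aestronglyMeasurable, ?_⟩
    rw [hasFiniteIntegral_iff_ofReal (hRpos.mono fun _ h => h.le), hR1]
    exact ENNReal.one_lt_top
  have hRint : ∫ ω, R ω ∂P = 1 := by
    rw [integral_eq_lintegral_of_nonneg_ae (hRpos.mono fun _ h => h.le) hRm.aestronglyMeasurable,
      hR1, ENNReal.toReal_one]
  -- Gibbs' inequality: `R` has mean one and its logarithm a nonnegative mean, so this nonnegative
  -- variable has integral zero and `R = 1` almost surely.
  have hnn : 0 ≤ᵐ[P] fun ω => R ω - 1 - Real.log (R ω) := by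
    filter_upwards [hRpos] with ω hω
    exact sub_nonneg.2 (Real.log_le_sub_one_of_pos hω)
  have hi1 : Integrable (fun ω => R ω - 1) P := hRi.sub (integrable_const _)
  have hzero := (integral_eq_zero_iff_of_nonneg_ae hnn (hi1.sub hlogi)).1
    (le_antisymm (by
      rw [integral_sub hi1 hlogi, integral_sub hRi (integrable_const _), hRint]
      simpa using hlog0) (integral_nonneg_of_ae hnn))
  have hone : ∫⁻ ω, ENNReal.ofReal |R ω - 1| ∂P = 0 := by
    rw [lintegral_congr_ae (g := fun _ => 0), lintegral_zero]
    filter_upwards [hzero, hRpos] with ω h1 h2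
    have : R ω = 1 := by
      by_contra hne
      have h3 := Real.log_lt_sub_one_of_pos h2 hne
      simp only [Pi.zero_apply] at h1
      linarith
    simp [this]
  have hfm : Measurable fun p : (Fin 2 → ℝ) × (Fin 2 → ℝ) =>
      ENNReal.ofReal |cellRatio r r₀ p.1 p.2 - 1| :=
    ((measurable_cellRatio r r₀).sub_const 1).abs.ennreal_ofReal
  have hsm := hs.mono (h.past_le _) le_rfl
  have := isProbabilityMeasure_gaussianCopula h.corr_mem
  rw [h.lintegral_indep 0 hs (f := fun s u => ENNReal.ofReal |cellRatio r r₀ s u - 1|) hfm] at hone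
  have hinner : Measurable fun ω => ∫⁻ u, ENNReal.ofReal |cellRatio r r₀ (s ω) u - 1|
      ∂gaussianCopula (corrMatrix r₀) := by
    have h1 := hfm.lintegral_prod_right' (ν := gaussianCopula (corrMatrix r₀))
    exact h1.comp hsm
  rw [lintegral_eq_zero_iff hinner] at hone
  -- A single realization with positive intensity identifies the correlation.
  obtain ⟨ω, h1, h2⟩ := (hone.and hpos).exists
  exact eq_of_ae_cellRatio_eq_one (hK1 hr) (hK1 hr₀) (h2 1) h1

/-- Strong consistency of the two-step estimator, path by path. -/
theorem ae_tendsto_rhat (h : ModelSetting P U X Y lam Θ θ₀ r₀ dmin δ)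
    (hK : IsCompact K) (hK1 : K ⊆ Set.Ioo (-1) 1) (hr₀ : r₀ ∈ K) {l₀ : Fin 2 → ℝ}
    (hl₀ : ∀ i, 0 ≤ l₀ i) :
    ∀ᵐ w ∂pathLaw P U X, ∀ (θhat : ℕ → Param m) (rhat : ℕ → ℝ),
      ((∀ n, 1 ≤ n → IsPseudoMLE Θ n (obsPath θ₀ w)
          (fun θ => initLatent l₀ θ (obsPath θ₀ w) (covPath w)) (θhat n)) ∨
        ∀ n, 1 ≤ n → IsPseudoMLE Θ n (obsPath θ₀ w)
          (fun θ t => latent θ (obsPath θ₀ w) (covPath w) t) (θhat n)) →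
      (∀ n, 1 ≤ n → IsCopulaMLE K n (obsPath θ₀ w) (covPath w) (θhat n) (rhat n)) →
      Tendsto rhat atTop (𝓝 r₀) := by
  obtain ⟨-, hc1, hu1⟩ := h.tendstoUniformly_latent_criterion
  obtain ⟨-, hc2, hu2⟩ := h.tendstoUniformly_copulaLogLik hK hK1
  filter_upwards [hu1, hu2, h.tendstoUniformly_criterion_sub hl₀] with w hw1 hw2 hw3
  intro θhat rhat hθ hr
  set y := obsPath θ₀ w
  set x := covPath w
  -- Both versions of the first-step criterion have the same uniform limit; of the minimization only
  -- the comparison with `θ₀` is kept.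
  obtain ⟨Q, hQ, hQmin⟩ : ∃ Q : ℕ → Θ → ℝ, TendstoUniformly Q
      (fun θ => ∫ w, contrast (obsPath θ₀ w 0) (pathLatent θ₀ θ w) ∂pathLaw P U X) atTop ∧
      ∀ n, 1 ≤ n → ∃ hn : θhat n ∈ Θ, Q n ⟨θhat n, hn⟩ ≤ Q n ⟨θ₀, h.mem⟩ := by
    rcases hθ with hθ | hθ
    · refine ⟨fun n (θ : Θ) => pseudoCriterion n y (initLatent l₀ θ y x), ?_,
        fun n hn => ⟨(hθ n hn).1, isMinOn_iff.1 (hθ n hn).2 θ₀ h.mem⟩⟩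
      have h1 := hw3.add hw1
      refine (congrArg₂ (fun F f => TendstoUniformly F f atTop) ?_ ?_).mp h1
      · funext n θ
        simp only [Pi.add_apply]
        ring
      · funext θ
        simp
    · exact ⟨_, hw1, fun n hn => ⟨(hθ n hn).1, isMinOn_iff.1 (hθ n hn).2 θ₀ h.mem⟩⟩
  -- Along an ultrafilter, compactness supplies limits of both estimators at once, in place of
  -- subsequences.
  refine (tendsto_iff_ultrafilter _ _ _).2 fun g hg => ?_
  have hge : ∀ᶠ n in (g : Filter ℕ), 1 ≤ n := hg (eventually_ge_atTop 1)
  have : CompactSpace Θ := isCompact_iff_compactSpace.1 h.compact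
  have : CompactSpace K := isCompact_iff_compactSpace.1 hK
  classical
  -- The default values can only matter at `n = 0`, which the ultrafilter ignores.
  let T : ℕ → Θ := fun n => if hn : θhat n ∈ Θ then ⟨θhat n, hn⟩ else ⟨θ₀, h.mem⟩
  let S : ℕ → K := fun n => if hn : rhat n ∈ K then ⟨rhat n, hn⟩ else ⟨r₀, hr₀⟩
  have hT : ∀ n, 1 ≤ n → (T n : Param m) = θhat n := fun n hn => by
    obtain ⟨h1, -⟩ := hQmin n hn
    simp only [T, dif_pos h1]
  have hS : ∀ n, 1 ≤ n → (S n : ℝ) = rhat n := fun n hn => by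
    simp only [S, dif_pos (hr n hn).1]
  obtain ⟨θ', hθ'⟩ : ∃ θ', Tendsto T g (𝓝 θ') :=
    ⟨_, (g.map T).le_nhds_lim⟩
  obtain ⟨r', hr'⟩ : ∃ r', Tendsto S g (𝓝 r') := ⟨_, (g.map S).le_nhds_lim⟩
  have hQg : ∀ {F : ℕ → Θ}, ∀ {θ : Θ}, Tendsto F g (𝓝 θ) → Tendsto (fun n => Q n (F n)) g
      (𝓝 (∫ w, contrast (obsPath θ₀ w 0) (pathLatent θ₀ θ w) ∂pathLaw P U X)) := fun hF =>
    TendstoUniformly.tendsto_comp (fun u hu => hg (hQ u hu)) hc1.continuousAt hF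
  have hLg : ∀ {F : ℕ → Θ × K}, ∀ {q : Θ × K}, Tendsto F g (𝓝 q) →
      Tendsto (fun n => copulaLogLik n y x (F n).1 (F n).2) g
      (𝓝 (∫ w, condLogDensity q.2 (pathLatent θ₀ q.1 w) (obsPath θ₀ w 0) ∂pathLaw P U X)) :=
    fun hF => TendstoUniformly.tendsto_comp (fun u hu => hg (hw2 u hu)) hc2.continuousAt hF
  -- The limiting contrast at `θ'` is at most that at `θ₀`, so `θ'` shares the true latent values,
  -- through which alone the limiting likelihood depends on it.
  have hlat : pathLatent θ₀ θ' =ᵐ[pathLaw P U X] pathLatent θ₀ θ₀ := by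
    refine h.ae_pathLatent_eq_of_integral_le θ'.2 ?_
    refine le_of_tendsto_of_tendsto (hQg hθ')
      (hQg (F := fun _ => ⟨θ₀, h.mem⟩) (θ := ⟨θ₀, h.mem⟩) tendsto_const_nhds) ?_
    filter_upwards [hge] with n hn
    obtain ⟨h1, h2⟩ := hQmin n hn
    simpa only [T, dif_pos h1] using h2
  have hle := le_of_tendsto_of_tendsto
    (hLg (hθ'.prodMk_nhds (tendsto_const_nhds (x := (⟨r₀, hr₀⟩ : K)))))
    (hLg (hθ'.prodMk_nhds hr')) (by
      filter_upwards [hge] with n hn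
      have h1 := isMaxOn_iff.1 (hr n hn).2 r₀ hr₀
      simpa only [hT n hn, hS n hn] using h1)
  have hcongr : ∀ r : ℝ, ∫ w, condLogDensity r (pathLatent θ₀ θ' w) (obsPath θ₀ w 0)
      ∂pathLaw P U X = ∫ w, condLogDensity r (pathLatent θ₀ θ₀ w) (obsPath θ₀ w 0)
      ∂pathLaw P U X := fun r => integral_congr_ae (by
    filter_upwards [hlat] with w hw
    rw [hw])
  simp only [hcongr] at hle
  have heq : (r' : ℝ) = r₀ := h.eq_of_integral_condLogDensity_le hK hK1 hr₀ r'.2 hle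
  rw [← heq]
  refine ((continuous_subtype_val.tendsto r').comp hr').congr' ?_
  filter_upwards [hge] with n hn
  exact hS n hn

end ModelSetting

end SecondStepLimit

/-! ### Strong consistency on the original probability space. -/

theorem mainTheorem10 {Ω : Type*} [MeasurableSpace Ω] (P : Measure Ω) [IsProbabilityMeasure P]
    (m : ℕ) (U : ℤ → Ω → Fin 2 → ℝ) (X : ℤ → Ω → Fin m → ℝ)
    (Y : ℤ → Ω → ℝ × ℕ) (lam : ℤ → Ω → Fin 2 → ℝ)
    -- parameter sets and true parameters
    (Θ : Set (Param m)) (hΘ : IsCompact Θ) (θ₀ : Param m) (hθ₀ : θ₀ ∈ Θ)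
    (K : Set ℝ) (hK : IsCompact K) (hK1 : K ⊆ Set.Ioo (-1) 1) (r₀ : ℝ) (hr₀ : r₀ ∈ K)
    (dmin : ℝ) (hdmin : 0 < dmin) (hd : ∀ θ ∈ Θ, ∀ i, dmin ≤ θ.d i)
    (hA : ∀ θ ∈ Θ, ∀ i j, 0 ≤ θ.A i j) (hB : ∀ θ ∈ Θ, ∀ i j, 0 ≤ θ.B i j)
    (hΓ : ∀ θ ∈ Θ, ∀ i j, 0 ≤ θ.Γ i j)
    -- noise, covariates and the observed process
    (hUX : NoiseAssumption P U X)
    (hU : ∀ t, P.map (U t) = gaussianCopula (corrMatrix r₀))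
    (hX : ∀ θ ∈ Θ, ∀ t, ∀ᵐ ω ∂P, ∀ i, 0 ≤ (θ.Γ *ᵥ X t ω) i)
    (δ : ℝ) (hδ : 0 < δ) (hXmom : Integrable (fun ω => (∑ i, |X 0 ω i|) ^ (1 + δ)) P)
    (hstab : specRadius (θ₀.A + θ₀.B) < 1)
    (hY : IsSolution P θ₀ U X Y lam)
    -- identification
    (hI0 : ∀ θ ∈ Θ, specRadius θ.B < 1)
    (hI1 : CovariateInnovation P U X ∨ StrictExogeneity P U X)
    (hI3 : FeedbackIdentified Θ θ₀)
    -- first step, with the latent process started at `l₀` or with the stationary one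
    (l₀ : Fin 2 → ℝ) (hl₀ : ∀ i, 0 ≤ l₀ i) (θhat : ℕ → Ω → Param m)
    (hθhat :
      (∀ᵐ ω ∂P, ∀ n, 1 ≤ n → IsPseudoMLE Θ n (fun t => Y t ω)
        (fun θ => initLatent l₀ θ (fun t => Y t ω) (fun t => X t ω)) (θhat n ω)) ∨
      (∀ᵐ ω ∂P, ∀ n, 1 ≤ n → IsPseudoMLE Θ n (fun t => Y t ω)
        (fun θ t => latent θ (fun t => Y t ω) (fun t => X t ω) t) (θhat n ω)))
    -- second step
    (rhat : ℕ → Ω → ℝ)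
    (hrhat : ∀ᵐ ω ∂P, ∀ n, 1 ≤ n →
      IsCopulaMLE K n (fun t => Y t ω) (fun t => X t ω) (θhat n ω) (rhat n ω)) :
    ∀ᵐ ω ∂P, Tendsto (fun n => rhat n ω) atTop (𝓝 r₀) := by
  have h : ModelSetting P U X Y lam Θ θ₀ r₀ dmin δ :=
    { compact := hΘ, mem := hθ₀, corr_mem := hK1 hr₀, dmin_pos := hdmin, dmin_le := hd,
      A_nonneg := hA, B_nonneg := hB, noise := hUX, law := hU, cov_nonneg := hX, delta_pos := hδ,
      moment := hXmom, stab := hstab, sol := hY, specB := hI0 }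
  -- The sequences of estimators are quantified inside the almost sure statement, so they can be
  -- substituted path by path, with no measurability in `ω`.
  have hmain := ae_of_ae_map h.measurable_drivingPath.aemeasurable
    (h.ae_tendsto_rhat hK hK1 hr₀ hl₀)
  rcases hθhat with hθhat | hθhat
  · filter_upwards [hmain, h.ae_obs_eq, hθhat, hrhat] with ω h1 h2 h3 h4
    rw [← h2] at h1
    exact h1 (fun n => θhat n ω) (fun n => rhat n ω) (Or.inl h3) h4
  · filter_upwards [hmain, h.ae_obs_eq, hθhat, hrhat] with ω h1 h2 h3 h4
    rw [← h2] at h1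
    exact h1 (fun n => θhat n ω) (fun n => rhat n ω) (Or.inr h3) h4
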